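/- \textbf{Setting.} Consider the linear advection equation $u_t+\nabla\cdot\boldsymbol f(u)=0$ with periodic boundary conditions, with $f(u)=\beta_1u$ on an interval (partitioned into cells $[x_{i-1/2},x_{i+1/2}]$ of length $h_i$, $h=\max_i h_i\le\sigma\min_i h_i$; $1/\tau_{\max}=|\beta_1|/(C_{\rm CFL}h)$), or $\boldsymbol f(u)=(\beta_1u,\beta_2u)$ on a rectangle (uniform Cartesian mesh of sizes $h_x,h_y$, $h=\max(h_x,h_y)\le\sigma\min(h_x,h_y)$; $1/\tau_{\max}=(|\beta_1|/h_x+|\beta_2|/h_y)/C_{\rm CFL}$), where $C_{\rm CFL}>0$. The dual cells are $[x_i,x_{i+1}]$, resp. $[x_i,x_{i+1}]\times[y_j,y_{j+1}]$, with $x_i,y_j$ the midpoints of the primal cells, and everything is continued periodically. Let $V_h$, $W_h$ be the spaces of piecewise polynomials of degree at most $k$ on the primal and on the dual mesh, $\langle\boldsymbol u,\boldsymbol\varphi\rangle=\int_\Omega u_1\varphi_1+u_2\varphi_2$, $\|\boldsymbol u\|^2=\langle\boldsymbol u,\boldsymbol u\rangle$, and on $V_h\times W_h$ let $$\mathcal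 H(\boldsymbol u,\boldsymbol\varphi)=-\frac1{\tau_{\max}}\int_\Omega(u_1-u_2)(\varphi_1-\varphi_2)+\sum_{C}\Big(\int_C\boldsymbol f(u_2)\cdot\nabla\varphi_1-\int_{\partial C}\boldsymbol f(u_2)\cdot\boldsymbol n\,\varphi_1\Big)+\sum_{D}\Big(\int_D\boldsymbol f(u_1)\cdot\nabla\varphi_2-\int_{\partial D}\boldsymbol f(u_1)\cdot\boldsymbol n\,\varphi_2\Big),$$ the sums running over the primal cells $C$ and the dual cells $D$, with gradients taken cellwise and with the traces of $\varphi_1,\varphi_2$ taken from inside the cell (central discontinuous Galerkin, CDG, discretization). Given an explicit $s$-stage Runge--Kutta method of order $r\ge1$ with coefficients $c_{l\nu},d_{l\nu}$ and a time step $\tau>0$, the RKCDG method computes $\boldsymbol u^{n+1}=\boldsymbol u^{n,s}$ from $\boldsymbol u^{n,0}=\boldsymbol u^n\in V_h\times W_h$ by $$\langle\boldsymbol u^{n,l+1},\boldsymbol\varphi\rangle=\sum_{0\le\nu\le l}\big(c_{l\nu}\langle\boldsymbol u^{n,\nu},\boldsymbol\varphi\rangle+\tau d_{l\nu}\mathcal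 H(\boldsymbol u^{n,\nu},\boldsymbol\varphi)\big)\quad\text{for all }\boldsymbol\varphi\in V_h\times W_h,\ 0\le l<s.$$ Define $\mathbb D_i$ by $\mathbb D_0\boldsymbol u=\boldsymbol u$, $\langle\mathbb D_i\boldsymbol u,\boldsymbol\varphi\rangle=\tau\mathcal H(\mathbb D_{i-1}\boldsymbol u,\boldsymbol\varphi)$ for all $\boldsymbol\varphi$. Fix $m$; combining $m$ steps of the method and substituting formally gives $\alpha_0\boldsymbol u^{n+m}=\sum_{0\le i\le ms}\alpha_i\mathbb D_i\boldsymbol u^n$ with constants $\alpha_i$, $\alpha_0>0$, determined up to a positive common factor by the Runge--Kutta coefficients and $m$. Put $\alpha_i=0$ for $i>ms$. Define symmetric matrices $\mathbb A^{(\ell)}=(a^{(\ell)}_{ij})$, $\mathbb B^{(\ell)}=(b^{(\ell)}_{ij})$ through their entries with $j\le i$: $a^{(0)}_{00}=0$, $a^{(0)}_{ij}=\alpha_i\alpha_j$ for $i+j>0$, $b^{(0)}_{ij}=0$, and $$a^{(\ell+1)}_{ij}=\begin{cases}0,&j\le\ell,\\a^{(\ell)}_{ij}-2a^{(\ell)}_{i+1,j-1},&i=j=\ell+1,\\a^{(\ell)}_{ij}-a^{(\ell)}_{i+1,j-1},&i\ge\ell+2,\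 j=\ell+1,\\a^{(\ell)}_{ij},&\text{otherwise},\end{cases}\qquad b^{(\ell+1)}_{ij}=\begin{cases}2a^{(\ell)}_{i+1,j},&i\ge\ell,\ j=\ell,\\b^{(\ell)}_{ij},&\text{otherwise}.\end{cases}$$ Assume that there is an $\ell$ with $a^{(\ell)}_{\ell\ell}\ne0$, and let the termination index $\zeta$ be the smallest one. Let the contribution index $\rho$ be the largest $\kappa\in\{0,\dots,\zeta\}$ such that the leading principal submatrix of order $\kappa$ (rows and columns $0,\dots,\kappa-1$) of $\mathbb B^{(\zeta)}$ is positive definite (the empty matrix counts as positive definite). \textbf{Theorem.} All constants below are independent of the mesh (with $\sigma$ fixed), of $\tau$, of $n$ and of the numerical solution, and every solution $(\boldsymbol u^n)_{n\ge0}$ of the RKCDG method satisfies the following, in one and in two dimensions. \begin{enumerate} \item If $\rho=\zeta$ and $a^{(\zeta)}_{\zeta\zeta}<0$, the method is monotonically stable: there is $C>0$ such that $\|\boldsymbol u^{n+m}\|\le\|\boldsymbol u^n\|$ for all $n$ whenever $\tau\le Ch$. \item If $\rho=\zeta$ and $a^{(\zeta)}_{\zeta\zeta}>0$, the method is weak$(2\zeta)$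 stable: there are $\lambda_0>0$ and $C>0$ such that $\|\boldsymbol u^{n+m}\|^2\le(1+C\tau)\|\boldsymbol u^n\|^2$ for all $n$ whenever $\tau/h\le\lambda_0$ and $\tau\le h^{1+\frac1{2\zeta-1}}$. \item If $\rho<\zeta$, the method is weak$(2\rho+1)$ stable: there are $\lambda_0>0$ and $C>0$ such that $\|\boldsymbol u^{n+m}\|^2\le(1+C\tau)\|\boldsymbol u^n\|^2$ for all $n$ whenever $\tau/h\le\lambda_0$ and $\tau\le h^{1+\frac1{2\rho}}$. \end{enumerate} -/

import Mathlib

open scoped BigOperators Topology ContDiff Polynomial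

noncomputable section

/-! ## Explicit Runge–Kutta methods -/

/-- An explicit `s`-stage Runge–Kutta method with coefficients `c l m`, `d l m`
(`0 ≤ m ≤ l < s`; the other entries are never used). -/
structure RKMethod where
  s : ℕ
  c : ℕ → ℕ → ℝ
  d : ℕ → ℕ → ℝ

namespace RKMethod

/-- The stages `y⁰ = u`, `y^{l+1} = ∑_{m ≤ l} (c_{lm} y^m + d_{lm} F(y^m))`, where `F` is the
time step size times the right-hand side. -/
def stage (R : RKMethod) {E : Type*} [AddCommGroup E] [Module ℝ E] (F : E → E) (u : E) : ℕ → E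
  | 0 => u
  | l + 1 => ∑ m : Fin (l + 1),
      (R.c l m • stage R F u m + R.d l m • F (stage R F u m))
  termination_by l => l
  decreasing_by all_goals exact m.2

/-- The method has order (at least) `r`: for each smooth autonomous system `y' = f(y)`, the error
after one step from exact data is `O(τ^{r+1})`. -/
def HasOrder (R : RKMethod) (r : ℕ) : Prop :=
  ∀ (n : ℕ) (f : EuclideanSpace ℝ (Fin n) → EuclideanSpace ℝ (Fin n)), ContDiff ℝ ∞ f →
    ∀ y : ℝ → EuclideanSpace ℝ (Fin n), (∀ᶠ t in 𝓝 0, HasDerivAt y (f (y t)) t) →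
      (fun τ : ℝ => R.stage (fun v => τ • f v) (y 0) R.s - y τ) =O[𝓝[>] 0]
        fun τ : ℝ => τ ^ (r + 1)

/-- The result of one step, written formally as a polynomial in `X`, where `X ^ i` stands for the
temporal difference operator `𝔻_i` (so that applying `τ ℋ` is multiplication by `X`). -/
def stabPoly (R : RKMethod) : ℝ[X] :=
  R.stage (fun p : ℝ[X] => Polynomial.X * p) 1 R.s

end RKMethod

/-- `α 0 > 0`, and `α 0 • u^{n+m} = ∑ i, α i • 𝔻_i u^n` is the evolution identity obtained by
combining `m` steps of the method. -/
def IsEvolutionCoeff (R : RKMethod) (m : ℕ) (α : ℕ → ℝ) : Prop :=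
  0 < α 0 ∧ ∀ i, α i = α 0 * (R.stabPoly ^ m).coeff i

/-! ## Matrix transferring

The matrices are symmetric; `aLow` and `bLow` are meaningful in the lower triangle `j ≤ i`.
Since `α i = 0` for `i > m s`, all entries with `i > m s` vanish and the index ranges need no
upper bound. -/

/-- Lower triangle of `𝔸^{(ℓ)}`: `aLow α ℓ i j = a_{ij}^{(ℓ)}` for `j ≤ i`. -/
def aLow (α : ℕ → ℝ) : ℕ → ℕ → ℕ → ℝ
  | 0, i, j => if i + j = 0 then 0 else α i * α j
  | ℓ + 1, i, j =>
      if j ≤ ℓ then 0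
      else if i = ℓ + 1 ∧ j = ℓ + 1 then aLow α ℓ i j - 2 * aLow α ℓ (i + 1) (j - 1)
      else if ℓ + 2 ≤ i ∧ j = ℓ + 1 then aLow α ℓ i j - aLow α ℓ (i + 1) (j - 1)
      else aLow α ℓ i j

/-- Lower triangle of `𝔹^{(ℓ)}`: `bLow α ℓ i j = b_{ij}^{(ℓ)}` for `j ≤ i`. -/
def bLow (α : ℕ → ℝ) : ℕ → ℕ → ℕ → ℝ
  | 0, _, _ => 0
  | ℓ + 1, i, j => if ℓ ≤ i ∧ j = ℓ then 2 * aLow α ℓ (i + 1) j else bLow α ℓ i j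

/-- The leading principal submatrix of order `κ` of the symmetric matrix `𝔹^{(ℓ)}`
(rows and columns `0, …, κ - 1`). -/
def bSub (α : ℕ → ℝ) (ℓ κ : ℕ) : Matrix (Fin κ) (Fin κ) ℝ :=
  Matrix.of fun i j => bLow α ℓ (max (i : ℕ) j) (min (i : ℕ) j)

/-- `ζ` is the first `ℓ` for which `a_{ℓℓ}^{(ℓ)} ≠ 0`. -/
def IsTerminationIndex (α : ℕ → ℝ) (ζ : ℕ) : Prop :=
  IsLeast {ℓ : ℕ | aLow α ℓ ℓ ℓ ≠ 0} ζ

/-- `ρ` is the largest `κ ≤ ζ` for which the leading principal submatrix of order `κ` of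
`𝔹^{(ζ)}` is positive definite (the empty matrix, `κ = 0`, is). -/
def IsContributionIndex (α : ℕ → ℝ) (ζ ρ : ℕ) : Prop :=
  IsGreatest {κ : ℕ | κ ≤ ζ ∧ (bSub α ζ κ).PosDef} ρ

/-! ## Fully discrete schemes and their stability -/

/-- The data of a spatial discretization: the discrete space, its `L²` inner product, the form
`ℋ`, and the mesh size `h`. Only the concrete instances `cdg1D` and `cdg2D` below are used. -/
structure SemiDiscretization where
  V : Type
  ip : V → V → ℝ
  H : V → V → ℝ
  h : ℝ

/-- The `L²` norm. -/
def SemiDiscretization.nrm (S : SemiDiscretization) (u : S.V) : ℝ := √(S.ip u u)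

/-- `u 0, u 1, …` is a solution of the fully discrete scheme with time step `τ`: each step
consists of stages `y 0 = u n, …, y s = u (n+1)` with
`⟨y (l+1), φ⟩ = ∑_{m ≤ l} (c_{lm} ⟨y m, φ⟩ + τ d_{lm} ℋ(y m, φ))` for all test functions `φ`. -/
def SemiDiscretization.IsRKSolution (S : SemiDiscretization) (R : RKMethod) (τ : ℝ)
    (u : ℕ → S.V) : Prop :=
  ∀ n, ∃ y : ℕ → S.V, y 0 = u n ∧ y R.s = u (n + 1) ∧
    ∀ l < R.s, ∀ φ : S.V, S.ip (y (l + 1)) φ =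
      ∑ m ∈ Finset.range (l + 1), (R.c l m * S.ip (y m) φ + τ * R.d l m * S.H (y m) φ)

/-- Monotone stability of the scheme on a family `𝓕` of discretizations, `m` steps combined: the
constant `C` is the same for the whole family. -/
def MonotonicallyStable (R : RKMethod) (m : ℕ) (𝓕 : Set SemiDiscretization) : Prop :=
  ∃ C > 0, ∀ S ∈ 𝓕, ∀ τ > 0, τ ≤ C * S.h →
    ∀ u : ℕ → S.V, S.IsRKSolution R τ u → ∀ n, S.nrm (u (n + m)) ≤ S.nrm (u n)

/-- Weak(`q`) stability on a family `𝓕`: for `λ = τ / h` sufficiently small and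
`τ ≤ h ^ (1 + 1 / (q - 1))`, one has `‖u (n+m)‖² ≤ (1 + C τ) ‖u n‖²`. -/
def WeaklyStable (q : ℕ) (R : RKMethod) (m : ℕ) (𝓕 : Set SemiDiscretization) : Prop :=
  ∃ lam₀ > 0, ∃ C > 0, ∀ S ∈ 𝓕, ∀ τ > 0, τ / S.h ≤ lam₀ →
    τ ≤ S.h ^ (1 + 1 / ((q : ℝ) - 1)) →
      ∀ u : ℕ → S.V, S.IsRKSolution R τ u →
        ∀ n, S.nrm (u (n + m)) ^ 2 ≤ (1 + C * τ) * S.nrm (u n) ^ 2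

/-! ## Integration over overlapping periodic cells

Cells are indexed cyclically by `Fin N`. In one direction the primal cell `i` is
`[x_{i-1/2}, x_{i+1/2}]` and the dual cell `i` is `[x_i, x_{i+1}]` (so the primal cell `i` meets the
dual cells `i - 1` and `i`). Points of the primal cell `i` carry the local coordinate
`ξ = x - x_i`, points of the dual cell `i` the local coordinate `η = x - x_{i+1/2}`. -/

/-- Integral over the primal cell `i`, of length `h`; `F j ξ η` is the integrand on the overlap with
the dual cell `j`, at the point with local coordinates `ξ` and `η`. -/
def primalInt {N : ℕ} [NeZero N] (h : ℝ) (i : Fin N) (F : Fin N → ℝ → ℝ → ℝ) : ℝ :=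
  (∫ ξ in (-(h / 2))..0, F (i - 1) ξ (ξ + h / 2)) + ∫ ξ in (0 : ℝ)..(h / 2), F i ξ (ξ - h / 2)

/-- Integral over the dual cell `i` of a uniform mesh of size `h`; `F j ξ η` is the integrand on the
overlap with the primal cell `j`. -/
def dualInt {N : ℕ} [NeZero N] (h : ℝ) (i : Fin N) (F : Fin N → ℝ → ℝ → ℝ) : ℝ :=
  (∫ η in (-(h / 2))..0, F i (η + h / 2) η) + ∫ η in (0 : ℝ)..(h / 2), F (i + 1) (η - h / 2) η

/-! ## The central discontinuous Galerkin method in one dimension -/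

/-- A partition of `[a, b]` into `N` cells `[node i, node (i+1)]`. -/
structure Mesh1D (a b : ℝ) (N : ℕ) where
  node : Fin (N + 1) → ℝ
  strictMono : StrictMono node
  first : node 0 = a
  last : node (Fin.last N) = b

namespace Mesh1D

variable {a b : ℝ} {N : ℕ}

/-- The length of the primal cell `i`. -/
def size (M : Mesh1D a b N) (i : Fin N) : ℝ := M.node i.succ - M.node i.castSucc

/-- The mesh size `h`, the largest cell length. -/
def h (M : Mesh1D a b N) : ℝ := ⨆ i, M.size i

/-- Quasi-uniformity with ratio `σ`. -/
def QuasiUniform (M : Mesh1D a b N) (σ : ℝ) : Prop := ∀ i, M.h ≤ σ * M.size i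

/-- `∫_Ω`; `F i j ξ η` is the integrand on the overlap of the primal cell `i` and the dual
cell `j`. -/
def integral [NeZero N] (M : Mesh1D a b N) (F : Fin N → Fin N → ℝ → ℝ → ℝ) : ℝ :=
  ∑ i, primalInt (M.size i) i (F i)

end Mesh1D

/-- `V_h × W_h`: a polynomial of degree at most `k`, in the local coordinate, on every primal cell
and on every dual cell. -/
abbrev Space1D (k N : ℕ) : Type :=
  (Fin N → Polynomial.degreeLT ℝ (k + 1)) × (Fin N → Polynomial.degreeLT ℝ (k + 1))

namespace Space1D

variable {k N : ℕ}

/-- The value of the first component on the primal cell `i`. -/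
def fst (u : Space1D k N) (i : Fin N) (ξ : ℝ) : ℝ := (u.1 i : ℝ[X]).eval ξ

/-- The value of the second component on the dual cell `j`. -/
def snd (u : Space1D k N) (j : Fin N) (η : ℝ) : ℝ := (u.2 j : ℝ[X]).eval η

/-- The derivative of the first component on the primal cell `i`. -/
def dfst (u : Space1D k N) (i : Fin N) (ξ : ℝ) : ℝ := (u.1 i : ℝ[X]).derivative.eval ξ

/-- The derivative of the second component on the dual cell `j`. -/
def dsnd (u : Space1D k N) (j : Fin N) (η : ℝ) : ℝ := (u.2 j : ℝ[X]).derivative.eval η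

end Space1D

/-- `τ_max = C_CFL h / |β|`. (For `β = 0` it only enters through `1 / τ_max`, which is then `0`.) -/
def tauMax1D (β CCFL h : ℝ) : ℝ := CCFL * h / |β|

/-- The form `ℋ` of the one-dimensional method with flux `f(u) = β u` and periodic boundary
conditions. In the sum, `x_{i+1/2}` is the point `η = 0` of the dual cell `i` and the right end of
the primal cell `i`; `x_i` is the point `ξ = 0` of the primal cell `i` and the left end of the dual
cell `i`. -/
def H1D {a b : ℝ} {k N : ℕ} [NeZero N] (β CCFL : ℝ) (M : Mesh1D a b N)
    (u φ : Space1D k N) : ℝ :=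
  -(1 / tauMax1D β CCFL M.h) *
      M.integral (fun i j ξ η => (u.fst i ξ - u.snd j η) * (φ.fst i ξ - φ.snd j η))
    + M.integral (fun i j ξ η => β * u.snd j η * φ.dfst i ξ + β * u.fst i ξ * φ.dsnd j η)
    - ∑ i : Fin N,
        (β * u.snd i 0 * φ.fst i (M.size i / 2)
          - β * u.snd (i - 1) 0 * φ.fst i (-(M.size i / 2))
          + β * u.fst (i + 1) 0 * φ.snd i (M.size (i + 1) / 2)
          - β * u.fst i 0 * φ.snd i (-(M.size i / 2)))

/-- The `ℙ^k` central discontinuous Galerkin discretization on a one-dimensional mesh. -/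
def cdg1D {a b : ℝ} {N : ℕ} [NeZero N] (k : ℕ) (β CCFL : ℝ) (M : Mesh1D a b N) :
    SemiDiscretization where
  V := Space1D k N
  ip u φ := M.integral (fun i j ξ η => u.fst i ξ * φ.fst i ξ + u.snd j η * φ.snd j η)
  H := H1D β CCFL M
  h := M.h

/-- All these discretizations, on quasi-uniform meshes with ratio `σ`. -/
def cdgFamily1D (k : ℕ) (β CCFL σ : ℝ) : Set SemiDiscretization :=
  {S | ∃ (a b : ℝ) (N : ℕ) (_ : NeZero N) (M : Mesh1D a b N),
    M.QuasiUniform σ ∧ S = cdg1D k β CCFL M}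

/-! ## The central discontinuous Galerkin method in two dimensions -/

/-- The uniform Cartesian mesh of `[xmin, xmax] × [ymin, ymax]` with `Nx × Ny` cells. -/
structure Mesh2D (Nx Ny : ℕ) where
  xmin : ℝ
  xmax : ℝ
  ymin : ℝ
  ymax : ℝ
  x_lt : xmin < xmax
  y_lt : ymin < ymax

namespace Mesh2D

variable {Nx Ny : ℕ}

def hx (M : Mesh2D Nx Ny) : ℝ := (M.xmax - M.xmin) / Nx

def hy (M : Mesh2D Nx Ny) : ℝ := (M.ymax - M.ymin) / Ny

/-- The mesh size. -/
def h (M : Mesh2D Nx Ny) : ℝ := max M.hx M.hy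

/-- The aspect ratio of the cells is at most `σ`. -/
def ShapeRegular (M : Mesh2D Nx Ny) (σ : ℝ) : Prop := M.h ≤ σ * min M.hx M.hy

/-- `∫_Ω`; `F (i, j) (i', j') ξ₁ ξ₂ η₁ η₂` is the integrand on the overlap of the primal cell
`(i, j)` and the dual cell `(i', j')`, at the point with local coordinates `(ξ₁, ξ₂)` and
`(η₁, η₂)`. -/
def integral [NeZero Nx] [NeZero Ny] (M : Mesh2D Nx Ny)
    (F : Fin Nx × Fin Ny → Fin Nx × Fin Ny → ℝ → ℝ → ℝ → ℝ → ℝ) : ℝ :=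
  ∑ i, ∑ j, primalInt M.hx i fun i' ξ₁ η₁ => primalInt M.hy j fun j' ξ₂ η₂ =>
    F (i, j) (i', j') ξ₁ ξ₂ η₁ η₂

end Mesh2D

/-- `V_h × W_h`: a polynomial of total degree at most `k` in two variables, in the local
coordinates, on every primal cell and on every dual cell. -/
abbrev Space2D (k Nx Ny : ℕ) : Type :=
  (Fin Nx × Fin Ny → MvPolynomial.restrictTotalDegree (Fin 2) ℝ k) ×
    (Fin Nx × Fin Ny → MvPolynomial.restrictTotalDegree (Fin 2) ℝ k)

namespace Space2D

variable {k Nx Ny : ℕ}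

/-- The value of the first component on the primal cell `c`. -/
def fst (u : Space2D k Nx Ny) (c : Fin Nx × Fin Ny) (x y : ℝ) : ℝ :=
  MvPolynomial.eval ![x, y] (u.1 c : MvPolynomial (Fin 2) ℝ)

/-- The value of the second component on the dual cell `c`. -/
def snd (u : Space2D k Nx Ny) (c : Fin Nx × Fin Ny) (x y : ℝ) : ℝ :=
  MvPolynomial.eval ![x, y] (u.2 c : MvPolynomial (Fin 2) ℝ)

/-- The partial derivative of the first component in direction `e` (`0` for `x`, `1` for `y`). -/
def dfst (u : Space2D k Nx Ny) (e : Fin 2) (c : Fin Nx × Fin Ny) (x y : ℝ) : ℝ :=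
  MvPolynomial.eval ![x, y] (MvPolynomial.pderiv e (u.1 c : MvPolynomial (Fin 2) ℝ))

/-- The partial derivative of the second component in direction `e`. -/
def dsnd (u : Space2D k Nx Ny) (e : Fin 2) (c : Fin Nx × Fin Ny) (x y : ℝ) : ℝ :=
  MvPolynomial.eval ![x, y] (MvPolynomial.pderiv e (u.2 c : MvPolynomial (Fin 2) ℝ))

end Space2D

/-- `τ_max = C_CFL / (|β₁| / h_x + |β₂| / h_y)`. (For `β₁ = β₂ = 0` it only enters through
`1 / τ_max`, which is then `0`.) -/
def tauMax2D (β₁ β₂ CCFL hx hy : ℝ) : ℝ := CCFL / (|β₁| / hx + |β₂| / hy)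

/-- The form `ℋ` of the two-dimensional method with flux `f(u) = (β₁ u, β₂ u)` and periodic boundary
conditions. The edge integrals are, in this order, those over the horizontal and the vertical
edges of the primal cells, and over the horizontal and the vertical edges of the dual cells. -/
def H2D {k Nx Ny : ℕ} [NeZero Nx] [NeZero Ny] (β₁ β₂ CCFL : ℝ) (M : Mesh2D Nx Ny)
    (u φ : Space2D k Nx Ny) : ℝ :=
  -(1 / tauMax2D β₁ β₂ CCFL M.hx M.hy) *
      M.integral (fun c d ξ₁ ξ₂ η₁ η₂ =>
        (u.fst c ξ₁ ξ₂ - u.snd d η₁ η₂) * (φ.fst c ξ₁ ξ₂ - φ.snd d η₁ η₂))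
    + M.integral (fun c d ξ₁ ξ₂ η₁ η₂ =>
        u.snd d η₁ η₂ * (β₁ * φ.dfst 0 c ξ₁ ξ₂ + β₂ * φ.dfst 1 c ξ₁ ξ₂)
        + u.fst c ξ₁ ξ₂ * (β₁ * φ.dsnd 0 d η₁ η₂ + β₂ * φ.dsnd 1 d η₁ η₂))
    - ∑ i : Fin Nx, ∑ j : Fin Ny,
        (primalInt M.hx i (fun i' ξ η =>
            β₂ * u.snd (i', j) η 0 * φ.fst (i, j) ξ (M.hy / 2)
            - β₂ * u.snd (i', j - 1) η 0 * φ.fst (i, j) ξ (-(M.hy / 2)))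
        + primalInt M.hy j (fun j' ξ η =>
            β₁ * u.snd (i, j') 0 η * φ.fst (i, j) (M.hx / 2) ξ
            - β₁ * u.snd (i - 1, j') 0 η * φ.fst (i, j) (-(M.hx / 2)) ξ)
        + dualInt M.hx i (fun i' ξ η =>
            β₂ * u.fst (i', j + 1) ξ 0 * φ.snd (i, j) η (M.hy / 2)
            - β₂ * u.fst (i', j) ξ 0 * φ.snd (i, j) η (-(M.hy / 2)))
        + dualInt M.hy j (fun j' ξ η =>
            β₁ * u.fst (i + 1, j') 0 ξ * φ.snd (i, j) (M.hx / 2) η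
            - β₁ * u.fst (i, j') 0 ξ * φ.snd (i, j) (-(M.hx / 2)) η))

/-- The `ℙ^k` central discontinuous Galerkin discretization on a uniform Cartesian mesh. -/
def cdg2D {Nx Ny : ℕ} [NeZero Nx] [NeZero Ny] (k : ℕ) (β₁ β₂ CCFL : ℝ) (M : Mesh2D Nx Ny) :
    SemiDiscretization where
  V := Space2D k Nx Ny
  ip u φ := M.integral (fun c d ξ₁ ξ₂ η₁ η₂ =>
    u.fst c ξ₁ ξ₂ * φ.fst c ξ₁ ξ₂ + u.snd d η₁ η₂ * φ.snd d η₁ η₂)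
  H := H2D β₁ β₂ CCFL M
  h := M.h

/-- All these discretizations, with aspect ratio at most `σ`. -/
def cdgFamily2D (k : ℕ) (β₁ β₂ CCFL σ : ℝ) : Set SemiDiscretization :=
  {S | ∃ (Nx Ny : ℕ) (_ : NeZero Nx) (_ : NeZero Ny) (M : Mesh2D Nx Ny),
    M.ShapeRegular σ ∧ S = cdg2D k β₁ β₂ CCFL M}

end

/-!
# Stability of Runge–Kutta central discontinuous Galerkin methods

On each discretization, `⟨L u, φ⟩ = ℋ(u, φ)` defines an operator `L` with two properties, uniform in
the mesh: it is dissipative, `⟨L u, u⟩ ≤ 0`, and `‖L‖ ≤ K / h`. Nothing else about the scheme is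
used (`HasDissipativeOperator`).

Dissipativity holds because on each overlap of a primal and a dual cell the transport terms of
`ℋ(u, u)` are the derivative of the product `u₁ u₂`, whose boundary values are exactly the edge
terms; what is left is `-(1 / τ_max) ∫ (u₁ - u₂)²` (`H1D_self`, `H2D_self`). The norm bound is an
inverse estimate. By compactness of the unit sphere of coefficient vectors, values and derivatives
of a polynomial on a cell are controlled by its `L²` norm on one half of the cell
(`exists_inverse_estimate`); in two dimensions this is applied in each coordinate. Since a dual cell
shares a half, or in two dimensions a quarter, with the primal cell of the same index, every term of
`ℋ` is bounded by the local energies of neighbouring primal cells.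

A solution satisfies `u^{n+m} = P(τ L)^m u^n` with the stability polynomial `P`, so that
`α₀ u^{n+m} = ∑ α_i w_i` with `w_i = (τ L)^i u^n`. With the dissipation form
`q(u, v) = -(⟨τ L u, v⟩ + ⟨u, τ L v⟩) / 2`, which is symmetric and positive semidefinite, one has
`⟨w_{i+1}, w_j⟩ = -⟨w_i, w_{j+1}⟩ - 2 q(w_i, w_j)`, and the passage from `𝔸^{(ℓ)}` to `𝔸^{(ℓ+1)}` is
this summation by parts, with `𝔹` recording the dissipation (`energy_identity`). The result is
`α₀² (‖u^{n+m}‖² - ‖u^n‖²) = ∑ a_{ij} ⟨w_i, w_j⟩ - ∑ b_{ij} q(w_i, w_j)`, where only `i, j ≥ ζ`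
contribute to the first sum. Positive definiteness of the leading block of order `ρ` bounds the
second sum below by `-C ∑_{i ≥ ρ} q(w_i, w_i)` (`exists_dissipation_lower_bound`). With
`κ = K τ / h ≥ ‖τ L‖` this gives the bound
`(a_{ζζ} + C₁ κ) ‖w_ζ‖² + C₂ κ ‖w_ρ‖²` (`exists_energy_estimate`), from which the three regimes are
read off, as `‖w_i‖ ≤ κ^i ‖u^n‖` and the time step restriction amounts to `(τ / h)^q ≤ τ`. The order
of the method enters through `ρ ≥ 1` (`one_le_contributionIndex`), without which the exponent
`1 + 1 / (2 ρ)` would be meaningless.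
-/

noncomputable section

/-! ### Matrix transferring as summation by parts -/

/-- The multiplicity with which the lower-triangular entry `(i, j)` of a symmetric matrix occurs in
the associated quadratic form. -/
def triWeight (i j : ℕ) : ℝ := if i < j then 0 else if i = j then 1 else 2

lemma triWeight_of_gt {i j : ℕ} (h : j < i) : triWeight i j = 2 := by
  rw [triWeight, if_neg (by omega), if_neg (by omega)]

/-- The weighted lower-triangular sum is the full sum over the symmetric extension. -/
lemma sum_triWeight (M : ℕ) (f : ℕ → ℕ → ℝ) :
    ∑ j ∈ Finset.range M, ∑ i ∈ Finset.range M, triWeight i j * f i j =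
      ∑ i ∈ Finset.range M, ∑ j ∈ Finset.range M, f (max i j) (min i j) := by
  set g : ℕ → ℕ → ℝ := fun i j => if j < i then f i j else 0 with hg
  set d : ℕ → ℕ → ℝ := fun i j => if i = j then f i j else 0 with hd
  have h1 : ∀ i j, triWeight i j * f i j = g i j + g i j + d i j := by
    intro i j
    rcases lt_trichotomy i j with h | h | h
    · simp [hg, hd, triWeight, h, h.ne, not_lt.2 h.le]
    · simp [hg, hd, triWeight, h]
    · simp [hg, hd, triWeight, h, h.ne', not_lt.2 h.le]; ring
  have h2 : ∀ i j, f (max i j) (min i j) = g i j + g j i + d i j := by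
    intro i j
    rcases lt_trichotomy i j with h | h | h
    · simp [hg, hd, h, h.ne, h.le]
    · simp [hg, hd, h]
    · simp [hg, hd, h, h.ne', h.le]
  simp only [h1, h2, Finset.sum_add_distrib]
  rw [Finset.sum_comm (f := fun j i => g i j), Finset.sum_comm (f := fun j i => d i j)]

lemma aLow_eq_zero_of_lt (α : ℕ → ℝ) {ℓ j : ℕ} (h : j < ℓ) (i : ℕ) : aLow α ℓ i j = 0 := by
  cases ℓ with
  | zero => omega
  | succ ℓ => rw [aLow, if_pos (by omega)]

lemma aLow_eq_zero_of_row (α : ℕ → ℝ) {N : ℕ} (hα : ∀ i, N < i → α i = 0) (ℓ : ℕ) :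
    ∀ i j, N < i → aLow α ℓ i j = 0 := by
  induction ℓ with
  | zero => intro i j hi; simp [aLow, hα i hi]
  | succ ℓ ih =>
    intro i j hi
    simp [aLow, ih i _ hi, ih (i + 1) _ (by omega)]

lemma bLow_eq_zero_of_le (α : ℕ → ℝ) (ℓ : ℕ) : ∀ i j, ℓ ≤ j → bLow α ℓ i j = 0 := by
  induction ℓ with
  | zero => intro i j _; rfl
  | succ ℓ ih =>
    intro i j h
    rw [bLow, if_neg (by omega), ih i j (by omega)]

/-- One step of the transfer: column `ℓ` of `𝔸^{(ℓ)}` is moved into column `ℓ + 1`, at the cost of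
the column `ℓ` of `𝔹^{(ℓ+1)}`. -/
lemma transfer_entry (α : ℕ → ℝ) (X q : ℕ → ℕ → ℝ) (hX : ∀ i j, X i j = X j i)
    (hq : ∀ i j, X (i + 1) j = -X i (j + 1) - 2 * q i j) (ℓ i : ℕ) :
    triWeight (i + 1) ℓ * aLow α ℓ (i + 1) ℓ * X (i + 1) ℓ
        - (if i + 1 = ℓ then aLow α ℓ ℓ ℓ * X ℓ ℓ else 0) =
      triWeight i (ℓ + 1) * aLow α (ℓ + 1) i (ℓ + 1) * X i (ℓ + 1)
        - triWeight i (ℓ + 1) * aLow α ℓ i (ℓ + 1) * X i (ℓ + 1)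
        - triWeight i ℓ * bLow α (ℓ + 1) i ℓ * q i ℓ := by
  rcases lt_trichotomy i ℓ with h | h | h
  · have h1 : triWeight i ℓ = 0 := if_pos h
    have h2 : triWeight i (ℓ + 1) = 0 := if_pos (by omega)
    rw [h1, h2]
    by_cases h' : i + 1 = ℓ
    · subst h'; simp [triWeight]
    · have : triWeight (i + 1) ℓ = 0 := if_pos (by omega)
      simp [this, h']
  · subst h
    have h1 := hq i i
    have h2 := hX (i + 1) i
    have h3 : X (i + 1) i = -q i i := by linarith
    simp [triWeight, bLow, h3]
  · have h1 : triWeight (i + 1) ℓ = 2 := triWeight_of_gt (by omega)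
    have h2 : triWeight i ℓ = 2 := triWeight_of_gt (by omega)
    rw [h1, h2, hq, if_neg (by omega)]
    have hb : bLow α (ℓ + 1) i ℓ = 2 * aLow α ℓ (i + 1) ℓ := by
      rw [bLow, if_pos ⟨h.le, rfl⟩]
    rw [hb]
    by_cases h' : i = ℓ + 1
    · subst h'
      simp only [triWeight, aLow]
      simp
      ring
    · have h3 : triWeight i (ℓ + 1) = 2 := triWeight_of_gt (by omega)
      have ha : aLow α (ℓ + 1) i (ℓ + 1) = aLow α ℓ i (ℓ + 1) - aLow α ℓ (i + 1) ℓ := by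
        rw [aLow, if_neg (by omega), if_neg (by omega), if_pos ⟨by omega, rfl⟩]
        simp
      rw [h3, ha]
      ring

lemma transfer_step (α : ℕ → ℝ) {N : ℕ} (hα : ∀ i, N < i → α i = 0) (X q : ℕ → ℕ → ℝ)
    (hX : ∀ i j, X i j = X j i) (hq : ∀ i j, X (i + 1) j = -X i (j + 1) - 2 * q i j)
    {ℓ M : ℕ} (h0 : aLow α ℓ ℓ ℓ = 0) (hM : N < M) (hℓ : ℓ + 1 < M) :
    ∑ j ∈ Finset.range M, ∑ i ∈ Finset.range M, triWeight i j * (aLow α ℓ i j * X i j)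
        - ∑ j ∈ Finset.range M, ∑ i ∈ Finset.range M, triWeight i j * (bLow α ℓ i j * q i j) =
      ∑ j ∈ Finset.range M, ∑ i ∈ Finset.range M, triWeight i j * (aLow α (ℓ + 1) i j * X i j)
        - ∑ j ∈ Finset.range M, ∑ i ∈ Finset.range M,
            triWeight i j * (bLow α (ℓ + 1) i j * q i j) := by
  set c : ℕ → ℕ → ℝ := fun l j => ∑ i ∈ Finset.range M, triWeight i j * (aLow α l i j * X i j)
    with hc
  set e : ℕ → ℕ → ℝ := fun l j => ∑ i ∈ Finset.range M, triWeight i j * (bLow α l i j * q i j)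
    with he
  -- The identity between the columns that change.
  have key : c ℓ ℓ = c (ℓ + 1) (ℓ + 1) - c ℓ (ℓ + 1) - e (ℓ + 1) ℓ := by
    have hs : c ℓ ℓ =
        ∑ i ∈ Finset.range M, triWeight (i + 1) ℓ * (aLow α ℓ (i + 1) ℓ * X (i + 1) ℓ) := by
      have h1 := Finset.sum_range_succ
        (fun i => triWeight i ℓ * (aLow α ℓ i ℓ * X i ℓ)) M
      rw [aLow_eq_zero_of_row α hα ℓ M ℓ hM] at h1
      rw [Finset.sum_range_succ'] at h1
      have h2 : triWeight 0 ℓ * (aLow α ℓ 0 ℓ * X 0 ℓ) = 0 := by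
        rcases Nat.eq_zero_or_pos ℓ with h | h
        · subst h; simp [h0]
        · simp [triWeight, h]
      simp only [hc]
      rw [h2] at h1
      linarith
    rw [hs]
    simp only [hc, he]
    rw [← Finset.sum_sub_distrib, ← Finset.sum_sub_distrib]
    refine Finset.sum_congr rfl fun i _ => ?_
    have := transfer_entry α X q hX hq ℓ i
    rw [h0, zero_mul, ite_self, sub_zero] at this
    linarith
  have ha : ∀ j, c (ℓ + 1) j = c ℓ j - (if ℓ = j then c ℓ ℓ else 0)
      + (if ℓ + 1 = j then c (ℓ + 1) (ℓ + 1) - c ℓ (ℓ + 1) else 0) := by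
    intro j
    by_cases h1 : ℓ = j
    · subst h1
      have : c (ℓ + 1) ℓ = 0 := by
        simp only [hc]
        exact Finset.sum_eq_zero fun i _ => by rw [aLow_eq_zero_of_lt α (by omega)]; ring
      simp [this]
    · by_cases h2 : ℓ + 1 = j
      · subst h2; simp
      · simp only [h1, h2, if_false, hc, sub_zero, add_zero]
        refine Finset.sum_congr rfl fun i _ => ?_
        congr 2
        by_cases h3 : j < ℓ
        · rw [aLow_eq_zero_of_lt α h3, aLow_eq_zero_of_lt α (by omega)]
        · rw [aLow, if_neg (by omega), if_neg (by omega), if_neg (by omega)]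
  have hb : ∀ j, e (ℓ + 1) j = e ℓ j + (if ℓ = j then e (ℓ + 1) ℓ else 0) := by
    intro j
    by_cases h1 : ℓ = j
    · subst h1
      have : e ℓ ℓ = 0 := by
        simp only [he]
        exact Finset.sum_eq_zero fun i _ => by rw [bLow_eq_zero_of_le α ℓ i ℓ le_rfl]; ring
      simp [this]
    · simp only [h1, if_false, he, add_zero]
      refine Finset.sum_congr rfl fun i _ => ?_
      rw [bLow, if_neg (by omega)]
  change ∑ j ∈ Finset.range M, c ℓ j - ∑ j ∈ Finset.range M, e ℓ j
    = ∑ j ∈ Finset.range M, c (ℓ + 1) j - ∑ j ∈ Finset.range M, e (ℓ + 1) j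
  rw [Finset.sum_congr rfl fun j _ => ha j, Finset.sum_congr rfl fun j _ => hb j]
  simp only [Finset.sum_add_distrib, Finset.sum_sub_distrib, Finset.sum_ite_eq, Finset.mem_range]
  rw [if_pos (by omega), if_pos hℓ, if_pos (by omega)]
  linarith

/-- The energy identity: if `X i j = ⟨w_i, w_j⟩` with `w_{i+1} = T w_i`, and `q` is the dissipation
form of `T`, the quadratic form of `(α_i α_j)` is that of `𝔸^{(ζ)}` minus the dissipation weighted
by `𝔹^{(ζ)}`, plus the contribution of `w_0`. -/
lemma energy_identity (α : ℕ → ℝ) {N : ℕ} (hα : ∀ i, N < i → α i = 0) (X q : ℕ → ℕ → ℝ)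
    (hX : ∀ i j, X i j = X j i) (hq : ∀ i j, X (i + 1) j = -X i (j + 1) - 2 * q i j)
    {ζ M : ℕ} (h0 : ∀ ℓ < ζ, aLow α ℓ ℓ ℓ = 0) (hM : N < M) (hζ : ζ < M) :
    ∑ i ∈ Finset.range M, ∑ j ∈ Finset.range M, α i * α j * X i j =
      α 0 ^ 2 * X 0 0
      + ∑ j ∈ Finset.range M, ∑ i ∈ Finset.range M, triWeight i j * (aLow α ζ i j * X i j)
      - ∑ j ∈ Finset.range M, ∑ i ∈ Finset.range M, triWeight i j * (bLow α ζ i j * q i j) := by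
  have hstep : ∀ ℓ ≤ ζ,
      ∑ j ∈ Finset.range M, ∑ i ∈ Finset.range M, triWeight i j * (aLow α 0 i j * X i j) =
      ∑ j ∈ Finset.range M, ∑ i ∈ Finset.range M, triWeight i j * (aLow α ℓ i j * X i j)
      - ∑ j ∈ Finset.range M, ∑ i ∈ Finset.range M, triWeight i j * (bLow α ℓ i j * q i j) := by
    intro ℓ
    induction ℓ with
    | zero => intro _; simp [bLow]
    | succ ℓ ih =>
      intro h
      rw [ih (by omega)]
      exact transfer_step α hα X q hX hq (h0 ℓ (by omega)) hM (by omega)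
  rw [add_sub_assoc, ← hstep ζ le_rfl, sum_triWeight M (fun i j => aLow α 0 i j * X i j)]
  have hMpos : 0 < M := by omega
  have hentry : ∀ i j, α i * α j * X i j = (if 0 = i then (if 0 = j then α 0 ^ 2 * X 0 0 else 0)
      else 0) + aLow α 0 (max i j) (min i j) * X (max i j) (min i j) := by
    intro i j
    have hXm : X (max i j) (min i j) = X i j := by
      rcases le_total i j with h | h
      · simp [h, hX j i]
      · simp [h]
    have hαm : α (max i j) * α (min i j) = α i * α j := by
      rcases le_total i j with h | h
      · simp [h, mul_comm]
      · simp [h]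
    rw [hXm, aLow]
    by_cases hi : 0 = i
    · by_cases hj : 0 = j
      · subst hi; subst hj; simp [sq]
      · have : ¬ (max i j + min i j = 0) := by omega
        rw [if_neg this, if_pos hi, if_neg hj, hαm]; ring
    · have : ¬ (max i j + min i j = 0) := by omega
      rw [if_neg this, if_neg hi, hαm]; ring
  simp only [hentry, Finset.sum_add_distrib]
  congr 1
  rw [Finset.sum_eq_single 0]
  · rw [Finset.sum_eq_single 0] <;> simp +contextual [hMpos, eq_comm]
  · intro b _ hb; simp [Ne.symm hb]
  · simp [hMpos.ne']

/-! ### Dissipation controlled by the leading block of `𝔹` -/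

/-- Compactness of the unit sphere, for functions that are homogeneous of degree two. -/
lemma exists_pos_mul_sum_sq_le {n : ℕ} (f : (Fin n → ℝ) → ℝ) (hf : Continuous f)
    (hom : ∀ (c : ℝ) x, f (c • x) = c ^ 2 * f x) (pos : ∀ x, x ≠ 0 → 0 < f x) :
    ∃ ε > 0, ∀ x, ε * ∑ i, x i ^ 2 ≤ f x := by
  have hf0 : f 0 = 0 := by simpa using hom 0 0
  obtain ⟨δ, hδ, h⟩ : ∃ δ > 0, ∀ x, ‖x‖ = 1 → δ ≤ f x := by
    rcases (Metric.sphere (0 : Fin n → ℝ) 1).eq_empty_or_nonempty with he | hne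
    · refine ⟨1, one_pos, fun x hx => ?_⟩
      have : x ∈ Metric.sphere (0 : Fin n → ℝ) 1 := by simpa using hx
      simp [he] at this
    · obtain ⟨z, hz, hmin⟩ := (isCompact_sphere (0 : Fin n → ℝ) 1).exists_isMinOn hne
        hf.continuousOn
      refine ⟨f z, pos z ?_, fun x hx => hmin (by simpa using hx)⟩
      rintro rfl
      simp at hz
  refine ⟨δ / (n + 1), by positivity, fun x => ?_⟩
  have h1 : ∑ i, x i ^ 2 ≤ (n + 1) * ‖x‖ ^ 2 := by
    calc ∑ i, x i ^ 2 ≤ ∑ _i : Fin n, ‖x‖ ^ 2 := by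
          refine Finset.sum_le_sum fun i _ => ?_
          have hi := norm_le_pi_norm x i
          rw [Real.norm_eq_abs] at hi
          exact sq_le_sq' (neg_le_of_abs_le hi) (le_of_abs_le hi)
      _ = n * ‖x‖ ^ 2 := by simp
      _ ≤ _ := by nlinarith [sq_nonneg ‖x‖]
  have h2 : δ * ‖x‖ ^ 2 ≤ f x := by
    by_cases hx : x = 0
    · simp [hx, hf0]
    · have hx' : ‖x‖ ≠ 0 := norm_ne_zero_iff.2 hx
      have h3 := h (‖x‖⁻¹ • x) (by rw [norm_smul, norm_inv, norm_norm, inv_mul_cancel₀ hx'])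
      rw [hom, inv_pow, ← div_eq_inv_mul, le_div_iff₀ (by positivity)] at h3
      exact h3
  calc δ / (n + 1) * ∑ i, x i ^ 2 ≤ δ / (n + 1) * ((n + 1) * ‖x‖ ^ 2) := by gcongr
    _ = δ * ‖x‖ ^ 2 := by field_simp
    _ ≤ f x := h2

/-- The Schur product of a positive semidefinite matrix and a Gram matrix has nonnegative sum. -/
lemma sum_mul_bilin_nonneg {n : ℕ} {A : Matrix (Fin n) (Fin n) ℝ} (hA : A.PosSemidef)
    {E : Type*} [AddCommGroup E] [Module ℝ E] (q : E →ₗ[ℝ] E →ₗ[ℝ] ℝ) (hq : ∀ v, 0 ≤ q v v)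
    (w : Fin n → E) : 0 ≤ ∑ i, ∑ j, A i j * q (w i) (w j) := by
  obtain ⟨m, a, rfl⟩ := Matrix.posSemidef_iff_eq_sum_vecMulVec.1 hA
  have : ∑ i, ∑ j, (∑ l, Matrix.vecMulVec (a l) (star (a l))) i j * q (w i) (w j) =
      ∑ l, q (∑ i, a l i • w i) (∑ j, a l j • w j) := by
    simp only [Matrix.sum_apply, Matrix.vecMulVec_apply, Finset.sum_mul, map_sum,
      LinearMap.sum_apply, map_smul, LinearMap.smul_apply, smul_eq_mul, star_trivial]
    rw [Finset.sum_congr rfl fun i _ => Finset.sum_comm, Finset.sum_comm]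
    refine Finset.sum_congr rfl fun l _ => ?_
    rw [Finset.sum_comm]
    refine Finset.sum_congr rfl fun i _ => ?_
    rw [Finset.mul_sum]
    exact Finset.sum_congr rfl fun j _ => by ring
  rw [this]
  exact Finset.sum_nonneg fun l _ => hq _

lemma Matrix.PosDef.exists_pos_sum_mul_bilin_le {n : ℕ} {A : Matrix (Fin n) (Fin n) ℝ}
    (hA : A.PosDef) : ∃ ε > 0, ∀ {E : Type} [AddCommGroup E] [Module ℝ E]
    (q : E →ₗ[ℝ] E →ₗ[ℝ] ℝ), (∀ v, 0 ≤ q v v) → ∀ w : Fin n → E,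
      ε * ∑ i, q (w i) (w i) ≤ ∑ i, ∑ j, A i j * q (w i) (w j) := by
  obtain ⟨ε, hε, h⟩ := exists_pos_mul_sum_sq_le (fun x => x ⬝ᵥ (A.mulVec x))
    (by simp only [dotProduct, Matrix.mulVec]; fun_prop)
    (fun c x => by simp [Matrix.mulVec_smul]; ring)
    (fun x hx => by simpa using hA.dotProduct_mulVec_pos hx)
  refine ⟨ε, hε, fun {E} _ _ q hq w => ?_⟩
  have hps : (A - ε • (1 : Matrix (Fin n) (Fin n) ℝ)).PosSemidef := by
    refine Matrix.PosSemidef.of_dotProduct_mulVec_nonneg ?_ fun x => ?_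
    · exact hA.isHermitian.sub (by simp [Matrix.IsHermitian])
    · have := h x
      simp only [star_trivial, Matrix.sub_mulVec, Matrix.smul_mulVec, Matrix.one_mulVec,
        dotProduct_sub, dotProduct_smul, smul_eq_mul]
      have h2 : x ⬝ᵥ x = ∑ i, x i ^ 2 := by simp [dotProduct, sq]
      rw [h2]; linarith
  have := sum_mul_bilin_nonneg hps q hq w
  simp only [Matrix.sub_apply, Matrix.smul_apply, sub_mul, Finset.sum_sub_distrib,
    Matrix.one_apply, smul_eq_mul, mul_ite, mul_one, mul_zero, ite_mul, zero_mul,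
    Finset.sum_ite_eq, Finset.mem_univ, if_true, ← Finset.mul_sum] at this
  linarith

/-- If the leading block of order `ρ` of a symmetric matrix is positive definite, then the
dissipation weighted by the whole matrix is bounded below by a multiple of the dissipation with
indices `≥ ρ`; the off-diagonal blocks are absorbed by Young's inequality. -/
lemma exists_dissipation_lower_bound (b : ℕ → ℕ → ℝ) {ρ M : ℕ} (hρ : ρ ≤ M)
    (hb : (Matrix.of fun i j : Fin ρ => b i j).PosDef) :
    ∃ C ≥ 0, ∀ {E : Type} [AddCommGroup E] [Module ℝ E] (q : E →ₗ[ℝ] E →ₗ[ℝ] ℝ),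
      (∀ v, 0 ≤ q v v) → (∀ v v', q v v' = q v' v) → ∀ w : ℕ → E,
        -(C * ∑ i ∈ Finset.range M, if i < ρ then 0 else q (w i) (w i)) ≤
          ∑ i ∈ Finset.range M, ∑ j ∈ Finset.range M, b i j * q (w i) (w j) := by
  obtain ⟨ε, hε, h⟩ := hb.exists_pos_sum_mul_bilin_le
  -- Each index occurs in at most `2 M` products, so weights `δ` in Young's inequality use up at most
  -- the coercivity `ε` of the leading block.
  set δ : ℝ := ε / (2 * (M + 1)) with hδdef
  have hδ : 0 < δ := by positivity
  set B : ℝ := ∑ i ∈ Finset.range M, ∑ j ∈ Finset.range M, b i j ^ 2 with hB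
  have hB0 : 0 ≤ B := Finset.sum_nonneg fun i _ => Finset.sum_nonneg fun j _ => sq_nonneg _
  have hbB : ∀ i < M, ∀ j < M, b i j ^ 2 ≤ B := by
    intro i hi j hj
    refine le_trans ?_ (Finset.single_le_sum (f := fun i => ∑ j ∈ Finset.range M, b i j ^ 2)
      (fun i _ => Finset.sum_nonneg fun j _ => sq_nonneg _) (Finset.mem_range.2 hi))
    exact Finset.single_le_sum (f := fun j => b i j ^ 2) (fun j _ => sq_nonneg _)
      (Finset.mem_range.2 hj)
  set K : ℝ := B / (4 * δ) + δ with hK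
  have hBδ : 0 ≤ B / (4 * δ) := by positivity
  refine ⟨2 * M * K, by positivity, fun {E} _ _ q hq hsymm w => ?_⟩
  set y' : ℕ → ℝ := fun i => if i < ρ then q (w i) (w i) else 0 with hy'
  set y'' : ℕ → ℝ := fun i => if i < ρ then 0 else q (w i) (w i) with hy''
  have hy'0 : ∀ i, 0 ≤ y' i := fun i => by simp only [hy']; split_ifs <;> simp [hq]
  have hy''0 : ∀ i, 0 ≤ y'' i := fun i => by simp only [hy'']; split_ifs <;> simp [hq]
  have young : ∀ (c : ℝ) (v v' : E), -(δ * q v v) - c ^ 2 / (4 * δ) * q v' v' ≤ c * q v v' := by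
    intro c v v'
    have h1 := hq ((2 * δ) • v + c • v')
    simp only [map_add, map_smul, LinearMap.add_apply, LinearMap.smul_apply, smul_eq_mul,
      hsymm v' v] at h1
    have h2 : 0 ≤ (4 * δ ^ 2 * q v v + 4 * δ * (c * q v v') + c ^ 2 * q v' v') / (4 * δ) := by
      apply div_nonneg _ (by positivity)
      linarith
    have h3 : (4 * δ ^ 2 * q v v + 4 * δ * (c * q v v') + c ^ 2 * q v' v') / (4 * δ)
        = δ * q v v + c * q v v' + c ^ 2 / (4 * δ) * q v' v' := by field_simp
    linarith
  have hpt : ∀ i < M, ∀ j < M,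
      (if i < ρ ∧ j < ρ then b i j * q (w i) (w j) else 0)
        - δ * y' i - δ * y' j - K * y'' i - K * y'' j ≤ b i j * q (w i) (w j) := by
    intro i hi j hj
    have hc : b i j ^ 2 / (4 * δ) ≤ B / (4 * δ) := by
      gcongr; exact hbB i hi j hj
    by_cases h1 : i < ρ
    · by_cases h2 : j < ρ
      · rw [if_pos ⟨h1, h2⟩]
        nlinarith [mul_nonneg hδ.le (hy'0 i), mul_nonneg hδ.le (hy'0 j),
          mul_nonneg (add_nonneg hBδ hδ.le) (hy''0 i), mul_nonneg (add_nonneg hBδ hδ.le) (hy''0 j)]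
      · have := young (b i j) (w i) (w j)
        have h3 := mul_le_mul_of_nonneg_right hc (hq (w j))
        have h4 := mul_nonneg hδ.le (hq (w j))
        simp only [hy', hy'', h1, h2, and_false, if_true, if_false, hK]
        linarith
    · by_cases h2 : j < ρ
      · have := young (b i j) (w j) (w i)
        rw [hsymm (w j) (w i)] at this
        have h3 := mul_le_mul_of_nonneg_right hc (hq (w i))
        have h4 := mul_nonneg hδ.le (hq (w i))
        simp only [hy', hy'', h1, h2, false_and, if_true, if_false, hK]
        linarith
      · have := young (b i j) (w i) (w j)
        have h3 := mul_le_mul_of_nonneg_right hc (hq (w j))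
        have h4 := mul_nonneg hδ.le (hq (w j))
        have h5 := mul_nonneg hBδ (hq (w i))
        simp only [hy', hy'', h1, h2, false_and, if_false, hK]
        linarith
  have hsum := Finset.sum_le_sum fun i hi => Finset.sum_le_sum fun j hj =>
    hpt i (Finset.mem_range.1 hi) j (Finset.mem_range.1 hj)
  refine le_trans ?_ hsum
  have hfilt : ∀ f : ℕ → ℝ, ∑ i ∈ Finset.range M, (if i < ρ then f i else 0) =
      ∑ i : Fin ρ, f i := by
    intro f
    rw [← Finset.sum_filter, ← Finset.sum_range]
    congr 1
    ext i; simp; omega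
  have hblock : ∑ i ∈ Finset.range M, ∑ j ∈ Finset.range M,
      (if i < ρ ∧ j < ρ then b i j * q (w i) (w j) else 0) =
      ∑ i : Fin ρ, ∑ j : Fin ρ, b i j * q (w i) (w j) := by
    rw [← hfilt (fun i => ∑ j : Fin ρ, b i j * q (w i) (w j))]
    refine Finset.sum_congr rfl fun i _ => ?_
    by_cases h1 : i < ρ
    · simp only [h1, true_and, if_true]
      exact hfilt fun j => b i j * q (w i) (w j)
    · simp [h1]
  have h1 : ε * ∑ i ∈ Finset.range M, y' i ≤ ∑ i ∈ Finset.range M, ∑ j ∈ Finset.range M,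
      (if i < ρ ∧ j < ρ then b i j * q (w i) (w j) else 0) := by
    rw [hblock, hfilt fun i => q (w i) (w i)]
    exact h q hq fun i => w i
  simp only [Finset.sum_sub_distrib, Finset.sum_const, Finset.card_range, nsmul_eq_mul,
    ← Finset.mul_sum]
  have h2 : 2 * M * δ * ∑ i ∈ Finset.range M, y' i ≤ ε * ∑ i ∈ Finset.range M, y' i := by
    refine mul_le_mul_of_nonneg_right ?_ (Finset.sum_nonneg fun i _ => hy'0 i)
    rw [hδdef, mul_div_assoc', div_le_iff₀ (by positivity)]
    nlinarith
  linarith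

/-! ### The energy estimate for a dissipative operator -/

/-- The dissipation form `-(⟨T u, v⟩ + ⟨u, T v⟩) / 2` of an operator. -/
def dissipationForm {E : Type} [NormedAddCommGroup E] [InnerProductSpace ℝ E]
    (T : Module.End ℝ E) : E →ₗ[ℝ] E →ₗ[ℝ] ℝ :=
  -(1 / 2 : ℝ) • ((innerₗ E).comp T + (innerₗ E).compl₂ T)

section

variable {E : Type} [NormedAddCommGroup E] [InnerProductSpace ℝ E]

lemma dissipationForm_apply (T : Module.End ℝ E) (u v : E) :
    dissipationForm T u v = -(inner ℝ (T u) v + inner ℝ u (T v)) / 2 := by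
  simp [dissipationForm, innerₗ_apply_apply]
  ring

lemma dissipationForm_comm (T : Module.End ℝ E) (u v : E) :
    dissipationForm T u v = dissipationForm T v u := by
  rw [dissipationForm_apply, dissipationForm_apply, real_inner_comm v, real_inner_comm u]
  ring

lemma dissipationForm_self (T : Module.End ℝ E) (u : E) :
    dissipationForm T u u = -inner ℝ (T u) u := by
  rw [dissipationForm_apply, real_inner_comm (T u) u]
  ring

lemma norm_pow_succ_apply_le {T : Module.End ℝ E} {κ : ℝ} (hT : ∀ v, ‖T v‖ ≤ κ * ‖v‖) (u : E)
    (i : ℕ) : ‖(T ^ (i + 1)) u‖ ≤ κ * ‖(T ^ i) u‖ := by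
  rw [pow_succ', Module.End.mul_apply]
  exact hT _

lemma antitone_norm_pow_apply {T : Module.End ℝ E} {κ : ℝ} (hκ : κ ≤ 1)
    (hT : ∀ v, ‖T v‖ ≤ κ * ‖v‖) (u : E) : Antitone fun i => ‖(T ^ i) u‖ :=
  antitone_nat_of_succ_le fun i => (norm_pow_succ_apply_le hT u i).trans
    (mul_le_of_le_one_left (norm_nonneg _) hκ)

lemma norm_pow_apply_le {T : Module.End ℝ E} {κ : ℝ} (hκ : 0 ≤ κ)
    (hT : ∀ v, ‖T v‖ ≤ κ * ‖v‖) (u : E) (i : ℕ) : ‖(T ^ i) u‖ ≤ κ ^ i * ‖u‖ := by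
  induction i with
  | zero => simp
  | succ i ih =>
    refine (norm_pow_succ_apply_le hT u i).trans ?_
    rw [pow_succ', mul_assoc]
    gcongr

end

/-- The stability estimate behind all three regimes: only the term `a_{ζζ} ‖T^ζ u‖²` and terms
with an additional factor `κ ≥ ‖T‖` survive. -/
theorem exists_energy_estimate (α : ℕ → ℝ) {N : ℕ} (hα : ∀ i, N < i → α i = 0) {ζ ρ M : ℕ}
    (hζ : IsTerminationIndex α ζ) (hρ : IsContributionIndex α ζ ρ) (hM : N < M) (hζM : ζ < M) :
    ∃ C₁ ≥ 0, ∃ C₂ ≥ 0, ∀ {E : Type} [NormedAddCommGroup E] [InnerProductSpace ℝ E]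
      (T : Module.End ℝ E) (κ : ℝ), 0 ≤ κ → κ ≤ 1 → (∀ v, inner ℝ (T v) v ≤ 0) →
      (∀ v, ‖T v‖ ≤ κ * ‖v‖) → ∀ u,
        ‖∑ i ∈ Finset.range M, α i • (T ^ i) u‖ ^ 2 ≤ α 0 ^ 2 * ‖u‖ ^ 2
          + (aLow α ζ ζ ζ + C₁ * κ) * ‖(T ^ ζ) u‖ ^ 2 + C₂ * κ * ‖(T ^ ρ) u‖ ^ 2 := by
  obtain ⟨⟨hρζ, hpd⟩, -⟩ := hρ
  obtain ⟨C, hC, hdiss⟩ := exists_dissipation_lower_bound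
    (fun i j => bLow α ζ (max i j) (min i j)) (M := M) (by omega : ρ ≤ M) hpd
  refine ⟨∑ j ∈ Finset.range M, ∑ i ∈ Finset.range M, |triWeight i j * aLow α ζ i j|,
    Finset.sum_nonneg fun _ _ => Finset.sum_nonneg fun _ _ => abs_nonneg _,
    C * M, by positivity, ?_⟩
  intro E _ _ T κ hκ hκ1 hneg hT u
  set w : ℕ → E := fun i => (T ^ i) u with hw
  have hanti : Antitone fun i => ‖w i‖ := antitone_norm_pow_apply hκ1 hT u
  have hTw : ∀ i, T (w i) = w (i + 1) := fun i => by
    simp only [hw]; rw [pow_succ', Module.End.mul_apply]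
  have hqpsd : ∀ v, 0 ≤ dissipationForm T v v := fun v => by
    rw [dissipationForm_self]; linarith [hneg v]
  have hid := energy_identity α hα (fun i j => inner ℝ (w i) (w j))
    (fun i j => dissipationForm T (w i) (w j)) (fun i j => real_inner_comm _ _)
    (fun i j => by rw [dissipationForm_apply, hTw, hTw]; ring)
    (fun ℓ hℓ => by_contra fun h => absurd (hζ.2 h) (by omega)) hM hζM
  have hnorm : ‖∑ i ∈ Finset.range M, α i • w i‖ ^ 2 =
      ∑ i ∈ Finset.range M, ∑ j ∈ Finset.range M, α i * α j * inner ℝ (w i) (w j) := by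
    rw [← real_inner_self_eq_norm_sq, sum_inner]
    refine Finset.sum_congr rfl fun i _ => ?_
    rw [inner_sum]
    refine Finset.sum_congr rfl fun j _ => ?_
    rw [real_inner_smul_left, real_inner_smul_right]; ring
  have hb : -(C * M * κ * ‖w ρ‖ ^ 2) ≤ ∑ j ∈ Finset.range M, ∑ i ∈ Finset.range M,
      triWeight i j * (bLow α ζ i j * dissipationForm T (w i) (w j)) := by
    rw [sum_triWeight M (fun i j => bLow α ζ i j * dissipationForm T (w i) (w j))]
    have h1 := hdiss (dissipationForm T) hqpsd (dissipationForm_comm T) w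
    have h2 : ∀ i j, bLow α ζ (max i j) (min i j) *
        dissipationForm T (w (max i j)) (w (min i j)) =
        bLow α ζ (max i j) (min i j) * dissipationForm T (w i) (w j) := by
      intro i j
      rcases le_total i j with h | h
      · simp [h, dissipationForm_comm T (w i) (w j)]
      · simp [h]
    simp only [h2]
    refine le_trans ?_ h1
    have h3 : ∑ i ∈ Finset.range M, (if i < ρ then 0 else dissipationForm T (w i) (w i)) ≤
        ∑ _i ∈ Finset.range M, κ * ‖w ρ‖ ^ 2 := by
      refine Finset.sum_le_sum fun i _ => ?_
      split_ifs with h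
      · positivity
      · rw [dissipationForm_self, ← inner_neg_left]
        have h4 := real_inner_le_norm (-T (w i)) (w i)
        rw [norm_neg] at h4
        have h5 : ‖w i‖ ≤ ‖w ρ‖ := hanti (not_lt.1 h)
        calc inner ℝ (-T (w i)) (w i) ≤ ‖T (w i)‖ * ‖w i‖ := h4
          _ ≤ (κ * ‖w i‖) * ‖w i‖ := by gcongr; exact hT _
          _ = κ * ‖w i‖ ^ 2 := by ring
          _ ≤ _ := by gcongr
    rw [Finset.sum_const, Finset.card_range, nsmul_eq_mul] at h3
    have := mul_le_mul_of_nonneg_left h3 hC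
    linarith
  have ha : ∑ j ∈ Finset.range M, ∑ i ∈ Finset.range M,
      triWeight i j * (aLow α ζ i j * inner ℝ (w i) (w j)) ≤
      aLow α ζ ζ ζ * ‖w ζ‖ ^ 2 + (∑ j ∈ Finset.range M, ∑ i ∈ Finset.range M,
        |triWeight i j * aLow α ζ i j|) * (κ * ‖w ζ‖ ^ 2) := by
    have hpt : ∀ i j, triWeight i j * (aLow α ζ i j * inner ℝ (w i) (w j)) ≤
        (if ζ = j then (if ζ = i then aLow α ζ ζ ζ * ‖w ζ‖ ^ 2 else 0) else 0) +
          |triWeight i j * aLow α ζ i j| * (κ * ‖w ζ‖ ^ 2) := by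
      intro i j
      have hnn : 0 ≤ |triWeight i j * aLow α ζ i j| * (κ * ‖w ζ‖ ^ 2) := by positivity
      by_cases hj : j < ζ
      · rw [aLow_eq_zero_of_lt α hj, if_neg (by omega)]; simp
      · by_cases hij : i < j
        · rw [triWeight, if_pos hij]
          split_ifs <;> first | omega | simp
        · by_cases hi : ζ = i
          · have hj' : ζ = j := by omega
            subst hi; subst hj'
            simp only [if_true]
            rw [real_inner_self_eq_norm_sq, ← mul_assoc]
            have : triWeight ζ ζ = 1 := by simp [triWeight]
            rw [this, one_mul] at hnn ⊢
            linarith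
          · have h1 : (if ζ = j then (if ζ = i then aLow α ζ ζ ζ * ‖w ζ‖ ^ 2 else 0) else 0) = 0 := by
              simp [hi]
            rw [h1, zero_add, ← mul_assoc]
            refine (le_abs_self _).trans ?_
            rw [abs_mul]
            refine mul_le_mul_of_nonneg_left ?_ (abs_nonneg _)
            have h2 : ‖w i‖ ≤ κ * ‖w ζ‖ :=
              (hanti (show ζ + 1 ≤ i by omega)).trans (norm_pow_succ_apply_le hT u ζ)
            have h3 : ‖w j‖ ≤ ‖w ζ‖ := hanti (not_lt.1 hj)
            calc |inner ℝ (w i) (w j)| ≤ ‖w i‖ * ‖w j‖ := abs_real_inner_le_norm _ _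
              _ ≤ (κ * ‖w ζ‖) * ‖w ζ‖ := by gcongr
              _ = _ := by ring
    refine (Finset.sum_le_sum fun j _ => Finset.sum_le_sum fun i _ => hpt i j).trans ?_
    simp only [Finset.sum_add_distrib, Finset.sum_mul]
    refine add_le_add ?_ le_rfl
    rw [Finset.sum_eq_single ζ, Finset.sum_eq_single ζ]
    · simp
    · intro i _ hi; simp [Ne.symm hi]
    · intro h; simp [hζM] at h
    · intro i _ hi; simp [Ne.symm hi]
    · intro h; simp [hζM] at h
  have h0 : w 0 = u := by simp [hw]
  rw [hnorm, hid, real_inner_self_eq_norm_sq, h0]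
  change _ ≤ α 0 ^ 2 * ‖u‖ ^ 2 + (aLow α ζ ζ ζ + _) * ‖w ζ‖ ^ 2 + C * M * κ * ‖w ρ‖ ^ 2
  linarith

/-! ### Runge–Kutta steps as polynomials of the operator -/

lemma RKMethod.stage_zero (R : RKMethod) {E : Type*} [AddCommGroup E] [Module ℝ E] (F : E → E)
    (u : E) : R.stage F u 0 = u := by
  rw [RKMethod.stage]

lemma RKMethod.stage_succ (R : RKMethod) {E : Type*} [AddCommGroup E] [Module ℝ E] (F : E → E)
    (u : E) (l : ℕ) : R.stage F u (l + 1) =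
      ∑ m ∈ Finset.range (l + 1), (R.c l m • R.stage F u m + R.d l m • F (R.stage F u m)) := by
  rw [RKMethod.stage, Finset.sum_range]

lemma RKMethod.stage_eq_aeval (R : RKMethod) {E : Type*} [AddCommGroup E] [Module ℝ E]
    (T : Module.End ℝ E) (u : E) (l : ℕ) :
    R.stage T u l = Polynomial.aeval T (R.stage (fun p : ℝ[X] => Polynomial.X * p) 1 l) u := by
  induction l using Nat.strong_induction_on with
  | _ l ih =>
    cases l with
    | zero => simp [RKMethod.stage_zero]
    | succ l =>
      rw [RKMethod.stage_succ, RKMethod.stage_succ, map_sum, LinearMap.sum_apply]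
      refine Finset.sum_congr rfl fun m hm => ?_
      rw [ih m (Finset.mem_range.1 hm)]
      simp

/-- A linear function of `τ` that is `O(τ²)` as `τ → 0⁺` vanishes. -/
lemma eq_zero_of_isBigO_sq {a b : ℝ}
    (h : (fun τ : ℝ => a + b * τ) =O[𝓝[>] 0] fun τ => τ ^ 2) : a = 0 ∧ b = 0 := by
  have hid : Filter.Tendsto (fun τ : ℝ => τ) (𝓝[>] 0) (𝓝 0) := nhdsWithin_le_nhds
  have hsq : Filter.Tendsto (fun τ : ℝ => τ ^ 2) (𝓝[>] 0) (𝓝 0) := by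
    simpa using hid.pow 2
  have ha : a = 0 := by
    have h1 := h.trans_tendsto hsq
    have h2 : Filter.Tendsto (fun τ : ℝ => a + b * τ) (𝓝[>] 0) (𝓝 (a + b * 0)) :=
      (hid.const_mul b).const_add a
    simpa using tendsto_nhds_unique h2 h1
  refine ⟨ha, ?_⟩
  obtain ⟨C, hC⟩ := h.bound
  have h3 : ∀ᶠ τ : ℝ in 𝓝[>] 0, |b| ≤ C * τ := by
    filter_upwards [hC, self_mem_nhdsWithin] with τ hτ hpos
    have hpos : 0 < τ := hpos
    rw [ha, zero_add, norm_mul, norm_pow, Real.norm_eq_abs, Real.norm_eq_abs,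
      abs_of_pos hpos] at hτ
    nlinarith
  have h4 : Filter.Tendsto (fun τ : ℝ => C * τ) (𝓝[>] 0) (𝓝 0) := by
    simpa using hid.const_mul C
  exact abs_nonpos_iff.1 (ge_of_tendsto h4 h3)

/-- Consistency: testing a method of order at least one on `y' = y` shows that its stability
polynomial is `1 + X + O(X²)`. -/
lemma RKMethod.HasOrder.stabPoly_coeff {R : RKMethod} {r : ℕ} (hr : 1 ≤ r) (hR : R.HasOrder r) :
    R.stabPoly.coeff 0 = 1 ∧ R.stabPoly.coeff 1 = 1 := by
  set v : EuclideanSpace ℝ (Fin 1) := EuclideanSpace.single 0 1 with hv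
  have hv1 : ‖v‖ = 1 := by simp [hv]
  have h := hR 1 (fun y => y) contDiff_id (fun t => Real.exp t • v)
    (Filter.Eventually.of_forall fun t => (Real.hasDerivAt_exp t).smul_const v)
  have hstage : ∀ τ : ℝ, R.stage (fun w : EuclideanSpace ℝ (Fin 1) => τ • w)
      (Real.exp 0 • v) R.s = R.stabPoly.eval τ • v := by
    intro τ
    have h1 := R.stage_eq_aeval (τ • (1 : Module.End ℝ (EuclideanSpace ℝ (Fin 1))))
      (Real.exp 0 • v) R.s
    have h2 : (τ • (1 : Module.End ℝ (EuclideanSpace ℝ (Fin 1)))) = algebraMap ℝ _ τ :=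
      (Algebra.algebraMap_eq_smul_one τ).symm
    rw [h2, Polynomial.aeval_algebraMap_apply] at h1
    rw [show (fun w : EuclideanSpace ℝ (Fin 1) => τ • w) =
      ⇑(algebraMap ℝ (Module.End ℝ (EuclideanSpace ℝ (Fin 1))) τ) from rfl, h1]
    simp [RKMethod.stabPoly, Module.algebraMap_end_apply]
  simp only [hstage] at h
  have h1 : (fun τ : ℝ => R.stabPoly.eval τ - Real.exp τ) =O[𝓝[>] 0] fun τ => τ ^ 2 := by
    have h2 : (fun τ : ℝ => τ ^ (r + 1)) =O[𝓝[>] 0] fun τ => τ ^ 2 := by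
      refine Asymptotics.IsBigO.of_bound 1 ?_
      filter_upwards [Ioo_mem_nhdsGT (zero_lt_one (α := ℝ))] with τ hτ
      rw [one_mul, norm_pow, norm_pow]
      refine pow_le_pow_of_le_one (norm_nonneg _) ?_ (by omega)
      rw [Real.norm_eq_abs, abs_of_pos hτ.1]; exact hτ.2.le
    refine Asymptotics.IsBigO.trans (Asymptotics.IsBigO.of_norm_left ?_) h2
    refine h.norm_left.congr_left fun τ => ?_
    rw [← sub_smul, norm_smul, hv1, mul_one]
  have h2 : (fun τ : ℝ => Real.exp τ - (1 + τ)) =O[𝓝[>] 0] fun τ => τ ^ 2 := by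
    have := (Real.exp_sub_sum_range_isBigO_pow 2).mono (nhdsWithin_le_nhds (s := Set.Ioi (0 : ℝ)))
    simpa [Finset.sum_range_succ] using this
  have h3 : (fun τ : ℝ => R.stabPoly.eval τ - (R.stabPoly.coeff 0 + R.stabPoly.coeff 1 * τ))
      =O[𝓝[>] 0] fun τ => τ ^ 2 := by
    have hdec : ∀ τ : ℝ, R.stabPoly.eval τ - (R.stabPoly.coeff 0 + R.stabPoly.coeff 1 * τ)
        = R.stabPoly.divX.divX.eval τ * τ ^ 2 := by
      intro τ
      have e1 := congrArg (Polynomial.eval τ) (Polynomial.divX_mul_X_add R.stabPoly)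
      have e2 := congrArg (Polynomial.eval τ) (Polynomial.divX_mul_X_add R.stabPoly.divX)
      simp only [Polynomial.eval_add, Polynomial.eval_mul, Polynomial.eval_X, Polynomial.eval_C,
        Polynomial.coeff_divX, zero_add] at e1 e2
      rw [← e1, ← e2]; ring
    simp only [hdec]
    have hb : (fun τ : ℝ => R.stabPoly.divX.divX.eval τ) =O[𝓝[>] 0] fun _ => (1 : ℝ) :=
      ((Polynomial.continuous _).tendsto 0 |>.mono_left nhdsWithin_le_nhds).isBigO_one ℝ
    simpa using hb.mul (Asymptotics.isBigO_refl (fun τ : ℝ => τ ^ 2) _)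
  have h4 := (h1.add h2).sub h3
  have h5 : (fun τ : ℝ => (R.stabPoly.coeff 0 - 1) + (R.stabPoly.coeff 1 - 1) * τ)
      =O[𝓝[>] 0] fun τ => τ ^ 2 := h4.congr_left fun τ => by ring
  obtain ⟨h6, h7⟩ := eq_zero_of_isBigO_sq h5
  exact ⟨by linarith, by linarith⟩

lemma coeff_one_pow_of_coeff_eq_one {P : ℝ[X]} (h0 : P.coeff 0 = 1) (h1 : P.coeff 1 = 1) (m : ℕ) :
    (P ^ m).coeff 0 = 1 ∧ (P ^ m).coeff 1 = m := by
  induction m with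
  | zero => simp [Polynomial.coeff_one]
  | succ m ih =>
    rw [pow_succ, Polynomial.mul_coeff_zero, Polynomial.mul_coeff_one, ih.1, ih.2, h0, h1]
    push_cast
    exact ⟨by ring, by ring⟩

lemma aLow_eq_zero_of_forall_pos {α : ℕ → ℝ} (h : ∀ i, 0 < i → α i = 0) (ℓ : ℕ) :
    ∀ i j, aLow α ℓ i j = 0 := by
  induction ℓ with
  | zero =>
    intro i j
    rw [aLow]
    split_ifs with h0
    · rfl
    · rcases Nat.eq_zero_or_pos i with hi | hi
      · rw [h j (by omega), mul_zero]
      · rw [h i hi, zero_mul]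
  | succ ℓ ih => intro i j; simp [aLow, ih]

lemma IsTerminationIndex.pos {α : ℕ → ℝ} {ζ : ℕ} (hζ : IsTerminationIndex α ζ) : 0 < ζ := by
  rcases Nat.eq_zero_or_pos ζ with h | h
  · subst h
    exact absurd hζ.1 (by simp [aLow])
  · exact h

lemma bLow_zero_zero (α : ℕ → ℝ) {ζ : ℕ} (hζ : 0 < ζ) : bLow α ζ 0 0 = 2 * (α 1 * α 0) := by
  induction ζ, hζ using Nat.le_induction with
  | base => simp [bLow, aLow]
  | succ n hn ih => rw [bLow, if_neg (by omega), ih]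

/-- The contribution index is at least one, since `b_{00} = 2 α₀ α₁` and `α₁ = m α₀` by
consistency. -/
lemma one_le_contributionIndex {R : RKMethod} {r m : ℕ} (hr : 1 ≤ r) (hR : R.HasOrder r)
    {α : ℕ → ℝ} (hα : IsEvolutionCoeff R m α) {ζ ρ : ℕ} (hζ : IsTerminationIndex α ζ)
    (hρ : IsContributionIndex α ζ ρ) : 1 ≤ ρ := by
  refine hρ.2 ⟨hζ.pos, ?_⟩
  obtain ⟨h0, h1⟩ := RKMethod.HasOrder.stabPoly_coeff hr hR
  have hm : 0 < m := by
    rcases Nat.eq_zero_or_pos m with h | h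
    · subst h
      refine absurd (aLow_eq_zero_of_forall_pos (fun i hi => ?_) ζ ζ ζ) hζ.1
      rw [hα.2 i, pow_zero, Polynomial.coeff_one, if_neg (by omega), mul_zero]
    · exact h
  have hα1 : α 1 = α 0 * m := by
    rw [hα.2 1, (coeff_one_pow_of_coeff_eq_one h0 h1 m).2]
  have hb : 0 < bLow α ζ 0 0 := by
    have := hα.1
    rw [bLow_zero_zero α hζ.pos, hα1]
    positivity
  refine Matrix.PosDef.of_dotProduct_mulVec_pos ?_ fun x hx => ?_
  · ext i j
    simp [bSub, Subsingleton.elim i j]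
  · have hx0 : x 0 ≠ 0 := fun h => hx (by ext i; rw [Fin.eq_zero i]; exact h)
    simp only [bSub, dotProduct, Matrix.mulVec, Fin.sum_univ_one, Matrix.of_apply]
    simp
    nlinarith [mul_pos hb (mul_self_pos.2 hx0)]

/-! ### Stability of semidiscretizations with a dissipative operator -/

/-- The form `ℋ` is represented, in an inner product space carrying the `L²` inner product of the
discrete space, by a dissipative operator of norm at most `K / h`. -/
def HasDissipativeOperator (S : SemiDiscretization) (K : ℝ) : Prop :=
  0 < S.h ∧ ∃ (E : Type) (_ : NormedAddCommGroup E) (_ : InnerProductSpace ℝ E) (e : S.V ≃ E)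
    (L : Module.End ℝ E), (∀ u v, S.ip u v = inner ℝ (e u) (e v)) ∧
    (∀ u v, S.H u v = inner ℝ (L (e u)) (e v)) ∧ (∀ v, inner ℝ (L v) v ≤ 0) ∧
    ∀ v, ‖L v‖ ≤ K / S.h * ‖v‖

/-- Since the inner product is nondegenerate, the weak formulation determines the stages, which are
therefore those of the method applied to `τ L`. -/
lemma isRKSolution_step {S : SemiDiscretization} {R : RKMethod} {τ : ℝ} {u : ℕ → S.V}
    (hu : S.IsRKSolution R τ u) {E : Type} [NormedAddCommGroup E] [InnerProductSpace ℝ E]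
    (e : S.V ≃ E) (L : Module.End ℝ E) (hip : ∀ u v, S.ip u v = inner ℝ (e u) (e v))
    (hH : ∀ u v, S.H u v = inner ℝ (L (e u)) (e v)) (n : ℕ) :
    e (u (n + 1)) = Polynomial.aeval (τ • L) R.stabPoly (e (u n)) := by
  obtain ⟨y, hy0, hys, hy⟩ := hu n
  have hstage : ∀ l ≤ R.s, e (y l) = R.stage (τ • L) (e (u n)) l := by
    intro l
    induction l using Nat.strong_induction_on with
    | _ l ih =>
      intro hl
      cases l with
      | zero => rw [hy0, RKMethod.stage_zero]
      | succ l =>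
        refine ext_inner_right ℝ fun w => ?_
        obtain ⟨φ, rfl⟩ := e.surjective w
        rw [← hip, hy l (by omega), RKMethod.stage_succ, sum_inner]
        refine Finset.sum_congr rfl fun m hm => ?_
        have hm := Finset.mem_range.1 hm
        rw [hip, hH, ih m hm (by omega), inner_add_left, real_inner_smul_left,
          real_inner_smul_left, LinearMap.smul_apply, real_inner_smul_left]
        ring
  rw [← hys, hstage R.s le_rfl, RKMethod.stage_eq_aeval]
  rfl

lemma isRKSolution_steps {S : SemiDiscretization} {R : RKMethod} {τ : ℝ} {u : ℕ → S.V}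
    (hu : S.IsRKSolution R τ u) {E : Type} [NormedAddCommGroup E] [InnerProductSpace ℝ E]
    (e : S.V ≃ E) (L : Module.End ℝ E) (hip : ∀ u v, S.ip u v = inner ℝ (e u) (e v))
    (hH : ∀ u v, S.H u v = inner ℝ (L (e u)) (e v)) (n m : ℕ) :
    e (u (n + m)) = Polynomial.aeval (τ • L) (R.stabPoly ^ m) (e (u n)) := by
  induction m with
  | zero => simp
  | succ m ih =>
    rw [← add_assoc, isRKSolution_step hu e L hip hH, ih, pow_succ', map_mul, Module.End.mul_apply]

/-- The energy estimate for `m` steps of the fully discrete scheme, with `κ = K τ / h`. The factors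
`N₁` and `N₂` are the squared norms of `𝔻_ζ u` and `𝔻_ρ u`. -/
theorem exists_scheme_energy_estimate {R : RKMethod} {m : ℕ} {α : ℕ → ℝ}
    (hα : IsEvolutionCoeff R m α) {ζ ρ : ℕ} (hζ : IsTerminationIndex α ζ)
    (hρ : IsContributionIndex α ζ ρ) :
    ∃ C₁ ≥ 0, ∃ C₂ ≥ 0, ∀ (S : SemiDiscretization) (K τ : ℝ), HasDissipativeOperator S K →
      0 < K → 0 < τ → K * (τ / S.h) ≤ 1 → ∀ u : ℕ → S.V, S.IsRKSolution R τ u → ∀ n,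
        ∃ N₁ N₂ : ℝ, 0 ≤ N₁ ∧ 0 ≤ N₂ ∧ (ρ = ζ → N₁ = N₂) ∧
          N₁ ≤ (K * (τ / S.h)) ^ (2 * ζ) * S.nrm (u n) ^ 2 ∧
          N₂ ≤ (K * (τ / S.h)) ^ (2 * ρ) * S.nrm (u n) ^ 2 ∧
          α 0 ^ 2 * S.nrm (u (n + m)) ^ 2 ≤ α 0 ^ 2 * S.nrm (u n) ^ 2
            + (aLow α ζ ζ ζ + C₁ * (K * (τ / S.h))) * N₁ + C₂ * (K * (τ / S.h)) * N₂ := by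
  set N := (R.stabPoly ^ m).natDegree with hN
  have hrow : ∀ i, N < i → α i = 0 := fun i hi => by
    rw [hα.2 i, Polynomial.coeff_eq_zero_of_natDegree_lt hi, mul_zero]
  obtain ⟨C₁, hC₁, C₂, hC₂, hest⟩ := exists_energy_estimate α hrow hζ hρ
    (M := N + ζ + 1) (by omega) (by omega)
  refine ⟨C₁, hC₁, C₂, hC₂, ?_⟩
  rintro S K τ ⟨hh, E, _, _, e, L, hip, hH, hneg, hL⟩ hK hτ hκ u hu n
  set κ := K * (τ / S.h) with hκdef
  have hκ0 : 0 ≤ κ := by positivity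
  have hnrm : ∀ v, S.nrm v = ‖e v‖ := fun v => by
    rw [SemiDiscretization.nrm, hip, norm_eq_sqrt_real_inner]
  have hTneg : ∀ v, inner ℝ ((τ • L) v) v ≤ 0 := fun v => by
    rw [LinearMap.smul_apply, real_inner_smul_left]
    exact mul_nonpos_of_nonneg_of_nonpos hτ.le (hneg v)
  have hT : ∀ v, ‖(τ • L) v‖ ≤ κ * ‖v‖ := fun v => by
    rw [LinearMap.smul_apply, norm_smul, Real.norm_of_nonneg hτ.le]
    calc τ * ‖L v‖ ≤ τ * (K / S.h * ‖v‖) := by gcongr; exact hL v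
      _ = κ * ‖v‖ := by rw [hκdef]; ring
  have hsq : ∀ i, ‖((τ • L) ^ i) (e (u n))‖ ^ 2 ≤ κ ^ (2 * i) * ‖e (u n)‖ ^ 2 := fun i => by
    refine (pow_le_pow_left₀ (norm_nonneg _) (norm_pow_apply_le hκ0 hT _ i) 2).trans_eq ?_
    rw [mul_pow, ← pow_mul, mul_comm i]
  refine ⟨‖((τ • L) ^ ζ) (e (u n))‖ ^ 2, ‖((τ • L) ^ ρ) (e (u n))‖ ^ 2, by positivity,
    by positivity, fun h => by rw [h], ?_, ?_, ?_⟩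
  · rw [hnrm]; exact hsq ζ
  · rw [hnrm]; exact hsq ρ
  · have h := hest (τ • L) κ hκ0 hκ hTneg hT (e (u n))
    have hsum : ∑ i ∈ Finset.range (N + ζ + 1), α i • ((τ • L) ^ i) (e (u n)) =
        α 0 • e (u (n + m)) := by
      rw [isRKSolution_steps hu e L hip hH, Polynomial.aeval_eq_sum_range' (n := N + ζ + 1)
        (by omega), LinearMap.sum_apply, Finset.smul_sum]
      refine Finset.sum_congr rfl fun i _ => ?_
      rw [hα.2 i, LinearMap.smul_apply, smul_smul]
    rw [hsum, norm_smul, mul_pow, Real.norm_eq_abs, sq_abs] at h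
    rw [hnrm, hnrm]
    exact h

/-- The time step restriction of weak stability: `τ ≤ h ^ (1 + 1 / (q - 1))` gives
`(τ / h) ^ q ≤ τ`. -/
lemma div_pow_le_of_le_rpow {q : ℕ} (hq : 2 ≤ q) {τ h : ℝ} (hτ : 0 < τ) (hh : 0 < h)
    (hle : τ ≤ h ^ (1 + 1 / ((q : ℝ) - 1))) : (τ / h) ^ q ≤ τ := by
  obtain ⟨p, rfl⟩ : ∃ p, q = p + 1 := ⟨q - 1, by omega⟩
  have hp : (0 : ℝ) < p := by exact_mod_cast (by omega : 0 < p)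
  have h1 : τ ^ p ≤ h ^ (p + 1) := by
    calc τ ^ p ≤ (h ^ (1 + 1 / (((p + 1 : ℕ) : ℝ) - 1))) ^ p := by gcongr
      _ = h ^ (p + 1) := by
        rw [← Real.rpow_mul_natCast hh.le, ← Real.rpow_natCast]
        congr 1
        push_cast
        rw [add_sub_cancel_right]
        field_simp
  rw [div_pow, div_le_iff₀ (by positivity), pow_succ τ]
  nlinarith

theorem stability_of_dissipative {R : RKMethod} {r m : ℕ} (hr : 1 ≤ r) (hR : R.HasOrder r)
    {α : ℕ → ℝ} (hα : IsEvolutionCoeff R m α) {ζ ρ : ℕ} (hζ : IsTerminationIndex α ζ)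
    (hρ : IsContributionIndex α ζ ρ) {𝓕 : Set SemiDiscretization} {K : ℝ} (hK : 0 < K)
    (h𝓕 : ∀ S ∈ 𝓕, HasDissipativeOperator S K) :
    (ρ = ζ → aLow α ζ ζ ζ < 0 → MonotonicallyStable R m 𝓕) ∧
    (ρ = ζ → 0 < aLow α ζ ζ ζ → WeaklyStable (2 * ζ) R m 𝓕) ∧
    (ρ < ζ → WeaklyStable (2 * ρ + 1) R m 𝓕) := by
  have hρ1 := one_le_contributionIndex hr hR hα hζ hρ
  have hα0 : 0 < α 0 ^ 2 := pow_pos hα.1 2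
  have hα0' : α 0 ≠ 0 := hα.1.ne'
  obtain ⟨C₁, hC₁, C₂, hC₂, hest⟩ := exists_scheme_energy_estimate hα hζ hρ
  set a := aLow α ζ ζ ζ with ha
  -- Both weak regimes follow from an excess bounded by a multiple of `κ ^ q`.
  have weak : ∀ q : ℕ, 2 ≤ q → ∀ B > 0, (∀ κ N₁ N₂ Z : ℝ, 0 ≤ κ → κ ≤ 1 → 0 ≤ N₁ → 0 ≤ N₂ → 0 ≤ Z →
      (ρ = ζ → N₁ = N₂) → N₁ ≤ κ ^ (2 * ζ) * Z → N₂ ≤ κ ^ (2 * ρ) * Z →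
      (a + C₁ * κ) * N₁ + C₂ * κ * N₂ ≤ B * κ ^ q * Z) → WeaklyStable q R m 𝓕 := by
    intro q hq B hB hbound
    refine ⟨1 / K, by positivity, B * K ^ q / α 0 ^ 2, by positivity, ?_⟩
    intro S hS τ hτ hlam hcfl u hu n
    have hh := (h𝓕 S hS).1
    have hκ : K * (τ / S.h) ≤ 1 := by
      rw [le_div_iff₀ hK] at hlam; linarith
    obtain ⟨N₁, N₂, h1, h2, h3, h4, h5, h6⟩ := hest S K τ (h𝓕 S hS) hK hτ hκ u hu n
    have h7 := hbound _ N₁ N₂ _ (by positivity) hκ h1 h2 (sq_nonneg _) h3 h4 h5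
    have h8 := div_pow_le_of_le_rpow hq hτ hh hcfl
    have h9 : B * (K * (τ / S.h)) ^ q * S.nrm (u n) ^ 2 ≤ B * (K ^ q * τ) * S.nrm (u n) ^ 2 := by
      rw [mul_pow]; gcongr
    refine le_of_mul_le_mul_left ?_ hα0
    calc α 0 ^ 2 * S.nrm (u (n + m)) ^ 2
        ≤ α 0 ^ 2 * S.nrm (u n) ^ 2 + B * (K ^ q * τ) * S.nrm (u n) ^ 2 := by linarith
      _ = _ := by field_simp
  refine ⟨fun hρζ hneg => ?_, fun hρζ hpos => ?_, fun hlt => ?_⟩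
  -- For `κ ≤ -a / (C₁ + C₂ + 1)` the negative term `a ‖w_ζ‖²` dominates the two remainders.
  · refine ⟨min 1 (-a / (C₁ + C₂ + 1)) / K, ?_, ?_⟩
    · have : 0 < -a / (C₁ + C₂ + 1) := div_pos (by linarith) (by positivity)
      exact div_pos (lt_min one_pos this) hK
    intro S hS τ hτ hcfl u hu n
    have hh := (h𝓕 S hS).1
    have hκ : K * (τ / S.h) ≤ min 1 (-a / (C₁ + C₂ + 1)) := by
      have h1 : τ / S.h ≤ min 1 (-a / (C₁ + C₂ + 1)) / K := by rwa [div_le_iff₀ hh]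
      rw [le_div_iff₀ hK] at h1
      linarith
    have hκ0 : 0 ≤ K * (τ / S.h) := by positivity
    have hκ2 := hκ.trans (min_le_right _ _)
    rw [le_div_iff₀ (by positivity)] at hκ2
    obtain ⟨N₁, N₂, h1, h2, h3, -, -, h6⟩ :=
      hest S K τ (h𝓕 S hS) hK hτ (hκ.trans (min_le_left _ _)) u hu n
    rw [← h3 hρζ] at h6
    have h7 : (a + (C₁ + C₂) * (K * (τ / S.h))) * N₁ ≤ 0 :=
      mul_nonpos_of_nonpos_of_nonneg (by linarith) h1
    have h8 : α 0 ^ 2 * S.nrm (u (n + m)) ^ 2 ≤ α 0 ^ 2 * S.nrm (u n) ^ 2 := by linarith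
    exact le_of_sq_le_sq (le_of_mul_le_mul_left h8 hα0) (Real.sqrt_nonneg _)
  · refine weak (2 * ζ) (by omega) (a + C₁ + C₂) (by positivity) ?_
    intro κ N₁ N₂ Z hκ0 hκ1 h1 h2 hZ h3 h4 h5
    rw [← h3 hρζ]
    calc (a + C₁ * κ) * N₁ + C₂ * κ * N₁ = (a + C₁ * κ + C₂ * κ) * N₁ := by ring
      _ ≤ (a + C₁ * 1 + C₂ * 1) * (κ ^ (2 * ζ) * Z) := by gcongr
      _ = _ := by ring
  · refine weak (2 * ρ + 1) (by omega) (|a| + C₁ + C₂ + 1) (by positivity) ?_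
    intro κ N₁ N₂ Z hκ0 hκ1 h1 h2 hZ h3 h4 h5
    have h6 : N₁ ≤ κ ^ (2 * ρ + 1) * Z := h4.trans
      (mul_le_mul_of_nonneg_right (pow_le_pow_of_le_one hκ0 hκ1 (by omega)) hZ)
    have h7 : κ * N₂ ≤ κ ^ (2 * ρ + 1) * Z := by
      rw [pow_succ', mul_assoc]; gcongr
    calc (a + C₁ * κ) * N₁ + C₂ * κ * N₂ ≤ (|a| + C₁ * 1) * N₁ + C₂ * (κ * N₂) := by
          rw [mul_assoc C₂]; gcongr; exact le_abs_self a
      _ ≤ (|a| + C₁ * 1) * (κ ^ (2 * ρ + 1) * Z) + C₂ * (κ ^ (2 * ρ + 1) * Z)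
          + 1 * (κ ^ (2 * ρ + 1) * Z) := by
          have : 0 ≤ 1 * (κ ^ (2 * ρ + 1) * Z) := by positivity
          have h8 : (|a| + C₁ * 1) * N₁ ≤ (|a| + C₁ * 1) * (κ ^ (2 * ρ + 1) * Z) := by gcongr
          have h9 : C₂ * (κ * N₂) ≤ C₂ * (κ ^ (2 * ρ + 1) * Z) := by gcongr
          linarith
      _ = _ := by ring

/-- A bilinear form that is nonpositive on the diagonal and bounded by a multiple of the inner
product is represented by a dissipative operator (Riesz). -/
lemma hasDissipativeOperator_of_bilinear {V : Type} [AddCommGroup V] [Module ℝ V]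
    [FiniteDimensional ℝ V] {ip H : V → V → ℝ} {h K : ℝ} (hh : 0 < h) (hK : 0 < K)
    (hsymm : ∀ u v, ip u v = ip v u)
    (hip : ∀ u v φ (c : ℝ), ip (u + c • v) φ = ip u φ + c * ip v φ)
    (hpos : ∀ u, 0 ≤ ip u u) (hdef : ∀ u, ip u u = 0 → u = 0)
    (hHl : ∀ u v φ (c : ℝ), H (u + c • v) φ = H u φ + c * H v φ)
    (hHr : ∀ u v φ (c : ℝ), H φ (u + c • v) = H φ u + c * H φ v)
    (hneg : ∀ u, H u u ≤ 0) (hbd : ∀ u φ, |H u φ| ≤ K / h * (ip u u + ip φ φ)) :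
    HasDissipativeOperator ⟨V, ip, H, h⟩ (2 * K) := by
  have lin : ∀ f : V → ℝ, (∀ u v (c : ℝ), f (u + c • v) = f u + c * f v) →
      (∀ u v, f (u + v) = f u + f v) ∧ ∀ (c : ℝ) v, f (c • v) = c * f v := by
    intro f hf
    have h0 : f 0 = 0 := by simpa using hf 0 0 1
    exact ⟨fun u v => by simpa using hf u v 1, fun c v => by simpa [h0] using hf 0 v c⟩
  let core : InnerProductSpace.Core ℝ V :=
    { inner := ip
      conj_inner_symm := fun u v => hsymm v u
      re_inner_nonneg := hpos
      add_left := fun u v φ => (lin (fun u => ip u φ) fun u v c => hip u v φ c).1 u v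
      smul_left := fun u φ c => (lin (fun u => ip u φ) fun u v c => hip u v φ c).2 c u
      definite := hdef }
  let _ : NormedAddCommGroup V := core.toNormedAddCommGroup
  let _ : InnerProductSpace ℝ V := InnerProductSpace.ofCore core.toCore
  have hinner : ∀ u v : V, inner ℝ u v = ip u v := fun _ _ => rfl
  let Hlin : V → V →ₗ[ℝ] ℝ := fun u =>
    { toFun := H u
      map_add' := (lin (H u) fun v w c => hHr v w u c).1
      map_smul' := (lin (H u) fun v w c => hHr v w u c).2 }
  have : CompleteSpace V := FiniteDimensional.complete ℝ V
  have hriesz : ∀ u, ∃ z : V, ∀ φ, H u φ = inner ℝ z φ := fun u =>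
    ⟨(InnerProductSpace.toDual ℝ V).symm (LinearMap.toContinuousLinearMap (Hlin u)), fun φ => by
      rw [InnerProductSpace.toDual_symm_apply]; rfl⟩
  choose L hL using hriesz
  let Llin : Module.End ℝ V :=
    { toFun := L
      map_add' := fun u v => ext_inner_right ℝ fun φ => by
        rw [← hL, inner_add_left, ← hL, ← hL]
        exact (lin (fun u => H u φ) fun v w c => hHl v w φ c).1 u v
      map_smul' := fun c u => ext_inner_right ℝ fun φ => by
        rw [← hL, RingHom.id_apply, real_inner_smul_left, ← hL]
        exact (lin (fun u => H u φ) fun v w c => hHl v w φ c).2 c u }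
  refine ⟨hh, V, inferInstance, inferInstance, Equiv.refl V, Llin, fun u v => rfl,
    fun u v => hL u v, fun v => (hL v v).symm.trans_le (hneg v), fun v => ?_⟩
  -- Test the bound with the multiple of `L v` that optimizes it.
  set κ := K / h with hκ
  have hκ0 : 0 < κ := by positivity
  have h1 := (le_abs_self _).trans (hbd v ((1 / (2 * κ)) • L v))
  rw [← hinner, ← hinner, real_inner_self_eq_norm_sq, real_inner_self_eq_norm_sq,
    hL, real_inner_smul_right, real_inner_self_eq_norm_sq, norm_smul, mul_pow, Real.norm_eq_abs,
    sq_abs] at h1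
  have h2 : ‖L v‖ ^ 2 ≤ (2 * κ * ‖v‖) ^ 2 := by
    have h3 := mul_le_mul_of_nonneg_left h1 (by positivity : 0 ≤ 4 * κ)
    have h4 : 4 * κ * (1 / (2 * κ) * ‖L v‖ ^ 2) = 2 * ‖L v‖ ^ 2 := by field_simp; norm_num
    have h5 : 4 * κ * (κ * (‖v‖ ^ 2 + (1 / (2 * κ)) ^ 2 * ‖L v‖ ^ 2)) =
        4 * κ ^ 2 * ‖v‖ ^ 2 + ‖L v‖ ^ 2 := by field_simp; ring
    rw [h4, h5] at h3
    linarith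
  change ‖L v‖ ≤ 2 * K / h * ‖v‖
  rw [mul_div_assoc, ← hκ]
  exact le_of_sq_le_sq h2 (by positivity)

/-! ### Inverse estimates for polynomials -/

/-- Inverse estimate on the reference interval: the `L²` norm on `[0, δ]` is a norm on the coefficient
vectors, and all norms on a finite-dimensional space are equivalent. -/
lemma exists_inverse_estimate_unit (k : ℕ) {δ : ℝ} (hδ : 0 < δ) :
    ∃ C > 0, ∀ p ∈ Polynomial.degreeLT ℝ (k + 1), ∀ t : ℝ, |t| ≤ 1 →
      p.eval t ^ 2 ≤ C * ∫ s in (0 : ℝ)..δ, p.eval s ^ 2 ∧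
      p.derivative.eval t ^ 2 ≤ C * ∫ s in (0 : ℝ)..δ, p.eval s ^ 2 := by
  obtain ⟨ε, hε, h⟩ := exists_pos_mul_sum_sq_le
    (fun x : Fin (k + 1) → ℝ => ∫ s in (0 : ℝ)..δ, (∑ i, x i * s ^ (i : ℕ)) ^ 2)
    (intervalIntegral.continuous_parametric_intervalIntegral_of_continuous' (by fun_prop) 0 δ)
    (fun c x => by
      rw [← intervalIntegral.integral_const_mul]
      congr 1; ext s
      simp only [Pi.smul_apply, smul_eq_mul, mul_assoc, ← Finset.mul_sum]
      ring)
    (fun x hx => by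
      set p : ℝ[X] := ∑ i : Fin (k + 1), Polynomial.monomial (i : ℕ) (x i) with hp
      have hev : ∀ s : ℝ, p.eval s = ∑ i, x i * s ^ (i : ℕ) := fun s => by
        simp [hp, Polynomial.eval_finsetSum]
      simp only [← hev]
      have hp0 : p ≠ 0 := by
        contrapose! hx
        ext i
        have := congrArg (fun q => Polynomial.coeff q (i : ℕ)) hx
        simpa [hp, Polynomial.finsetSum_coeff, Polynomial.coeff_monomial, Fin.val_inj] using this
      obtain ⟨s, hs, hs0⟩ : ∃ s ∈ Set.Icc 0 δ, p.eval s ≠ 0 := by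
        by_contra! hcon
        exact hp0 (Polynomial.eq_zero_of_infinite_isRoot p
          ((Set.Icc_infinite hδ).mono fun s hs => hcon s hs))
      exact intervalIntegral.integral_pos hδ (by fun_prop) (fun _ _ => sq_nonneg _)
        ⟨s, hs, by positivity⟩)
  refine ⟨(k + 1) ^ 3 / ε, by positivity, fun p hp t ht => ?_⟩
  have hdeg : p.natDegree < k + 1 := by
    rcases eq_or_ne p 0 with rfl | hp0
    · simp
    · exact (Polynomial.natDegree_lt_iff_degree_lt hp0).2 (Polynomial.mem_degreeLT.1 hp)
  have hev : ∀ s : ℝ, p.eval s = ∑ i : Fin (k + 1), p.coeff i * s ^ (i : ℕ) := fun s => by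
    rw [Polynomial.eval_eq_sum_range' hdeg, Finset.sum_range]
  have hdev : p.derivative.eval t =
      ∑ i : Fin (k + 1), p.coeff i * (i : ℕ) * t ^ ((i : ℕ) - 1) := by
    rw [Polynomial.derivative_eval, Polynomial.sum_over_range' p (by simp) _ hdeg,
      Finset.sum_range]
  have h1 := h fun i => p.coeff i
  simp only [← hev] at h1
  set I := ∫ s in (0 : ℝ)..δ, p.eval s ^ 2 with hI
  have hbound : ∀ g : Fin (k + 1) → ℝ, (∀ i, g i ^ 2 ≤ (k + 1) ^ 2 * p.coeff i ^ 2) →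
      (∑ i, g i) ^ 2 ≤ (k + 1) ^ 3 / ε * I := by
    intro g hg
    calc (∑ i, g i) ^ 2 ≤ (k + 1) * ∑ i, g i ^ 2 := by
          simpa using sq_sum_le_card_mul_sum_sq (s := Finset.univ) (f := g)
      _ ≤ (k + 1) * ∑ i : Fin (k + 1), (k + 1) ^ 2 * p.coeff i ^ 2 := by
          gcongr with i; exact hg i
      _ = (k + 1) ^ 3 / ε * (ε * ∑ i : Fin (k + 1), p.coeff i ^ 2) := by
          rw [← Finset.mul_sum]; field_simp
      _ ≤ _ := by gcongr
  have hpow : ∀ n : ℕ, (t ^ n) ^ 2 ≤ 1 := fun n => by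
    rw [← sq_abs, abs_pow]
    exact pow_le_one₀ (by positivity) (pow_le_one₀ (abs_nonneg t) ht)
  rw [hdev, hev]
  refine ⟨hbound _ fun i => ?_, hbound _ fun i => ?_⟩
  · rw [mul_pow]
    have := hpow i
    have h2 : (1 : ℝ) ≤ (k + 1) ^ 2 := by
      have : (0 : ℝ) ≤ k := by positivity
      nlinarith
    nlinarith [sq_nonneg (p.coeff i), mul_le_mul_of_nonneg_left this (sq_nonneg (p.coeff i)),
      mul_le_mul_of_nonneg_right h2 (sq_nonneg (p.coeff i))]
  · rw [mul_pow, mul_pow]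
    have h2 := hpow (i - 1)
    have h3 : (((i : ℕ) : ℝ)) ^ 2 ≤ (k + 1) ^ 2 := by
      have : ((i : ℕ) : ℝ) ≤ k + 1 := by exact_mod_cast i.2.le
      gcongr
    calc p.coeff i ^ 2 * ((i : ℕ) : ℝ) ^ 2 * (t ^ ((i : ℕ) - 1)) ^ 2
        ≤ p.coeff i ^ 2 * (k + 1) ^ 2 * 1 := by gcongr
      _ = _ := by ring

/-- Scaled inverse estimates: values and derivatives on `[-H, H]` are controlled by the `L²` norm
on an interval `[0, ℓ]` or `[-ℓ, 0]` of comparable length. -/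
lemma exists_inverse_estimate (k : ℕ) {δ : ℝ} (hδ : 0 < δ) :
    ∃ C > 0, ∀ p ∈ Polynomial.degreeLT ℝ (k + 1), ∀ H ℓ : ℝ, 0 < H → δ * H ≤ ℓ → ∀ t, |t| ≤ H →
      (p.eval t ^ 2 ≤ C / H * ∫ s in (0 : ℝ)..ℓ, p.eval s ^ 2 ∧
        (H * p.derivative.eval t) ^ 2 ≤ C / H * ∫ s in (0 : ℝ)..ℓ, p.eval s ^ 2) ∧
      (p.eval t ^ 2 ≤ C / H * ∫ s in (-ℓ)..0, p.eval s ^ 2 ∧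
        (H * p.derivative.eval t) ^ 2 ≤ C / H * ∫ s in (-ℓ)..0, p.eval s ^ 2) := by
  obtain ⟨C, hC, h⟩ := exists_inverse_estimate_unit k hδ
  refine ⟨C, hC, fun p hp H ℓ hH hℓ t ht => ?_⟩
  have hint : ∀ a b : ℝ, IntervalIntegrable (fun s => p.eval s ^ 2) MeasureTheory.volume a b :=
    fun a b => Continuous.intervalIntegrable (by fun_prop) a b
  have hscale : ∀ c : ℝ, |c| = H →
      p.eval t ^ 2 ≤ C * ∫ s in (0 : ℝ)..δ, p.eval (c * s) ^ 2 ∧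
      (H * p.derivative.eval t) ^ 2 ≤ C * ∫ s in (0 : ℝ)..δ, p.eval (c * s) ^ 2 := by
    intro c hc
    have hc0 : c ≠ 0 := by rintro rfl; simp at hc; linarith
    set r : ℝ[X] := p.comp (Polynomial.C c * Polynomial.X) with hr
    have hrd : r ∈ Polynomial.degreeLT ℝ (k + 1) := by
      rcases eq_or_ne p 0 with rfl | hp0
      · simp [hr]
      · have h1 : p.natDegree < k + 1 :=
          (Polynomial.natDegree_lt_iff_degree_lt hp0).2 (Polynomial.mem_degreeLT.1 hp)
        rw [Polynomial.mem_degreeLT]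
        refine lt_of_le_of_lt Polynomial.degree_le_natDegree ?_
        rw [hr, Polynomial.natDegree_comp, Polynomial.natDegree_C_mul_X _ hc0, mul_one]
        exact_mod_cast h1
    have hev : ∀ s, r.eval s = p.eval (c * s) := fun s => by simp [hr]
    have hdev : ∀ s, r.derivative.eval s = c * p.derivative.eval (c * s) := fun s => by
      simp [hr, Polynomial.derivative_comp]
    have h1 := h r hrd (t / c) (by rw [abs_div, hc, div_le_one hH]; exact ht)
    simp only [hev, hdev, mul_div_cancel₀ t hc0] at h1
    refine ⟨h1.1, ?_⟩
    rw [mul_pow, ← hc, sq_abs, ← mul_pow]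
    exact h1.2
  have hnn : ∀ a b : ℝ, 0 ≤ᵐ[MeasureTheory.volume.restrict (Set.Ioc a b)]
      fun s => p.eval s ^ 2 := fun a b => Filter.Eventually.of_forall fun s => sq_nonneg _
  have hδH : 0 < δ * H := by positivity
  have hpos : C * ∫ s in (0 : ℝ)..δ, p.eval (H * s) ^ 2 ≤
      C / H * ∫ s in (0 : ℝ)..ℓ, p.eval s ^ 2 := by
    rw [intervalIntegral.integral_comp_mul_left (fun s => p.eval s ^ 2) hH.ne', mul_zero,
      smul_eq_mul, ← mul_assoc, ← div_eq_mul_inv, mul_comm H δ]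
    gcongr
    exact intervalIntegral.integral_mono_interval le_rfl hδH.le hℓ (hnn _ _) (hint _ _)
  have hneg : C * ∫ s in (0 : ℝ)..δ, p.eval (-H * s) ^ 2 ≤
      C / H * ∫ s in (-ℓ)..0, p.eval s ^ 2 := by
    rw [intervalIntegral.integral_comp_mul_left (fun s => p.eval s ^ 2) (neg_ne_zero.2 hH.ne'),
      mul_zero, smul_eq_mul, intervalIntegral.integral_symm, inv_neg, neg_mul_neg, ← mul_assoc,
      ← div_eq_mul_inv, neg_mul, mul_comm H δ]
    gcongr
    exact intervalIntegral.integral_mono_interval (by linarith) (by linarith) le_rfl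
      (hnn _ _) (hint _ _)
  have h1 := hscale H (abs_of_pos hH)
  have h2 := hscale (-H) (by rw [abs_neg, abs_of_pos hH])
  exact ⟨⟨h1.1.trans hpos, h1.2.trans hpos⟩, ⟨h2.1.trans hneg, h2.2.trans hneg⟩⟩

/-! ### Integration over the overlapping cells -/

section

variable {N : ℕ} [NeZero N]

lemma primalInt_add_mul (h : ℝ) (i : Fin N) {F G : Fin N → ℝ → ℝ → ℝ} (c : ℝ)
    (hF : ∀ j, Continuous fun p : ℝ × ℝ => F j p.1 p.2)
    (hG : ∀ j, Continuous fun p : ℝ × ℝ => G j p.1 p.2) :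
    primalInt h i (fun j ξ η => F j ξ η + c * G j ξ η) =
      primalInt h i F + c * primalInt h i G := by
  have hF' : ∀ j s, Continuous fun ξ => F j ξ (ξ + s) := fun j s =>
    (hF j).comp (by fun_prop : Continuous fun ξ : ℝ => (ξ, ξ + s))
  have hG' : ∀ j s, Continuous fun ξ => G j ξ (ξ + s) := fun j s =>
    (hG j).comp (by fun_prop : Continuous fun ξ : ℝ => (ξ, ξ + s))
  simp only [primalInt, sub_eq_add_neg]
  rw [intervalIntegral.integral_add ((hF' _ _).intervalIntegrable _ _)
      (((hG' _ _).const_mul c).intervalIntegrable _ _),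
    intervalIntegral.integral_add ((hF' _ _).intervalIntegrable _ _)
      (((hG' _ _).const_mul c).intervalIntegrable _ _),
    intervalIntegral.integral_const_mul, intervalIntegral.integral_const_mul]
  ring

lemma dualInt_add_mul (h : ℝ) (i : Fin N) {F G : Fin N → ℝ → ℝ → ℝ} (c : ℝ)
    (hF : ∀ j, Continuous fun p : ℝ × ℝ => F j p.1 p.2)
    (hG : ∀ j, Continuous fun p : ℝ × ℝ => G j p.1 p.2) :
    dualInt h i (fun j ξ η => F j ξ η + c * G j ξ η) = dualInt h i F + c * dualInt h i G := by
  have hF' : ∀ j s, Continuous fun η => F j (η + s) η := fun j s =>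
    (hF j).comp (by fun_prop : Continuous fun η : ℝ => (η + s, η))
  have hG' : ∀ j s, Continuous fun η => G j (η + s) η := fun j s =>
    (hG j).comp (by fun_prop : Continuous fun η : ℝ => (η + s, η))
  simp only [dualInt, sub_eq_add_neg]
  rw [intervalIntegral.integral_add ((hF' _ _).intervalIntegrable _ _)
      (((hG' _ _).const_mul c).intervalIntegrable _ _),
    intervalIntegral.integral_add ((hF' _ _).intervalIntegrable _ _)
      (((hG' _ _).const_mul c).intervalIntegrable _ _),
    intervalIntegral.integral_const_mul, intervalIntegral.integral_const_mul]
  ring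

lemma primalInt_sum {ι : Type*} (s : Finset ι) (h : ℝ) (i : Fin N)
    {F : ι → Fin N → ℝ → ℝ → ℝ} (hF : ∀ l j, Continuous fun p : ℝ × ℝ => F l j p.1 p.2) :
    primalInt h i (fun j ξ η => ∑ l ∈ s, F l j ξ η) = ∑ l ∈ s, primalInt h i (F l) := by
  have hF' : ∀ l j t, Continuous fun ξ => F l j ξ (ξ + t) := fun l j t =>
    (hF l j).comp (by fun_prop : Continuous fun ξ : ℝ => (ξ, ξ + t))
  simp only [primalInt, sub_eq_add_neg, Finset.sum_add_distrib]
  rw [intervalIntegral.integral_finsetSum fun l _ => (hF' l _ _).intervalIntegrable _ _,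
    intervalIntegral.integral_finsetSum fun l _ => (hF' l _ _).intervalIntegrable _ _]

lemma continuous_primalInt {X : Type*} [TopologicalSpace X] (h : ℝ) (i : Fin N)
    {F : X → Fin N → ℝ → ℝ → ℝ}
    (hF : ∀ j, Continuous fun p : X × ℝ × ℝ => F p.1 j p.2.1 p.2.2) :
    Continuous fun x => primalInt h i (F x) := by
  have hF' : ∀ j s, Continuous (Function.uncurry fun x ξ => F x j ξ (ξ + s)) := fun j s =>
    (hF j).comp (by fun_prop : Continuous fun p : X × ℝ => (p.1, p.2, p.2 + s))
  simp only [primalInt, sub_eq_add_neg]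
  exact (intervalIntegral.continuous_parametric_intervalIntegral_of_continuous' (hF' _ _) _ _).add
    (intervalIntegral.continuous_parametric_intervalIntegral_of_continuous' (hF' _ _) _ _)

lemma intervalIntegral_swap_of_continuous {f : ℝ → ℝ → ℝ} (hf : Continuous (Function.uncurry f))
    (a b c d : ℝ) : ∫ x in a..b, ∫ y in c..d, f x y = ∫ y in c..d, ∫ x in a..b, f x y := by
  refine MeasureTheory.intervalIntegral_intervalIntegral_swap ?_
  exact (hf.continuousOn.integrableOn_compact (isCompact_uIcc.prod isCompact_uIcc)).mono_set
    (Set.prod_mono Set.uIoc_subset_uIcc Set.uIoc_subset_uIcc)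

lemma primalInt_comm {N' : ℕ} [NeZero N'] (h h' : ℝ) (i : Fin N) (j : Fin N')
    {F : Fin N → Fin N' → ℝ → ℝ → ℝ → ℝ → ℝ}
    (hF : ∀ i' j', Continuous fun p : (ℝ × ℝ) × ℝ × ℝ => F i' j' p.1.1 p.1.2 p.2.1 p.2.2) :
    primalInt h i (fun i' ξ₁ η₁ => primalInt h' j fun j' ξ₂ η₂ => F i' j' ξ₁ η₁ ξ₂ η₂) =
      primalInt h' j (fun j' ξ₂ η₂ => primalInt h i fun i' ξ₁ η₁ => F i' j' ξ₁ η₁ ξ₂ η₂) := by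
  have hF' : ∀ i' j' s t, Continuous (Function.uncurry fun x y => F i' j' x (x + s) y (y + t)) :=
    fun i' j' s t => (hF i' j').comp
      (by fun_prop : Continuous fun p : ℝ × ℝ => ((p.1, p.1 + s), p.2, p.2 + t))
  have hF'' : ∀ i' j' s t, Continuous (Function.uncurry fun y x => F i' j' x (x + s) y (y + t)) :=
    fun i' j' s t => (hF i' j').comp
      (by fun_prop : Continuous fun p : ℝ × ℝ => ((p.2, p.2 + s), p.1, p.1 + t))
  have hint : ∀ i' j' s t a b c d, IntervalIntegrable
      (fun x => ∫ y in c..d, F i' j' x (x + s) y (y + t)) MeasureTheory.volume a b :=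
    fun i' j' s t a b c d =>
      (intervalIntegral.continuous_parametric_intervalIntegral_of_continuous'
        (hF' i' j' s t) c d).intervalIntegrable a b
  have hint' : ∀ i' j' s t a b c d, IntervalIntegrable
      (fun y => ∫ x in c..d, F i' j' x (x + s) y (y + t)) MeasureTheory.volume a b :=
    fun i' j' s t a b c d =>
      (intervalIntegral.continuous_parametric_intervalIntegral_of_continuous'
        (hF'' i' j' s t) c d).intervalIntegrable a b
  simp only [primalInt, sub_eq_add_neg]
  rw [intervalIntegral.integral_add (hint _ _ _ _ _ _ _ _) (hint _ _ _ _ _ _ _ _),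
    intervalIntegral.integral_add (hint _ _ _ _ _ _ _ _) (hint _ _ _ _ _ _ _ _),
    intervalIntegral.integral_add (hint' _ _ _ _ _ _ _ _) (hint' _ _ _ _ _ _ _ _),
    intervalIntegral.integral_add (hint' _ _ _ _ _ _ _ _) (hint' _ _ _ _ _ _ _ _)]
  simp only [intervalIntegral_swap_of_continuous (hF' _ _ _ _)]
  ring

lemma abs_primalInt_le {h : ℝ} (hh : 0 ≤ h) (i : Fin N) {F : Fin N → ℝ → ℝ → ℝ} {b : Fin N → ℝ}
    (hF : ∀ j ξ η, |ξ| ≤ h / 2 → |η| ≤ h / 2 → |F j ξ η| ≤ b j) :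
    |primalInt h i F| ≤ h / 2 * (b (i - 1) + b i) := by
  have h1 : |∫ ξ in (-(h / 2))..0, F (i - 1) ξ (ξ + h / 2)| ≤ b (i - 1) * |0 - -(h / 2)| := by
    rw [← Real.norm_eq_abs]
    refine intervalIntegral.norm_integral_le_of_norm_le_const fun ξ hξ => ?_
    rw [Set.uIoc_of_le (by linarith)] at hξ
    exact hF _ _ _ (abs_le.2 ⟨hξ.1.le, by linarith [hξ.2]⟩)
      (abs_le.2 ⟨by linarith [hξ.1], by linarith [hξ.2]⟩)
  have h2 : |∫ ξ in (0 : ℝ)..(h / 2), F i ξ (ξ - h / 2)| ≤ b i * |h / 2 - 0| := by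
    rw [← Real.norm_eq_abs]
    refine intervalIntegral.norm_integral_le_of_norm_le_const fun ξ hξ => ?_
    rw [Set.uIoc_of_le (by linarith)] at hξ
    exact hF _ _ _ (abs_le.2 ⟨by linarith [hξ.1], hξ.2⟩)
      (abs_le.2 ⟨by linarith [hξ.1], by linarith [hξ.2]⟩)
  rw [zero_sub, neg_neg, abs_of_nonneg (by linarith : 0 ≤ h / 2)] at h1
  rw [sub_zero, abs_of_nonneg (by linarith : 0 ≤ h / 2)] at h2
  refine (abs_add_le _ _).trans ?_
  linarith

lemma abs_dualInt_le {h : ℝ} (hh : 0 ≤ h) (i : Fin N) {F : Fin N → ℝ → ℝ → ℝ} {b : Fin N → ℝ}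
    (hF : ∀ j ξ η, |ξ| ≤ h / 2 → |η| ≤ h / 2 → |F j ξ η| ≤ b j) :
    |dualInt h i F| ≤ h / 2 * (b i + b (i + 1)) := by
  have h1 : |∫ η in (-(h / 2))..0, F i (η + h / 2) η| ≤ b i * |0 - -(h / 2)| := by
    rw [← Real.norm_eq_abs]
    refine intervalIntegral.norm_integral_le_of_norm_le_const fun η hη => ?_
    rw [Set.uIoc_of_le (by linarith)] at hη
    exact hF _ _ _ (abs_le.2 ⟨by linarith [hη.1], by linarith [hη.2]⟩)
      (abs_le.2 ⟨hη.1.le, by linarith [hη.2]⟩)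
  have h2 : |∫ η in (0 : ℝ)..(h / 2), F (i + 1) (η - h / 2) η| ≤ b (i + 1) * |h / 2 - 0| := by
    rw [← Real.norm_eq_abs]
    refine intervalIntegral.norm_integral_le_of_norm_le_const fun η hη => ?_
    rw [Set.uIoc_of_le (by linarith)] at hη
    exact hF _ _ _ (abs_le.2 ⟨by linarith [hη.1], by linarith [hη.2]⟩)
      (abs_le.2 ⟨by linarith [hη.1], hη.2⟩)
  rw [zero_sub, neg_neg, abs_of_nonneg (by linarith : 0 ≤ h / 2)] at h1
  rw [sub_zero, abs_of_nonneg (by linarith : 0 ≤ h / 2)] at h2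
  refine (abs_add_le _ _).trans ?_
  linarith

lemma primalInt_nonneg {h : ℝ} (hh : 0 ≤ h) (i : Fin N) {F : Fin N → ℝ → ℝ → ℝ}
    (hF : ∀ j ξ η, 0 ≤ F j ξ η) : 0 ≤ primalInt h i F :=
  add_nonneg (intervalIntegral.integral_nonneg (by linarith) fun _ _ => hF _ _ _)
    (intervalIntegral.integral_nonneg (by linarith) fun _ _ => hF _ _ _)

/-- Integrating a lower bound that depends on the primal coordinate only, over the right half. -/
lemma integral_right_le_primalInt {h : ℝ} (hh : 0 ≤ h) (i : Fin N) {F : Fin N → ℝ → ℝ → ℝ}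
    (hc : ∀ j, Continuous fun p : ℝ × ℝ => F j p.1 p.2) (hF : ∀ j ξ η, 0 ≤ F j ξ η)
    {f : ℝ → ℝ} (hf : Continuous f) (hle : ∀ ξ η, |ξ| ≤ h / 2 → |η| ≤ h / 2 → f ξ ≤ F i ξ η) :
    ∫ ξ in (0 : ℝ)..(h / 2), f ξ ≤ primalInt h i F := by
  have hc' : Continuous fun ξ => F i ξ (ξ - h / 2) :=
    (hc i).comp (by fun_prop : Continuous fun ξ : ℝ => (ξ, ξ - h / 2))
  have h1 : 0 ≤ ∫ ξ in (-(h / 2))..0, F (i - 1) ξ (ξ + h / 2) :=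
    intervalIntegral.integral_nonneg (by linarith) fun _ _ => hF _ _ _
  have h2 : ∫ ξ in (0 : ℝ)..(h / 2), f ξ ≤ ∫ ξ in (0 : ℝ)..(h / 2), F i ξ (ξ - h / 2) := by
    refine intervalIntegral.integral_mono_on (by linarith) (hf.intervalIntegrable _ _)
      (hc'.intervalIntegrable _ _) fun ξ hξ => ?_
    exact hle _ _ (abs_le.2 ⟨by linarith [hξ.1], hξ.2⟩)
      (abs_le.2 ⟨by linarith [hξ.1], by linarith [hξ.2]⟩)
  rw [primalInt]; linarith

/-- Integrating a lower bound that depends on the dual coordinate only, over the left half of the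
dual cell `i`, which is the right half of the primal cell `i`. -/
lemma integral_left_dual_le_primalInt {h : ℝ} (hh : 0 ≤ h) (i : Fin N) {F : Fin N → ℝ → ℝ → ℝ}
    (hc : ∀ j, Continuous fun p : ℝ × ℝ => F j p.1 p.2) (hF : ∀ j ξ η, 0 ≤ F j ξ η)
    {f : ℝ → ℝ} (hf : Continuous f) (hle : ∀ ξ η, |ξ| ≤ h / 2 → |η| ≤ h / 2 → f η ≤ F i ξ η) :
    ∫ η in (-(h / 2))..0, f η ≤ primalInt h i F := by
  have hc' : Continuous fun ξ => F i ξ (ξ - h / 2) :=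
    (hc i).comp (by fun_prop : Continuous fun ξ : ℝ => (ξ, ξ - h / 2))
  have h1 : 0 ≤ ∫ ξ in (-(h / 2))..0, F (i - 1) ξ (ξ + h / 2) :=
    intervalIntegral.integral_nonneg (by linarith) fun _ _ => hF _ _ _
  have h2 : ∫ ξ in (0 : ℝ)..(h / 2), f (ξ - h / 2) ≤
      ∫ ξ in (0 : ℝ)..(h / 2), F i ξ (ξ - h / 2) := by
    refine intervalIntegral.integral_mono_on (by linarith)
      ((hf.comp (by fun_prop : Continuous fun ξ : ℝ => ξ - h / 2)).intervalIntegrable _ _)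
      (hc'.intervalIntegrable _ _) fun ξ hξ => ?_
    exact hle _ _ (abs_le.2 ⟨by linarith [hξ.1], hξ.2⟩)
      (abs_le.2 ⟨by linarith [hξ.1], by linarith [hξ.2]⟩)
  rw [intervalIntegral.integral_comp_sub_right (fun η => f η), zero_sub, sub_self] at h2
  rw [primalInt]; linarith

lemma sum_add_one_shift (f : Fin N → ℝ) : ∑ i, f (i + 1) = ∑ i, f i :=
  Equiv.sum_comp (Equiv.addRight (1 : Fin N)) f

lemma sum_sub_one_shift (f : Fin N → ℝ) : ∑ i, f (i - 1) = ∑ i, f i :=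
  Equiv.sum_comp (Equiv.subRight (1 : Fin N)) f

/-- The fundamental theorem of calculus on the overlaps; the boundary terms are sorted into those
at the ends of the primal and at the ends of the dual cells. -/
lemma sum_primalInt_deriv {h : Fin N → ℝ} {G G' : Fin N → Fin N → ℝ → ℝ → ℝ}
    (hG : ∀ i j s ξ, HasDerivAt (fun ξ => G i j ξ (ξ + s)) (G' i j ξ (ξ + s)) ξ)
    (hc : ∀ i j, Continuous fun p : ℝ × ℝ => G' i j p.1 p.2) :
    ∑ i, primalInt (h i) i (G' i) =
      ∑ i, (G i i (h i / 2) 0 - G i (i - 1) (-(h i / 2)) 0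
        + G (i + 1) i 0 (h (i + 1) / 2) - G i i 0 (-(h i / 2))) := by
  have hc' : ∀ i j s, Continuous fun ξ => G' i j ξ (ξ + s) := fun i j s =>
    (hc i j).comp (by fun_prop : Continuous fun ξ : ℝ => (ξ, ξ + s))
  have hftc : ∀ i j s a b, ∫ ξ in a..b, G' i j ξ (ξ + s) = G i j b (b + s) - G i j a (a + s) :=
    fun i j s a b => intervalIntegral.integral_eq_sub_of_hasDerivAt (fun ξ _ => hG i j s ξ)
      ((hc' i j s).intervalIntegrable _ _)
  have hshift := sum_add_one_shift fun i : Fin N => G i (i - 1) 0 (h i / 2)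
  simp only [add_sub_cancel_right] at hshift
  simp only [primalInt, sub_eq_add_neg, hftc]
  simp only [zero_add, neg_add_cancel, add_neg_cancel, ← sub_eq_add_neg, zero_sub,
    Finset.sum_add_distrib, Finset.sum_sub_distrib, hshift]
  linarith

lemma sum_dualInt (h : ℝ) (F : Fin N → Fin N → ℝ → ℝ → ℝ) :
    ∑ j, dualInt h j (F j) = ∑ i, primalInt h i fun j ξ η => F j i ξ η := by
  have h1 : ∀ j, ∫ η in (-(h / 2))..0, F j j (η + h / 2) η =
      ∫ ξ in (0 : ℝ)..(h / 2), F j j ξ (ξ - h / 2) := fun j => by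
    have := intervalIntegral.integral_comp_add_right (a := -(h / 2)) (b := 0)
      (fun ξ => F j j ξ (ξ - h / 2)) (h / 2)
    simpa using this
  have h2 : ∀ j, ∫ η in (0 : ℝ)..(h / 2), F j (j + 1) (η - h / 2) η =
      ∫ ξ in (-(h / 2))..0, F (j + 1 - 1) (j + 1) ξ (ξ + h / 2) := fun j => by
    have := intervalIntegral.integral_comp_sub_right (a := 0) (b := h / 2)
      (fun ξ => F j (j + 1) ξ (ξ + h / 2)) (h / 2)
    simpa using this
  have hshift := sum_add_one_shift fun i : Fin N =>
    ∫ ξ in (-(h / 2))..0, F (i - 1) i ξ (ξ + h / 2)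
  simp only [dualInt, primalInt, Finset.sum_add_distrib, h1, h2, hshift]
  ring

end

/-! ### The one-dimensional method -/

namespace Mesh1D

variable {a b : ℝ} {N : ℕ} (M : Mesh1D a b N)

lemma size_pos (i : Fin N) : 0 < M.size i :=
  sub_pos.2 (M.strictMono Fin.castSucc_lt_succ)

lemma size_le_h (i : Fin N) : M.size i ≤ M.h :=
  le_ciSup (Set.finite_range M.size).bddAbove i

lemma h_pos [NeZero N] : 0 < M.h := (M.size_pos 0).trans_le (M.size_le_h 0)

variable [NeZero N]

lemma integral_add_mul {F G : Fin N → Fin N → ℝ → ℝ → ℝ} (c : ℝ)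
    (hF : ∀ i j, Continuous fun p : ℝ × ℝ => F i j p.1 p.2)
    (hG : ∀ i j, Continuous fun p : ℝ × ℝ => G i j p.1 p.2) :
    M.integral (fun i j ξ η => F i j ξ η + c * G i j ξ η) = M.integral F + c * M.integral G := by
  simp only [integral, primalInt_add_mul _ _ c (hF _) (hG _), Finset.sum_add_distrib,
    Finset.mul_sum]

lemma abs_integral_le {F : Fin N → Fin N → ℝ → ℝ → ℝ} {e : Fin N → ℝ} (he : ∀ i, 0 ≤ e i)
    (hF : ∀ i j ξ η, |ξ| ≤ M.h / 2 → |η| ≤ M.h / 2 → |F i j ξ η| ≤ e i + e j) :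
    |M.integral F| ≤ 2 * M.h * ∑ i, e i := by
  have h1 : ∀ i, |primalInt (M.size i) i (F i)| ≤ M.h / 2 * (3 * e i + e (i - 1)) := by
    intro i
    have hs := M.size_le_h i
    refine (abs_primalInt_le (b := fun j => e i + e j) (M.size_pos i).le i fun j ξ η hξ hη =>
      hF i j ξ η (hξ.trans (by linarith)) (hη.trans (by linarith))).trans ?_
    have := he (i - 1)
    have := he i
    calc M.size i / 2 * (e i + e (i - 1) + (e i + e i))
        ≤ M.h / 2 * (e i + e (i - 1) + (e i + e i)) := by gcongr
      _ = _ := by ring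
  refine (Finset.abs_sum_le_sum_abs _ _).trans ((Finset.sum_le_sum fun i _ => h1 i).trans_eq ?_)
  rw [← Finset.mul_sum, Finset.sum_add_distrib, ← Finset.mul_sum, sum_sub_one_shift e]
  ring

end Mesh1D

lemma abs_mul_le_add_of_sq_le {x y A B : ℝ} (hx : x ^ 2 ≤ A) (hy : y ^ 2 ≤ B) :
    |x * y| ≤ A + B := by
  rw [abs_le]
  constructor <;> nlinarith [sq_nonneg (x + y), sq_nonneg (x - y), sq_nonneg x, sq_nonneg y]

namespace Space1D

variable {k N : ℕ}

@[fun_prop]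
lemma continuous_fst {X : Type*} [TopologicalSpace X] (u : Space1D k N) (i : Fin N) {f : X → ℝ}
    (hf : Continuous f) : Continuous fun x => u.fst i (f x) :=
  (Polynomial.continuous _).comp hf

@[fun_prop]
lemma continuous_snd {X : Type*} [TopologicalSpace X] (u : Space1D k N) (i : Fin N) {f : X → ℝ}
    (hf : Continuous f) : Continuous fun x => u.snd i (f x) :=
  (Polynomial.continuous _).comp hf

@[fun_prop]
lemma continuous_dfst {X : Type*} [TopologicalSpace X] (u : Space1D k N) (i : Fin N) {f : X → ℝ}
    (hf : Continuous f) : Continuous fun x => u.dfst i (f x) :=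
  (Polynomial.continuous _).comp hf

@[fun_prop]
lemma continuous_dsnd {X : Type*} [TopologicalSpace X] (u : Space1D k N) (i : Fin N) {f : X → ℝ}
    (hf : Continuous f) : Continuous fun x => u.dsnd i (f x) :=
  (Polynomial.continuous _).comp hf

lemma fst_add_smul (u v : Space1D k N) (c : ℝ) (i : Fin N) (ξ : ℝ) :
    (u + c • v).fst i ξ = u.fst i ξ + c * v.fst i ξ := by simp [fst]

lemma snd_add_smul (u v : Space1D k N) (c : ℝ) (i : Fin N) (ξ : ℝ) :
    (u + c • v).snd i ξ = u.snd i ξ + c * v.snd i ξ := by simp [snd]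

lemma dfst_add_smul (u v : Space1D k N) (c : ℝ) (i : Fin N) (ξ : ℝ) :
    (u + c • v).dfst i ξ = u.dfst i ξ + c * v.dfst i ξ := by simp [dfst]

lemma dsnd_add_smul (u v : Space1D k N) (c : ℝ) (i : Fin N) (ξ : ℝ) :
    (u + c • v).dsnd i ξ = u.dsnd i ξ + c * v.dsnd i ξ := by simp [dsnd]

instance : FiniteDimensional ℝ (Space1D k N) :=
  have : Module.Finite ℝ (Polynomial.degreeLT ℝ (k + 1)) :=
    Module.Finite.equiv (Polynomial.degreeLTEquiv ℝ (k + 1)).symm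
  inferInstanceAs (Module.Finite ℝ (_ × _))

variable {a b : ℝ} [NeZero N]

/-- The squared `L²` norm of both components over the primal cell `i`. -/
def localEnergy (M : Mesh1D a b N) (u : Space1D k N) (i : Fin N) : ℝ :=
  primalInt (M.size i) i fun j ξ η => u.fst i ξ * u.fst i ξ + u.snd j η * u.snd j η

lemma localEnergy_nonneg (M : Mesh1D a b N) (u : Space1D k N) (i : Fin N) :
    0 ≤ localEnergy M u i :=
  primalInt_nonneg (M.size_pos i).le i fun _ _ _ =>
    add_nonneg (mul_self_nonneg _) (mul_self_nonneg _)

end Space1D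

section

open Space1D

/-- Pointwise values and scaled derivatives of both components are controlled by the local energy.
For the dual cell `i`, its left half, which belongs to the primal cell `i`, suffices. -/
lemma exists_local_bound_1D (k : ℕ) {σ : ℝ} (hσ : 0 < σ) :
    ∃ C > 0, ∀ {a b : ℝ} {N : ℕ} [NeZero N] (M : Mesh1D a b N), M.QuasiUniform σ →
      ∀ (u : Space1D k N) (i : Fin N) (x : ℝ), |x| ≤ M.h / 2 →
        (u.fst i x ^ 2 ≤ C / M.h * localEnergy M u i ∧
          (M.h * u.dfst i x) ^ 2 ≤ C / M.h * localEnergy M u i) ∧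
        (u.snd i x ^ 2 ≤ C / M.h * localEnergy M u i ∧
          (M.h * u.dsnd i x) ^ 2 ≤ C / M.h * localEnergy M u i) := by
  obtain ⟨C, hC, hinv⟩ := exists_inverse_estimate k (one_div_pos.2 hσ)
  refine ⟨8 * C, by positivity, fun {a b N} _ M hM u i x hx => ?_⟩
  have hh := M.h_pos
  have hs := (M.size_pos i).le
  have hlen : 1 / σ * (M.h / 2) ≤ M.size i / 2 := by
    rw [one_div, ← div_eq_inv_mul, div_le_iff₀ hσ]
    linarith [hM i]
  have hE := localEnergy_nonneg M u i
  have h1 := (hinv _ (u.1 i).2 (M.h / 2) _ (by positivity) hlen x hx).1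
  have h2 := (hinv _ (u.2 i).2 (M.h / 2) _ (by positivity) hlen x hx).2
  have hc : ∀ j, Continuous fun p : ℝ × ℝ =>
      u.fst i p.1 * u.fst i p.1 + u.snd j p.2 * u.snd j p.2 := fun j => by fun_prop
  have hnn : ∀ j ξ η, 0 ≤ u.fst i ξ * u.fst i ξ + u.snd j η * u.snd j η := fun j ξ η =>
    add_nonneg (mul_self_nonneg _) (mul_self_nonneg _)
  have h3 : ∫ s in (0 : ℝ)..(M.size i / 2), u.fst i s ^ 2 ≤ localEnergy M u i :=
    integral_right_le_primalInt hs i hc hnn (by fun_prop) fun ξ η _ _ => by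
      nlinarith [mul_self_nonneg (u.snd i η)]
  have h4 : ∫ s in (-(M.size i / 2))..0, u.snd i s ^ 2 ≤ localEnergy M u i :=
    integral_left_dual_le_primalInt hs i hc hnn (by fun_prop) fun ξ η _ _ => by
      nlinarith [mul_self_nonneg (u.fst i ξ)]
  have e1 : ∀ {x y I : ℝ}, x ≤ C / (M.h / 2) * I → I ≤ localEnergy M u i → y ≤ 4 * x →
      y ≤ 8 * C / M.h * localEnergy M u i := by
    intro x y I hx hI hy
    have : C / (M.h / 2) * I ≤ C / (M.h / 2) * localEnergy M u i := by gcongr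
    have h5 : C / (M.h / 2) * localEnergy M u i * 4 = 8 * C / M.h * localEnergy M u i := by
      field_simp; ring
    linarith
  refine ⟨⟨e1 h1.1 h3 ?_, e1 h1.2 h3 ?_⟩, ⟨e1 h2.1 h4 ?_, e1 h2.2 h4 ?_⟩⟩
  · change _ ≤ 4 * u.fst i x ^ 2
    nlinarith [sq_nonneg (u.fst i x)]
  · change (M.h * u.dfst i x) ^ 2 ≤ 4 * (M.h / 2 * u.dfst i x) ^ 2
    linarith
  · change _ ≤ 4 * u.snd i x ^ 2
    nlinarith [sq_nonneg (u.snd i x)]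
  · change (M.h * u.dsnd i x) ^ 2 ≤ 4 * (M.h / 2 * u.dsnd i x) ^ 2
    linarith

section

variable {a b : ℝ} {k N : ℕ} [NeZero N]

lemma H1D_add_smul_left (β CCFL : ℝ) (M : Mesh1D a b N) (u v φ : Space1D k N) (c : ℝ) :
    H1D β CCFL M (u + c • v) φ = H1D β CCFL M u φ + c * H1D β CCFL M v φ := by
  have h1 := M.integral_add_mul c
    (F := fun i j ξ η => (u.fst i ξ - u.snd j η) * (φ.fst i ξ - φ.snd j η))
    (G := fun i j ξ η => (v.fst i ξ - v.snd j η) * (φ.fst i ξ - φ.snd j η))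
    (fun i j => by fun_prop) (fun i j => by fun_prop)
  have h2 := M.integral_add_mul c
    (F := fun i j ξ η => β * u.snd j η * φ.dfst i ξ + β * u.fst i ξ * φ.dsnd j η)
    (G := fun i j ξ η => β * v.snd j η * φ.dfst i ξ + β * v.fst i ξ * φ.dsnd j η)
    (fun i j => by fun_prop) (fun i j => by fun_prop)
  have e1 : M.integral (fun i j ξ η => ((u + c • v).fst i ξ - (u + c • v).snd j η) *
      (φ.fst i ξ - φ.snd j η)) = _ := Eq.trans (by
        congr 1; ext i j ξ η; rw [fst_add_smul, snd_add_smul]; ring) h1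
  have e2 : M.integral (fun i j ξ η => β * (u + c • v).snd j η * φ.dfst i ξ +
      β * (u + c • v).fst i ξ * φ.dsnd j η) = _ := Eq.trans (by
        congr 1; ext i j ξ η; rw [fst_add_smul, snd_add_smul]; ring) h2
  rw [H1D, e1, e2, H1D, H1D, mul_sub, Finset.mul_sum, ← sub_eq_zero]
  simp only [fst_add_smul, snd_add_smul]
  rw [sub_eq_zero, Finset.sum_congr rfl (g := fun i =>
    (β * u.snd i 0 * φ.fst i (M.size i / 2) - β * u.snd (i - 1) 0 * φ.fst i (-(M.size i / 2))
      + β * u.fst (i + 1) 0 * φ.snd i (M.size (i + 1) / 2)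
      - β * u.fst i 0 * φ.snd i (-(M.size i / 2))) +
    c * (β * v.snd i 0 * φ.fst i (M.size i / 2) - β * v.snd (i - 1) 0 * φ.fst i (-(M.size i / 2))
      + β * v.fst (i + 1) 0 * φ.snd i (M.size (i + 1) / 2)
      - β * v.fst i 0 * φ.snd i (-(M.size i / 2)))) fun i _ => by ring, Finset.sum_add_distrib]
  ring

lemma H1D_add_smul_right (β CCFL : ℝ) (M : Mesh1D a b N) (u v φ : Space1D k N) (c : ℝ) :
    H1D β CCFL M φ (u + c • v) = H1D β CCFL M φ u + c * H1D β CCFL M φ v := by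
  have h1 := M.integral_add_mul c
    (F := fun i j ξ η => (φ.fst i ξ - φ.snd j η) * (u.fst i ξ - u.snd j η))
    (G := fun i j ξ η => (φ.fst i ξ - φ.snd j η) * (v.fst i ξ - v.snd j η))
    (fun i j => by fun_prop) (fun i j => by fun_prop)
  have h2 := M.integral_add_mul c
    (F := fun i j ξ η => β * φ.snd j η * u.dfst i ξ + β * φ.fst i ξ * u.dsnd j η)
    (G := fun i j ξ η => β * φ.snd j η * v.dfst i ξ + β * φ.fst i ξ * v.dsnd j η)
    (fun i j => by fun_prop) (fun i j => by fun_prop)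
  have e1 : M.integral (fun i j ξ η => (φ.fst i ξ - φ.snd j η) *
      ((u + c • v).fst i ξ - (u + c • v).snd j η)) = _ := Eq.trans (by
        congr 1; ext i j ξ η; rw [fst_add_smul, snd_add_smul]; ring) h1
  have e2 : M.integral (fun i j ξ η => β * φ.snd j η * (u + c • v).dfst i ξ +
      β * φ.fst i ξ * (u + c • v).dsnd j η) = _ := Eq.trans (by
        congr 1; ext i j ξ η; rw [dfst_add_smul, dsnd_add_smul]; ring) h2
  rw [H1D, e1, e2, H1D, H1D, mul_sub, Finset.mul_sum, ← sub_eq_zero]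
  simp only [fst_add_smul, snd_add_smul]
  rw [sub_eq_zero, Finset.sum_congr rfl (g := fun i =>
    (β * φ.snd i 0 * u.fst i (M.size i / 2) - β * φ.snd (i - 1) 0 * u.fst i (-(M.size i / 2))
      + β * φ.fst (i + 1) 0 * u.snd i (M.size (i + 1) / 2)
      - β * φ.fst i 0 * u.snd i (-(M.size i / 2))) +
    c * (β * φ.snd i 0 * v.fst i (M.size i / 2) - β * φ.snd (i - 1) 0 * v.fst i (-(M.size i / 2))
      + β * φ.fst (i + 1) 0 * v.snd i (M.size (i + 1) / 2)
      - β * φ.fst i 0 * v.snd i (-(M.size i / 2)))) fun i _ => by ring, Finset.sum_add_distrib]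
  ring

/-- The transport terms cancel on the diagonal, which leaves only the dissipation between the two
overlapping solutions. -/
lemma H1D_self (β CCFL : ℝ) (M : Mesh1D a b N) (u : Space1D k N) :
    H1D β CCFL M u u = -(1 / tauMax1D β CCFL M.h) *
      M.integral (fun i j ξ η => (u.fst i ξ - u.snd j η) * (u.fst i ξ - u.snd j η)) := by
  have hfst : ∀ i ξ, HasDerivAt (u.fst i) (u.dfst i ξ) ξ := fun i ξ => Polynomial.hasDerivAt _ _
  have hsnd : ∀ j η, HasDerivAt (u.snd j) (u.dsnd j η) η := fun j η => Polynomial.hasDerivAt _ _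
  have h := sum_primalInt_deriv (h := M.size) (G := fun i j ξ η => β * u.fst i ξ * u.snd j η)
    (G' := fun i j ξ η => β * u.snd j η * u.dfst i ξ + β * u.fst i ξ * u.dsnd j η)
    (fun i j s ξ => by
      refine (((hfst i ξ).const_mul β).mul
        ((hsnd j (ξ + s)).comp_add_const ξ s)).congr_deriv ?_
      ring)
    (fun i j => by fun_prop)
  have h' : M.integral (fun i j ξ η => β * u.snd j η * u.dfst i ξ + β * u.fst i ξ * u.dsnd j η)
    = _ := h
  rw [H1D, h', add_sub_assoc, ← Finset.sum_sub_distrib]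
  exact add_eq_left.2 (Finset.sum_eq_zero fun i _ => by ring)

end

theorem exists_hasDissipativeOperator_1D (k : ℕ) (β σ : ℝ) {CCFL : ℝ} (hCFL : 0 < CCFL) :
    ∃ K > 0, ∀ S ∈ cdgFamily1D k β CCFL σ, HasDissipativeOperator S K := by
  by_cases hσ : σ ≤ 0
  · refine ⟨1, one_pos, ?_⟩
    rintro S ⟨a, b, N, hN, M, hM, -⟩
    have h1 := hM 0
    have h2 := M.h_pos
    have h3 := M.size_pos 0
    nlinarith
  push Not at hσ
  obtain ⟨C, hC, hloc⟩ := exists_local_bound_1D k hσ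
  refine ⟨2 * ((4 * |β| / CCFL + 8 * |β|) * C + 1), by positivity, ?_⟩
  rintro S ⟨a, b, N, hN, M, hM, rfl⟩
  have hh := M.h_pos
  have hip : ∀ u : Space1D k N, (cdg1D k β CCFL M).ip u u = ∑ i, localEnergy M u i :=
    fun u => rfl
  have hipnn : ∀ u : Space1D k N, 0 ≤ (cdg1D k β CCFL M).ip u u := fun u => by
    rw [hip]; exact Finset.sum_nonneg fun i _ => localEnergy_nonneg M u i
  refine hasDissipativeOperator_of_bilinear (V := Space1D k N) (ip := (cdg1D k β CCFL M).ip)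
    (H := H1D β CCFL M) hh (by positivity) ?_ ?_ hipnn ?_
    (fun u v φ c => H1D_add_smul_left β CCFL M u v φ c)
    (fun u v φ c => H1D_add_smul_right β CCFL M u v φ c) ?_ ?_
  · intro u v
    simp only [cdg1D]
    congr 1; ext i j ξ η; ring
  · intro u v φ c
    have h1 := M.integral_add_mul c
      (F := fun i j ξ η => u.fst i ξ * φ.fst i ξ + u.snd j η * φ.snd j η)
      (G := fun i j ξ η => v.fst i ξ * φ.fst i ξ + v.snd j η * φ.snd j η)
      (fun i j => by fun_prop) (fun i j => by fun_prop)
    refine Eq.trans ?_ h1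
    simp only [cdg1D]
    congr 1; ext i j ξ η; rw [fst_add_smul, snd_add_smul]; ring
  · intro u hu
    rw [hip, Finset.sum_eq_zero_iff_of_nonneg fun i _ => localEnergy_nonneg M u i] at hu
    have hpoly : ∀ p : ℝ[X], (∀ x, |x| ≤ M.h / 2 → p.eval x ^ 2 ≤ 0) → p = 0 := by
      intro p hp
      refine Polynomial.eq_zero_of_infinite_isRoot p
        ((Set.Icc_infinite (by linarith : -(M.h / 2) < M.h / 2)).mono fun x hx => ?_)
      exact pow_eq_zero_iff (two_ne_zero) |>.1 (le_antisymm (hp x (abs_le.2 hx)) (sq_nonneg _))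
    ext i : 3
    · refine hpoly _ fun x hx => ?_
      have := (hloc M hM u i x hx).1.1
      rwa [hu i (Finset.mem_univ i), mul_zero] at this
    · refine hpoly _ fun x hx => ?_
      have := (hloc M hM u i x hx).2.1
      rwa [hu i (Finset.mem_univ i), mul_zero] at this
  · intro u
    rw [H1D_self, neg_mul]
    refine neg_nonpos.2 (mul_nonneg ?_ (Finset.sum_nonneg fun i _ =>
      primalInt_nonneg (M.size_pos i).le i fun _ _ _ => mul_self_nonneg _))
    rw [tauMax1D]; positivity
  · intro u φ
    set e : Fin N → ℝ := fun i => C / M.h * localEnergy M u i + C / M.h * localEnergy M φ i with he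
    have hEu : ∀ i, 0 ≤ C / M.h * localEnergy M u i := fun i =>
      mul_nonneg (by positivity) (localEnergy_nonneg M u i)
    have hEφ : ∀ i, 0 ≤ C / M.h * localEnergy M φ i := fun i =>
      mul_nonneg (by positivity) (localEnergy_nonneg M φ i)
    have he0 : ∀ i, 0 ≤ e i := fun i => add_nonneg (hEu i) (hEφ i)
    have hsum : ∑ i, e i = C / M.h * ((cdg1D k β CCFL M).ip u u + (cdg1D k β CCFL M).ip φ φ) := by
      rw [hip, hip, he, Finset.sum_add_distrib, ← Finset.mul_sum, ← Finset.mul_sum, mul_add]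
    have hlu := hloc M hM u
    have hlφ := hloc M hM φ
    have h1 : |M.integral (fun i j ξ η => (u.fst i ξ - u.snd j η) * (φ.fst i ξ - φ.snd j η))| ≤
        2 * M.h * ∑ i, 2 * e i := by
      refine M.abs_integral_le (fun i => by linarith [he0 i]) fun i j ξ η hξ hη => ?_
      have := (hlu i ξ hξ).1.1
      have := (hlu j η hη).2.1
      have := (hlφ i ξ hξ).1.1
      have := (hlφ j η hη).2.1
      refine (abs_mul_le_add_of_sq_le (A := 2 * (C / M.h * localEnergy M u i)
        + 2 * (C / M.h * localEnergy M u j)) (B := 2 * (C / M.h * localEnergy M φ i)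
        + 2 * (C / M.h * localEnergy M φ j)) ?_ ?_).trans_eq (by simp only [he]; ring)
      · nlinarith [sq_nonneg (u.fst i ξ + u.snd j η)]
      · nlinarith [sq_nonneg (φ.fst i ξ + φ.snd j η)]
    have h2 : |M.integral (fun i j ξ η =>
        β * u.snd j η * φ.dfst i ξ + β * u.fst i ξ * φ.dsnd j η)| ≤
        2 * M.h * ∑ i, |β| / M.h * e i := by
      refine M.abs_integral_le (fun i => mul_nonneg (by positivity) (he0 i)) fun i j ξ η hξ hη => ?_
      have b1 := abs_mul_le_add_of_sq_le (hlu j η hη).2.1 (hlφ i ξ hξ).1.2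
      have b2 := abs_mul_le_add_of_sq_le (hlu i ξ hξ).1.1 (hlφ j η hη).2.2
      calc |β * u.snd j η * φ.dfst i ξ + β * u.fst i ξ * φ.dsnd j η|
          = |β / M.h * (u.snd j η * (M.h * φ.dfst i ξ) + u.fst i ξ * (M.h * φ.dsnd j η))| := by
            congr 1; field_simp
        _ = |β| / M.h * |u.snd j η * (M.h * φ.dfst i ξ) + u.fst i ξ * (M.h * φ.dsnd j η)| := by
            rw [abs_mul, abs_div, abs_of_pos hh]
        _ ≤ |β| / M.h * (e i + e j) := by
            gcongr
            refine (abs_add_le _ _).trans ?_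
            simp only [he]; linarith
        _ = _ := by ring
    have h3 : |∑ i : Fin N, (β * u.snd i 0 * φ.fst i (M.size i / 2)
          - β * u.snd (i - 1) 0 * φ.fst i (-(M.size i / 2))
          + β * u.fst (i + 1) 0 * φ.snd i (M.size (i + 1) / 2)
          - β * u.fst i 0 * φ.snd i (-(M.size i / 2)))| ≤ 6 * |β| * ∑ i, e i := by
      have hpt : ∀ i, |β * u.snd i 0 * φ.fst i (M.size i / 2)
          - β * u.snd (i - 1) 0 * φ.fst i (-(M.size i / 2))
          + β * u.fst (i + 1) 0 * φ.snd i (M.size (i + 1) / 2)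
          - β * u.fst i 0 * φ.snd i (-(M.size i / 2))| ≤
          |β| * (4 * e i + e (i - 1) + e (i + 1)) := by
        intro i
        have hz : |(0 : ℝ)| ≤ M.h / 2 := by rw [abs_zero]; linarith
        have hs : ∀ i, |M.size i / 2| ≤ M.h / 2 := fun i => by
          rw [abs_of_pos (by linarith [M.size_pos i])]; linarith [M.size_le_h i]
        have b1 := abs_mul_le_add_of_sq_le (hlu i 0 hz).2.1 (hlφ i _ (hs i)).1.1
        have b2 := abs_mul_le_add_of_sq_le (hlu (i - 1) 0 hz).2.1
          (hlφ i _ ((abs_neg _).trans_le (hs i))).1.1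
        have b3 := abs_mul_le_add_of_sq_le (hlu (i + 1) 0 hz).1.1 (hlφ i _ (hs (i + 1))).2.1
        have b4 := abs_mul_le_add_of_sq_le (hlu i 0 hz).1.1
          (hlφ i _ ((abs_neg _).trans_le (hs i))).2.1
        have hfac : β * u.snd i 0 * φ.fst i (M.size i / 2)
          - β * u.snd (i - 1) 0 * φ.fst i (-(M.size i / 2))
          + β * u.fst (i + 1) 0 * φ.snd i (M.size (i + 1) / 2)
          - β * u.fst i 0 * φ.snd i (-(M.size i / 2)) =
          β * (u.snd i 0 * φ.fst i (M.size i / 2)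
          - u.snd (i - 1) 0 * φ.fst i (-(M.size i / 2))
          + u.fst (i + 1) 0 * φ.snd i (M.size (i + 1) / 2)
          - u.fst i 0 * φ.snd i (-(M.size i / 2))) := by ring
        rw [hfac, abs_mul]
        refine mul_le_mul_of_nonneg_left ?_ (abs_nonneg _)
        refine (abs_sub _ _).trans ?_
        refine (add_le_add_left ((abs_add_le _ _).trans (add_le_add_left (abs_sub _ _) _)) _).trans ?_
        have := hEu i
        have := hEu (i - 1)
        have := hEu (i + 1)
        have := hEφ i
        have := hEφ (i - 1)
        have := hEφ (i + 1)
        simp only [he]; linarith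
      refine (Finset.abs_sum_le_sum_abs _ _).trans
        ((Finset.sum_le_sum fun i _ => hpt i).trans_eq ?_)
      rw [← Finset.mul_sum, Finset.sum_add_distrib, Finset.sum_add_distrib, ← Finset.mul_sum,
        sum_sub_one_shift e, sum_add_one_shift e]
      ring
    have hτ : |-(1 / tauMax1D β CCFL M.h)| = |β| / (CCFL * M.h) := by
      rw [abs_neg, tauMax1D, one_div_div, abs_of_nonneg (by positivity)]
    have hs0 : 0 ≤ (cdg1D k β CCFL M).ip u u + (cdg1D k β CCFL M).ip φ φ :=
      add_nonneg (hipnn u) (hipnn φ)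
    have hH : |H1D β CCFL M u φ| ≤ |β| / (CCFL * M.h) * (2 * M.h * ∑ i, 2 * e i)
        + 2 * M.h * (∑ i, |β| / M.h * e i) + 6 * |β| * ∑ i, e i := by
      refine (abs_sub _ _).trans (add_le_add ((abs_add_le _ _).trans (add_le_add ?_ h2)) h3)
      rw [abs_mul, hτ]
      gcongr
    refine hH.trans ?_
    rw [← Finset.mul_sum, ← Finset.mul_sum, hsum]
    set s := (cdg1D k β CCFL M).ip u u + (cdg1D k β CCFL M).ip φ φ
    calc |β| / (CCFL * M.h) * (2 * M.h * (2 * (C / M.h * s)))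
          + 2 * M.h * (|β| / M.h * (C / M.h * s)) + 6 * |β| * (C / M.h * s)
        = ((4 * |β| / CCFL + 8 * |β|) * C) / M.h * s := by field_simp; ring
      _ ≤ ((4 * |β| / CCFL + 8 * |β|) * C + 1) / M.h * s := by gcongr; linarith

end

/-! ### Restricting polynomials in two variables to lines -/

/-- The restriction of a polynomial to the line through `v` in direction `e`, as a polynomial in the
coordinate `e`. -/
def MvPolynomial.lineRestriction {ι : Type*} [DecidableEq ι] (e : ι) (v : ι → ℝ)
    (p : MvPolynomial ι ℝ) : ℝ[X] :=
  MvPolynomial.aeval (fun i => if i = e then Polynomial.X else Polynomial.C (v i)) p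

lemma MvPolynomial.eval_lineRestriction {ι : Type*} [DecidableEq ι] (e : ι) (v : ι → ℝ)
    (p : MvPolynomial ι ℝ) (t : ℝ) :
    (p.lineRestriction e v).eval t = MvPolynomial.eval (Function.update v e t) p := by
  induction p using MvPolynomial.induction_on with
  | C a => simp [lineRestriction]
  | add p q hp hq => simpa [lineRestriction] using congrArg₂ (· + ·) hp hq
  | mul_X p i hp =>
    simp only [lineRestriction, map_mul, MvPolynomial.aeval_X, Polynomial.eval_mul,
      MvPolynomial.eval_X] at hp ⊢
    rw [hp]
    by_cases h : i = e
    · subst h; simp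
    · simp [h]

lemma MvPolynomial.derivative_lineRestriction {ι : Type*} [DecidableEq ι] (e : ι) (v : ι → ℝ)
    (p : MvPolynomial ι ℝ) :
    (p.lineRestriction e v).derivative = (MvPolynomial.pderiv e p).lineRestriction e v := by
  induction p using MvPolynomial.induction_on with
  | C a => simp [lineRestriction]
  | add p q hp hq => simpa [lineRestriction] using congrArg₂ (· + ·) hp hq
  | mul_X p i hp =>
    simp only [lineRestriction, map_mul, MvPolynomial.aeval_X, Polynomial.derivative_mul,
      Derivation.leibniz, map_add, smul_eq_mul] at hp ⊢
    rw [hp]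
    by_cases h : i = e
    · subst h; simp; ring
    · simp [h]; ring

lemma MvPolynomial.lineRestriction_mem_degreeLT {ι : Type*} [DecidableEq ι] {k : ℕ} (e : ι)
    (v : ι → ℝ) {p : MvPolynomial ι ℝ} (hp : p ∈ MvPolynomial.restrictTotalDegree ι ℝ k) :
    p.lineRestriction e v ∈ Polynomial.degreeLT ℝ (k + 1) := by
  rw [MvPolynomial.mem_restrictTotalDegree] at hp
  have h := MvPolynomial.aeval_natDegree_le p hp
    (fun i => if i = e then Polynomial.X else Polynomial.C (v i)) (n := 1) (fun i => by
      split_ifs <;> simp)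
  rw [Polynomial.mem_degreeLT]
  refine lt_of_le_of_lt Polynomial.degree_le_natDegree ?_
  rw [lineRestriction]
  exact_mod_cast (by omega)

lemma update_pair_zero (a b t : ℝ) : Function.update ![a, b] 0 t = ![t, b] := by
  ext i; fin_cases i <;> simp

lemma update_pair_one (a b t : ℝ) : Function.update ![a, b] 1 t = ![a, t] := by
  ext i; fin_cases i <;> simp

lemma MvPolynomial.hasDerivAt_eval_fst (p : MvPolynomial (Fin 2) ℝ) (x y : ℝ) :
    HasDerivAt (fun s => MvPolynomial.eval ![s, y] p)
      (MvPolynomial.eval ![x, y] (MvPolynomial.pderiv 0 p)) x := by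
  have h := (p.lineRestriction 0 ![x, y]).hasDerivAt x
  rw [MvPolynomial.derivative_lineRestriction] at h
  simpa [MvPolynomial.eval_lineRestriction, update_pair_zero] using h

lemma MvPolynomial.hasDerivAt_eval_snd (p : MvPolynomial (Fin 2) ℝ) (x y : ℝ) :
    HasDerivAt (fun t => MvPolynomial.eval ![x, t] p)
      (MvPolynomial.eval ![x, y] (MvPolynomial.pderiv 1 p)) y := by
  have h := (p.lineRestriction 1 ![x, y]).hasDerivAt y
  rw [MvPolynomial.derivative_lineRestriction] at h
  simpa [MvPolynomial.eval_lineRestriction, update_pair_one] using h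

lemma MvPolynomial.continuous_eval_pair {X : Type*} [TopologicalSpace X]
    (p : MvPolynomial (Fin 2) ℝ) {f g : X → ℝ} (hf : Continuous f) (hg : Continuous g) :
    Continuous fun x => MvPolynomial.eval ![f x, g x] p := by
  refine (MvPolynomial.continuous_eval p).comp (continuous_pi fun i => ?_)
  fin_cases i <;> simpa

/-- The inverse estimate for polynomials in two variables, by applying the one-dimensional one in
each coordinate. -/
lemma exists_inverse_estimate_2D (k : ℕ) :
    ∃ C > 0, ∀ p ∈ MvPolynomial.restrictTotalDegree (Fin 2) ℝ k, ∀ H₁ H₂ a₁ b₁ a₂ b₂ : ℝ,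
      0 < H₁ → 0 < H₂ → (a₁ = 0 ∧ b₁ = H₁ ∨ a₁ = -H₁ ∧ b₁ = 0) →
      (a₂ = 0 ∧ b₂ = H₂ ∨ a₂ = -H₂ ∧ b₂ = 0) → ∀ x y, |x| ≤ H₁ → |y| ≤ H₂ →
        MvPolynomial.eval ![x, y] p ^ 2 ≤ C / (H₁ * H₂) *
          (∫ s in a₁..b₁, ∫ t in a₂..b₂, MvPolynomial.eval ![s, t] p ^ 2) ∧
        (H₁ * MvPolynomial.eval ![x, y] (MvPolynomial.pderiv 0 p)) ^ 2 ≤ C / (H₁ * H₂) *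
          (∫ s in a₁..b₁, ∫ t in a₂..b₂, MvPolynomial.eval ![s, t] p ^ 2) ∧
        (H₂ * MvPolynomial.eval ![x, y] (MvPolynomial.pderiv 1 p)) ^ 2 ≤ C / (H₁ * H₂) *
          (∫ s in a₁..b₁, ∫ t in a₂..b₂, MvPolynomial.eval ![s, t] p ^ 2) := by
  obtain ⟨C, hC, h⟩ := exists_inverse_estimate k one_pos
  refine ⟨C * C, by positivity, fun p hp H₁ H₂ a₁ b₁ a₂ b₂ hH₁ hH₂ hI₁ hI₂ x y hx hy => ?_⟩
  have h' : ∀ q ∈ Polynomial.degreeLT ℝ (k + 1), ∀ H a b : ℝ, 0 < H →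
      (a = 0 ∧ b = H ∨ a = -H ∧ b = 0) → ∀ t, |t| ≤ H →
      q.eval t ^ 2 ≤ C / H * (∫ s in a..b, q.eval s ^ 2) ∧
      (H * q.derivative.eval t) ^ 2 ≤ C / H * ∫ s in a..b, q.eval s ^ 2 := by
    rintro q hq H a b hH (⟨rfl, rfl⟩ | ⟨rfl, rfl⟩) t ht
    · exact (h q hq _ _ hH (by rw [one_mul]) t ht).1
    · exact (h q hq _ _ hH (by rw [one_mul]) t ht).2
  have hfst : ∀ y x, |x| ≤ H₁ → MvPolynomial.eval ![x, y] p ^ 2 ≤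
        C / H₁ * (∫ s in a₁..b₁, MvPolynomial.eval ![s, y] p ^ 2) ∧
      (H₁ * MvPolynomial.eval ![x, y] (MvPolynomial.pderiv 0 p)) ^ 2 ≤
        C / H₁ * ∫ s in a₁..b₁, MvPolynomial.eval ![s, y] p ^ 2 := by
    intro y x hx
    have := h' _ (MvPolynomial.lineRestriction_mem_degreeLT 0 ![0, y] hp) H₁ a₁ b₁ hH₁ hI₁ x hx
    simpa [MvPolynomial.derivative_lineRestriction, MvPolynomial.eval_lineRestriction,
      update_pair_zero] using this
  have hsnd : ∀ x y, |y| ≤ H₂ → MvPolynomial.eval ![x, y] p ^ 2 ≤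
        C / H₂ * (∫ t in a₂..b₂, MvPolynomial.eval ![x, t] p ^ 2) ∧
      (H₂ * MvPolynomial.eval ![x, y] (MvPolynomial.pderiv 1 p)) ^ 2 ≤
        C / H₂ * ∫ t in a₂..b₂, MvPolynomial.eval ![x, t] p ^ 2 := by
    intro x y hy
    have := h' _ (MvPolynomial.lineRestriction_mem_degreeLT 1 ![x, 0] hp) H₂ a₂ b₂ hH₂ hI₂ y hy
    simpa [MvPolynomial.derivative_lineRestriction, MvPolynomial.eval_lineRestriction,
      update_pair_one] using this
  have hab₁ : a₁ ≤ b₁ := by rcases hI₁ with ⟨rfl, rfl⟩ | ⟨rfl, rfl⟩ <;> linarith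
  have hab₂ : a₂ ≤ b₂ := by rcases hI₂ with ⟨rfl, rfl⟩ | ⟨rfl, rfl⟩ <;> linarith
  have hcont : Continuous (Function.uncurry fun s t => MvPolynomial.eval ![s, t] p ^ 2) :=
    (MvPolynomial.continuous_eval_pair p continuous_fst continuous_snd).pow 2
  have hcont' : Continuous (Function.uncurry fun t s => MvPolynomial.eval ![s, t] p ^ 2) :=
    (MvPolynomial.continuous_eval_pair p continuous_snd continuous_fst).pow 2
  have hpar := intervalIntegral.continuous_parametric_intervalIntegral_of_continuous'
    (μ := MeasureTheory.volume) hcont a₂ b₂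
  have hpar' := intervalIntegral.continuous_parametric_intervalIntegral_of_continuous'
    (μ := MeasureTheory.volume) hcont' a₁ b₁
  have hx' : ∫ s in a₁..b₁, MvPolynomial.eval ![s, y] p ^ 2 ≤
      C / H₂ * ∫ s in a₁..b₁, ∫ t in a₂..b₂, MvPolynomial.eval ![s, t] p ^ 2 := by
    rw [← intervalIntegral.integral_const_mul]
    refine intervalIntegral.integral_mono_on hab₁ ?_ ?_ fun s _ => (hsnd s y hy).1
    · exact ((MvPolynomial.continuous_eval_pair p continuous_id continuous_const).pow
        2).intervalIntegrable _ _
    · exact (hpar.const_mul _).intervalIntegrable _ _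
  have hy' : ∫ t in a₂..b₂, MvPolynomial.eval ![x, t] p ^ 2 ≤
      C / H₁ * ∫ s in a₁..b₁, ∫ t in a₂..b₂, MvPolynomial.eval ![s, t] p ^ 2 := by
    rw [intervalIntegral_swap_of_continuous hcont, ← intervalIntegral.integral_const_mul]
    refine intervalIntegral.integral_mono_on hab₂ ?_ ?_ fun t _ => (hfst t x hx).1
    · exact ((MvPolynomial.continuous_eval_pair p continuous_const continuous_id).pow
        2).intervalIntegrable _ _
    · exact (hpar'.const_mul _).intervalIntegrable _ _
  set I := ∫ s in a₁..b₁, ∫ t in a₂..b₂, MvPolynomial.eval ![s, t] p ^ 2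
  have e1 : C / H₁ * (C / H₂ * I) = C * C / (H₁ * H₂) * I := by field_simp
  have e2 : C / H₂ * (C / H₁ * I) = C * C / (H₁ * H₂) * I := by field_simp
  rw [← e1]
  refine ⟨(hfst y x hx).1.trans (by gcongr), (hfst y x hx).2.trans (by gcongr), ?_⟩
  rw [e1, ← e2]
  exact (hsnd x y hy).2.trans (by gcongr)

/-! ### Integrals over products of overlapping cells -/

section

variable {N N' : ℕ} [NeZero N] [NeZero N']

/-- Edge integrals over primal cells, with integrands bounded through the primal cell `(i, j)` and
the dual cells `(i', j)` and `(i', j - 1)` that it meets. -/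
lemma sum_abs_primalInt_le {h B : ℝ} (hh : 0 ≤ h) {e : Fin N → Fin N' → ℝ}
    {F : Fin N → Fin N' → Fin N → ℝ → ℝ → ℝ}
    (hF : ∀ i j i' ξ η, |ξ| ≤ h / 2 → |η| ≤ h / 2 →
      |F i j i' ξ η| ≤ B * (2 * e i j + e i' j + e i' (j - 1))) :
    ∑ i, ∑ j, |primalInt h i (F i j)| ≤ 4 * h * B * ∑ i, ∑ j, e i j := by
  refine (Finset.sum_le_sum fun i _ => Finset.sum_le_sum fun j _ =>
    abs_primalInt_le hh i (hF i j)).trans_eq ?_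
  have h1 : ∀ i, ∑ j, e i (j - 1) = ∑ j, e i j := fun i => sum_sub_one_shift (e i)
  have h2 : ∑ i, ∑ j, e (i - 1) j = ∑ i, ∑ j, e i j := sum_sub_one_shift fun i => ∑ j, e i j
  simp only [← Finset.mul_sum, Finset.sum_add_distrib, h1, h2]
  ring

lemma sum_abs_dualInt_le {h B : ℝ} (hh : 0 ≤ h) {e : Fin N → Fin N' → ℝ}
    {F : Fin N → Fin N' → Fin N → ℝ → ℝ → ℝ}
    (hF : ∀ i j i' ξ η, |ξ| ≤ h / 2 → |η| ≤ h / 2 →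
      |F i j i' ξ η| ≤ B * (2 * e i j + e i' j + e i' (j + 1))) :
    ∑ i, ∑ j, |dualInt h i (F i j)| ≤ 4 * h * B * ∑ i, ∑ j, e i j := by
  refine (Finset.sum_le_sum fun i _ => Finset.sum_le_sum fun j _ =>
    abs_dualInt_le hh i (hF i j)).trans_eq ?_
  have h1 : ∀ i, ∑ j, e i (j + 1) = ∑ j, e i j := fun i => sum_add_one_shift (e i)
  have h2 : ∑ i, ∑ j, e (i + 1) j = ∑ i, ∑ j, e i j := sum_add_one_shift fun i => ∑ j, e i j
  simp only [← Finset.mul_sum, Finset.sum_add_distrib, h1, h2]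
  ring

/-- Integrating a derivative in the inner direction over all products of cells leaves integrals over
the edges in the outer direction, those of the dual cells being regrouped into dual integrals. -/
lemma sum_primalInt_primalInt_deriv (h h' : ℝ)
    {G G' : Fin N → Fin N → ℝ → ℝ → Fin N' → Fin N' → ℝ → ℝ → ℝ}
    (hG : ∀ i i' x y j j' s ξ, HasDerivAt (fun ξ => G i i' x y j j' ξ (ξ + s))
      (G' i i' x y j j' ξ (ξ + s)) ξ)
    (hc : ∀ i i' j j', Continuous fun p : (ℝ × ℝ) × ℝ × ℝ => G i i' p.1.1 p.1.2 j j' p.2.1 p.2.2)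
    (hc' : ∀ i i' j j', Continuous fun p : (ℝ × ℝ) × ℝ × ℝ =>
      G' i i' p.1.1 p.1.2 j j' p.2.1 p.2.2) :
    ∑ i, ∑ j, primalInt h i (fun i' x y => primalInt h' j fun j' ξ η => G' i i' x y j j' ξ η) =
      ∑ i, ∑ j, (primalInt h i (fun i' x y =>
          G i i' x y j j (h' / 2) 0 - G i i' x y j (j - 1) (-(h' / 2)) 0)
        + dualInt h i (fun i' x y =>
          G i' i x y (j + 1) j 0 (h' / 2) - G i' i x y j j 0 (-(h' / 2)))) := by
  have hcG : ∀ i i' j j' ξ η, Continuous fun p : ℝ × ℝ => G i i' p.1 p.2 j j' ξ η :=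
    fun i i' j j' ξ η => (hc i i' j j').comp
      (by fun_prop : Continuous fun p : ℝ × ℝ => (p, ξ, η))
  have hinner : ∀ i i' j, Continuous fun p : ℝ × ℝ =>
      primalInt h' j fun j' ξ η => G' i i' p.1 p.2 j j' ξ η := fun i i' j =>
    continuous_primalInt h' j fun j' => hc' i i' j j'
  have h1 : ∀ i, ∑ j, primalInt h i (fun i' x y =>
      primalInt h' j fun j' ξ η => G' i i' x y j j' ξ η) =
      ∑ j, (primalInt h i (fun i' x y =>
          G i i' x y j j (h' / 2) 0 - G i i' x y j (j - 1) (-(h' / 2)) 0)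
        + primalInt h i (fun i' x y =>
          G i i' x y (j + 1) j 0 (h' / 2) - G i i' x y j j 0 (-(h' / 2)))) := by
    intro i
    rw [← primalInt_sum Finset.univ h i (fun j i' => hinner i i' j)]
    have h2 : ∀ i' x y, ∑ j, primalInt h' j (fun j' ξ η => G' i i' x y j j' ξ η) =
        ∑ j, ((G i i' x y j j (h' / 2) 0 - G i i' x y j (j - 1) (-(h' / 2)) 0)
          + 1 * (G i i' x y (j + 1) j 0 (h' / 2) - G i i' x y j j 0 (-(h' / 2)))) := by
      intro i' x y
      refine (sum_primalInt_deriv (h := fun _ => h') (G := fun j j' ξ η => G i i' x y j j' ξ η)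
        (hG i i' x y) fun j j' => ?_).trans (Finset.sum_congr rfl fun j _ => by ring)
      exact (hc' i i' j j').comp (by fun_prop : Continuous fun p : ℝ × ℝ => ((x, y), p))
    simp only [h2]
    rw [primalInt_sum Finset.univ h i
      (fun j i' => ((hcG _ _ _ _ _ _).sub (hcG _ _ _ _ _ _)).add
        (((hcG _ _ _ _ _ _).sub (hcG _ _ _ _ _ _)).const_mul 1))]
    refine Finset.sum_congr rfl fun j _ => ?_
    rw [primalInt_add_mul h i 1 (fun i' => (hcG _ _ _ _ _ _).sub (hcG _ _ _ _ _ _))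
      (fun i' => (hcG _ _ _ _ _ _).sub (hcG _ _ _ _ _ _)), one_mul]
  simp only [h1, Finset.sum_add_distrib]
  congr 1
  rw [Finset.sum_comm, Finset.sum_comm (f := fun i j => dualInt h i _)]
  refine Finset.sum_congr rfl fun j _ => ?_
  exact (sum_dualInt h fun i i' x y =>
    G i' i x y (j + 1) j 0 (h' / 2) - G i' i x y j j 0 (-(h' / 2))).symm

end

namespace Mesh2D

variable {Nx Ny : ℕ} (M : Mesh2D Nx Ny)

lemma hx_pos [NeZero Nx] : 0 < M.hx :=
  div_pos (sub_pos.2 M.x_lt) (Nat.cast_pos.2 (NeZero.pos Nx))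

lemma hy_pos [NeZero Ny] : 0 < M.hy :=
  div_pos (sub_pos.2 M.y_lt) (Nat.cast_pos.2 (NeZero.pos Ny))

lemma h_pos [NeZero Nx] : 0 < M.h := M.hx_pos.trans_le (le_max_left _ _)

variable [NeZero Nx] [NeZero Ny]

lemma integral_add_mul {F G : Fin Nx × Fin Ny → Fin Nx × Fin Ny → ℝ → ℝ → ℝ → ℝ → ℝ} (c : ℝ)
    (hF : ∀ i j, Continuous fun p : (ℝ × ℝ) × ℝ × ℝ => F i j p.1.1 p.2.1 p.1.2 p.2.2)
    (hG : ∀ i j, Continuous fun p : (ℝ × ℝ) × ℝ × ℝ => G i j p.1.1 p.2.1 p.1.2 p.2.2) :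
    M.integral (fun i j ξ₁ ξ₂ η₁ η₂ => F i j ξ₁ ξ₂ η₁ η₂ + c * G i j ξ₁ ξ₂ η₁ η₂) =
      M.integral F + c * M.integral G := by
  have hpair : ∀ q : ℝ × ℝ, Continuous fun p : ℝ × ℝ => (q, p) := fun q => by fun_prop
  have h1 : ∀ (i : Fin Nx) (j : Fin Ny) (i' : Fin Nx) (ξ₁ η₁ : ℝ),
      primalInt M.hy j (fun j' ξ₂ η₂ => F (i, j) (i', j') ξ₁ ξ₂ η₁ η₂
        + c * G (i, j) (i', j') ξ₁ ξ₂ η₁ η₂) =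
      primalInt M.hy j (fun j' ξ₂ η₂ => F (i, j) (i', j') ξ₁ ξ₂ η₁ η₂) +
        c * primalInt M.hy j (fun j' ξ₂ η₂ => G (i, j) (i', j') ξ₁ ξ₂ η₁ η₂) :=
    fun i j i' ξ₁ η₁ => primalInt_add_mul M.hy j c
      (fun j' => (hF (i, j) (i', j')).comp (hpair (ξ₁, η₁)))
      (fun j' => (hG (i, j) (i', j')).comp (hpair (ξ₁, η₁)))
  have h2 : ∀ (i : Fin Nx) (j : Fin Ny) (i' : Fin Nx), Continuous fun p : ℝ × ℝ =>
      primalInt M.hy j (fun j' ξ₂ η₂ => F (i, j) (i', j') p.1 ξ₂ p.2 η₂) := fun i j i' =>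
    continuous_primalInt M.hy j fun j' => hF (i, j) (i', j')
  have h3 : ∀ (i : Fin Nx) (j : Fin Ny) (i' : Fin Nx), Continuous fun p : ℝ × ℝ =>
      primalInt M.hy j (fun j' ξ₂ η₂ => G (i, j) (i', j') p.1 ξ₂ p.2 η₂) := fun i j i' =>
    continuous_primalInt M.hy j fun j' => hG (i, j) (i', j')
  simp only [integral, h1, Finset.mul_sum, ← Finset.sum_add_distrib]
  exact Finset.sum_congr rfl fun i _ => Finset.sum_congr rfl fun j _ =>
    primalInt_add_mul M.hx i c (h2 i j) (h3 i j)

lemma abs_integral_le {F : Fin Nx × Fin Ny → Fin Nx × Fin Ny → ℝ → ℝ → ℝ → ℝ → ℝ}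
    {e : Fin Nx → Fin Ny → ℝ}
    (hF : ∀ i j i' j' ξ₁ ξ₂ η₁ η₂, |ξ₁| ≤ M.hx / 2 → |ξ₂| ≤ M.hy / 2 → |η₁| ≤ M.hx / 2 →
      |η₂| ≤ M.hy / 2 → |F (i, j) (i', j') ξ₁ ξ₂ η₁ η₂| ≤ e i j + e i' j') :
    |M.integral F| ≤ 2 * (M.hx * M.hy) * ∑ i, ∑ j, e i j := by
  have h1 : |M.integral F| ≤ ∑ i, ∑ j, |primalInt M.hx i fun i' ξ₁ η₁ =>
      primalInt M.hy j fun j' ξ₂ η₂ => F (i, j) (i', j') ξ₁ ξ₂ η₁ η₂| :=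
    (Finset.abs_sum_le_sum_abs _ _).trans
      (Finset.sum_le_sum fun i _ => Finset.abs_sum_le_sum_abs _ _)
  refine h1.trans ?_
  have h2 : ∀ (i : Fin Nx) (j : Fin Ny) (i' : Fin Nx) (ξ₁ η₁ : ℝ), |ξ₁| ≤ M.hx / 2 →
      |η₁| ≤ M.hx / 2 →
      |primalInt M.hy j fun j' ξ₂ η₂ => F (i, j) (i', j') ξ₁ ξ₂ η₁ η₂| ≤
        M.hy / 2 * (2 * e i j + e i' j + e i' (j - 1)) := by
    intro i j i' ξ₁ η₁ h3 h4
    refine (abs_primalInt_le (b := fun j' => e i j + e i' j') M.hy_pos.le j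
      fun j' ξ₂ η₂ h5 h6 => hF i j i' j' ξ₁ ξ₂ η₁ η₂ h3 h5 h4 h6).trans_eq ?_
    ring
  refine (sum_abs_primalInt_le (e := e) M.hx_pos.le h2).trans_eq ?_
  ring

end Mesh2D

/-! ### The two-dimensional method -/

namespace Space2D

variable {k Nx Ny : ℕ}

@[fun_prop]
lemma continuous_fst {X : Type*} [TopologicalSpace X] (u : Space2D k Nx Ny) (c : Fin Nx × Fin Ny)
    {f g : X → ℝ} (hf : Continuous f) (hg : Continuous g) :
    Continuous fun x => u.fst c (f x) (g x) :=
  MvPolynomial.continuous_eval_pair _ hf hg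

@[fun_prop]
lemma continuous_snd {X : Type*} [TopologicalSpace X] (u : Space2D k Nx Ny) (c : Fin Nx × Fin Ny)
    {f g : X → ℝ} (hf : Continuous f) (hg : Continuous g) :
    Continuous fun x => u.snd c (f x) (g x) :=
  MvPolynomial.continuous_eval_pair _ hf hg

@[fun_prop]
lemma continuous_dfst {X : Type*} [TopologicalSpace X] (u : Space2D k Nx Ny) (e : Fin 2)
    (c : Fin Nx × Fin Ny) {f g : X → ℝ} (hf : Continuous f) (hg : Continuous g) :
    Continuous fun x => u.dfst e c (f x) (g x) :=
  MvPolynomial.continuous_eval_pair _ hf hg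

@[fun_prop]
lemma continuous_dsnd {X : Type*} [TopologicalSpace X] (u : Space2D k Nx Ny) (e : Fin 2)
    (c : Fin Nx × Fin Ny) {f g : X → ℝ} (hf : Continuous f) (hg : Continuous g) :
    Continuous fun x => u.dsnd e c (f x) (g x) :=
  MvPolynomial.continuous_eval_pair _ hf hg

lemma fst_add_smul (u v : Space2D k Nx Ny) (a : ℝ) (c : Fin Nx × Fin Ny) (x y : ℝ) :
    (u + a • v).fst c x y = u.fst c x y + a * v.fst c x y := by simp [fst]

lemma snd_add_smul (u v : Space2D k Nx Ny) (a : ℝ) (c : Fin Nx × Fin Ny) (x y : ℝ) :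
    (u + a • v).snd c x y = u.snd c x y + a * v.snd c x y := by simp [snd]

lemma dfst_add_smul (u v : Space2D k Nx Ny) (a : ℝ) (e : Fin 2) (c : Fin Nx × Fin Ny) (x y : ℝ) :
    (u + a • v).dfst e c x y = u.dfst e c x y + a * v.dfst e c x y := by simp [dfst]

lemma dsnd_add_smul (u v : Space2D k Nx Ny) (a : ℝ) (e : Fin 2) (c : Fin Nx × Fin Ny) (x y : ℝ) :
    (u + a • v).dsnd e c x y = u.dsnd e c x y + a * v.dsnd e c x y := by simp [dsnd]

instance : FiniteDimensional ℝ (Space2D k Nx Ny) :=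
  inferInstanceAs (Module.Finite ℝ (_ × _))

variable [NeZero Nx] [NeZero Ny]

/-- The squared `L²` norm of both components over the primal cell `(i, j)`. -/
def localEnergy (M : Mesh2D Nx Ny) (u : Space2D k Nx Ny) (i : Fin Nx) (j : Fin Ny) : ℝ :=
  primalInt M.hx i fun i' ξ₁ η₁ => primalInt M.hy j fun j' ξ₂ η₂ =>
    u.fst (i, j) ξ₁ ξ₂ * u.fst (i, j) ξ₁ ξ₂ + u.snd (i', j') η₁ η₂ * u.snd (i', j') η₁ η₂

lemma localEnergy_nonneg (M : Mesh2D Nx Ny) (u : Space2D k Nx Ny) (i : Fin Nx) (j : Fin Ny) :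
    0 ≤ localEnergy M u i j :=
  primalInt_nonneg M.hx_pos.le i fun _ _ _ => primalInt_nonneg M.hy_pos.le j fun _ _ _ =>
    add_nonneg (mul_self_nonneg _) (mul_self_nonneg _)

/-- The edge terms of the form `ℋ` that belong to the primal and to the dual cell `(i, j)`. -/
def edgeTerms (β₁ β₂ : ℝ) (M : Mesh2D Nx Ny) (u φ : Space2D k Nx Ny) (i : Fin Nx) (j : Fin Ny) :
    ℝ :=
  primalInt M.hx i (fun i' ξ η =>
      β₂ * u.snd (i', j) η 0 * φ.fst (i, j) ξ (M.hy / 2)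
      - β₂ * u.snd (i', j - 1) η 0 * φ.fst (i, j) ξ (-(M.hy / 2)))
  + primalInt M.hy j (fun j' ξ η =>
      β₁ * u.snd (i, j') 0 η * φ.fst (i, j) (M.hx / 2) ξ
      - β₁ * u.snd (i - 1, j') 0 η * φ.fst (i, j) (-(M.hx / 2)) ξ)
  + dualInt M.hx i (fun i' ξ η =>
      β₂ * u.fst (i', j + 1) ξ 0 * φ.snd (i, j) η (M.hy / 2)
      - β₂ * u.fst (i', j) ξ 0 * φ.snd (i, j) η (-(M.hy / 2)))
  + dualInt M.hy j (fun j' ξ η =>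
      β₁ * u.fst (i + 1, j') 0 ξ * φ.snd (i, j) (M.hx / 2) η
      - β₁ * u.fst (i, j') 0 ξ * φ.snd (i, j) (-(M.hx / 2)) η)

lemma edgeTerms_add_smul_left (β₁ β₂ : ℝ) (M : Mesh2D Nx Ny) (u v φ : Space2D k Nx Ny) (a : ℝ)
    (i : Fin Nx) (j : Fin Ny) : edgeTerms β₁ β₂ M (u + a • v) φ i j =
      edgeTerms β₁ β₂ M u φ i j + a * edgeTerms β₁ β₂ M v φ i j := by
  have hreg : ∀ p q r s p' q' r' s' : ℝ, p + q + r + s + a * (p' + q' + r' + s') =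
      (p + a * p') + (q + a * q') + (r + a * r') + (s + a * s') := by intros; ring
  simp only [edgeTerms]
  rw [hreg, ← primalInt_add_mul M.hx i a ?_ ?_, ← primalInt_add_mul M.hy j a ?_ ?_,
    ← dualInt_add_mul M.hx i a ?_ ?_, ← dualInt_add_mul M.hy j a ?_ ?_]
  · simp only [fst_add_smul, snd_add_smul]
    refine congrArg₂ (· + ·) (congrArg₂ (· + ·) (congrArg₂ (· + ·) ?_ ?_) ?_) ?_ <;>
    · congr 1; ext _ _ _; ring
  all_goals intro _; fun_prop

lemma edgeTerms_add_smul_right (β₁ β₂ : ℝ) (M : Mesh2D Nx Ny) (u v φ : Space2D k Nx Ny) (a : ℝ)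
    (i : Fin Nx) (j : Fin Ny) : edgeTerms β₁ β₂ M φ (u + a • v) i j =
      edgeTerms β₁ β₂ M φ u i j + a * edgeTerms β₁ β₂ M φ v i j := by
  have hreg : ∀ p q r s p' q' r' s' : ℝ, p + q + r + s + a * (p' + q' + r' + s') =
      (p + a * p') + (q + a * q') + (r + a * r') + (s + a * s') := by intros; ring
  simp only [edgeTerms]
  rw [hreg, ← primalInt_add_mul M.hx i a ?_ ?_, ← primalInt_add_mul M.hy j a ?_ ?_,
    ← dualInt_add_mul M.hx i a ?_ ?_, ← dualInt_add_mul M.hy j a ?_ ?_]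
  · simp only [fst_add_smul, snd_add_smul]
    refine congrArg₂ (· + ·) (congrArg₂ (· + ·) (congrArg₂ (· + ·) ?_ ?_) ?_) ?_ <;>
    · congr 1; ext _ _ _; ring
  all_goals intro _; fun_prop

end Space2D

section

open Space2D

/-- Pointwise values and scaled partial derivatives of both components are controlled by the local
energy; for the dual cell, its lower left quarter suffices. -/
lemma exists_local_bound_2D (k : ℕ) :
    ∃ C > 0, ∀ {Nx Ny : ℕ} [NeZero Nx] [NeZero Ny] (M : Mesh2D Nx Ny) (u : Space2D k Nx Ny)
      (i : Fin Nx) (j : Fin Ny) (x y : ℝ), |x| ≤ M.hx / 2 → |y| ≤ M.hy / 2 →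
        (u.fst (i, j) x y ^ 2 ≤ C / (M.hx * M.hy) * localEnergy M u i j ∧
          (M.hx * u.dfst 0 (i, j) x y) ^ 2 ≤ C / (M.hx * M.hy) * localEnergy M u i j ∧
          (M.hy * u.dfst 1 (i, j) x y) ^ 2 ≤ C / (M.hx * M.hy) * localEnergy M u i j) ∧
        (u.snd (i, j) x y ^ 2 ≤ C / (M.hx * M.hy) * localEnergy M u i j ∧
          (M.hx * u.dsnd 0 (i, j) x y) ^ 2 ≤ C / (M.hx * M.hy) * localEnergy M u i j ∧
          (M.hy * u.dsnd 1 (i, j) x y) ^ 2 ≤ C / (M.hx * M.hy) * localEnergy M u i j) := by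
  obtain ⟨C, hC, hinv⟩ := exists_inverse_estimate_2D k
  refine ⟨16 * C, by positivity, fun {Nx Ny} _ _ M u i j x y hx hy => ?_⟩
  have hhx := M.hx_pos
  have hhy := M.hy_pos
  have hE := localEnergy_nonneg M u i j
  have h1 := hinv _ (u.1 (i, j)).2 (M.hx / 2) (M.hy / 2) _ _ _ _ (by positivity) (by positivity)
    (Or.inl ⟨rfl, rfl⟩) (Or.inl ⟨rfl, rfl⟩) x y hx hy
  have h2 := hinv _ (u.2 (i, j)).2 (M.hx / 2) (M.hy / 2) _ _ _ _ (by positivity) (by positivity)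
    (Or.inr ⟨rfl, rfl⟩) (Or.inr ⟨rfl, rfl⟩) x y hx hy
  have hc : ∀ i' j', Continuous fun p : (ℝ × ℝ) × ℝ × ℝ =>
      u.fst (i, j) p.1.1 p.2.1 * u.fst (i, j) p.1.1 p.2.1 +
        u.snd (i', j') p.1.2 p.2.2 * u.snd (i', j') p.1.2 p.2.2 := fun i' j' => by fun_prop
  have hnn : ∀ i' j' ξ₁ ξ₂ η₁ η₂, 0 ≤ u.fst (i, j) ξ₁ ξ₂ * u.fst (i, j) ξ₁ ξ₂ +
      u.snd (i', j') η₁ η₂ * u.snd (i', j') η₁ η₂ := fun i' j' ξ₁ ξ₂ η₁ η₂ =>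
    add_nonneg (mul_self_nonneg _) (mul_self_nonneg _)
  have hci : ∀ i' ξ₁ η₁ j', Continuous fun p : ℝ × ℝ =>
      u.fst (i, j) ξ₁ p.1 * u.fst (i, j) ξ₁ p.1 +
        u.snd (i', j') η₁ p.2 * u.snd (i', j') η₁ p.2 := fun i' ξ₁ η₁ j' => by fun_prop
  have hco : ∀ i', Continuous fun p : ℝ × ℝ => primalInt M.hy j fun j' ξ₂ η₂ =>
      u.fst (i, j) p.1 ξ₂ * u.fst (i, j) p.1 ξ₂ +
        u.snd (i', j') p.2 η₂ * u.snd (i', j') p.2 η₂ := fun i' =>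
    continuous_primalInt M.hy j fun j' => hc i' j'
  have hnno : ∀ i' ξ₁ η₁, 0 ≤ primalInt M.hy j fun j' ξ₂ η₂ =>
      u.fst (i, j) ξ₁ ξ₂ * u.fst (i, j) ξ₁ ξ₂ +
        u.snd (i', j') η₁ η₂ * u.snd (i', j') η₁ η₂ := fun i' ξ₁ η₁ =>
    primalInt_nonneg hhy.le j fun j' ξ₂ η₂ => hnn i' j' ξ₁ ξ₂ η₁ η₂
  have h3 : ∫ s in (0 : ℝ)..(M.hx / 2), ∫ t in (0 : ℝ)..(M.hy / 2), u.fst (i, j) s t ^ 2 ≤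
      localEnergy M u i j := by
    refine integral_right_le_primalInt hhx.le i hco hnno ?_ fun ξ₁ η₁ _ _ => ?_
    · exact intervalIntegral.continuous_parametric_intervalIntegral_of_continuous'
        (by fun_prop : Continuous fun p : ℝ × ℝ => u.fst (i, j) p.1 p.2 ^ 2) _ _
    · exact integral_right_le_primalInt hhy.le j (hci i ξ₁ η₁) (fun _ _ _ => hnn _ _ _ _ _ _)
        (by fun_prop) fun ξ₂ η₂ _ _ => by nlinarith [mul_self_nonneg (u.snd (i, j) η₁ η₂)]
  have h4 : ∫ s in (-(M.hx / 2))..0, ∫ t in (-(M.hy / 2))..0, u.snd (i, j) s t ^ 2 ≤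
      localEnergy M u i j := by
    refine integral_left_dual_le_primalInt hhx.le i hco hnno ?_ fun ξ₁ η₁ _ _ => ?_
    · exact intervalIntegral.continuous_parametric_intervalIntegral_of_continuous'
        (by fun_prop : Continuous fun p : ℝ × ℝ => u.snd (i, j) p.1 p.2 ^ 2) _ _
    · exact integral_left_dual_le_primalInt hhy.le j (hci i ξ₁ η₁)
        (fun _ _ _ => hnn _ _ _ _ _ _) (by fun_prop) fun ξ₂ η₂ _ _ => by
          nlinarith [mul_self_nonneg (u.fst (i, j) ξ₁ ξ₂)]
  have e1 : ∀ {x y I : ℝ}, x ≤ C / (M.hx / 2 * (M.hy / 2)) * I → I ≤ localEnergy M u i j →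
      y ≤ 4 * x → y ≤ 16 * C / (M.hx * M.hy) * localEnergy M u i j := by
    intro x y I hx hI hy
    have : C / (M.hx / 2 * (M.hy / 2)) * I ≤
        C / (M.hx / 2 * (M.hy / 2)) * localEnergy M u i j := by gcongr
    have h5 : C / (M.hx / 2 * (M.hy / 2)) * localEnergy M u i j * 4 =
        16 * C / (M.hx * M.hy) * localEnergy M u i j := by
      field_simp; ring
    linarith
  refine ⟨⟨e1 h1.1 h3 ?_, e1 h1.2.1 h3 ?_, e1 h1.2.2 h3 ?_⟩,
    ⟨e1 h2.1 h4 ?_, e1 h2.2.1 h4 ?_, e1 h2.2.2 h4 ?_⟩⟩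
  · change _ ≤ 4 * u.fst (i, j) x y ^ 2
    nlinarith [sq_nonneg (u.fst (i, j) x y)]
  · change (M.hx * u.dfst 0 (i, j) x y) ^ 2 ≤ 4 * (M.hx / 2 * u.dfst 0 (i, j) x y) ^ 2
    linarith
  · change (M.hy * u.dfst 1 (i, j) x y) ^ 2 ≤ 4 * (M.hy / 2 * u.dfst 1 (i, j) x y) ^ 2
    linarith
  · change _ ≤ 4 * u.snd (i, j) x y ^ 2
    nlinarith [sq_nonneg (u.snd (i, j) x y)]
  · change (M.hx * u.dsnd 0 (i, j) x y) ^ 2 ≤ 4 * (M.hx / 2 * u.dsnd 0 (i, j) x y) ^ 2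
    linarith
  · change (M.hy * u.dsnd 1 (i, j) x y) ^ 2 ≤ 4 * (M.hy / 2 * u.dsnd 1 (i, j) x y) ^ 2
    linarith

section

variable {k Nx Ny : ℕ} [NeZero Nx] [NeZero Ny]

lemma H2D_add_smul_left (β₁ β₂ CCFL : ℝ) (M : Mesh2D Nx Ny) (u v φ : Space2D k Nx Ny) (a : ℝ) :
    H2D β₁ β₂ CCFL M (u + a • v) φ = H2D β₁ β₂ CCFL M u φ + a * H2D β₁ β₂ CCFL M v φ := by
  have hreg : ∀ t p q s p' q' s' : ℝ, t * p + q - s + a * (t * p' + q' - s') =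
      t * (p + a * p') + (q + a * q') - (s + a * s') := by intros; ring
  have hedge : ∑ i, ∑ j, edgeTerms β₁ β₂ M (u + a • v) φ i j =
      ∑ i, ∑ j, edgeTerms β₁ β₂ M u φ i j + a * ∑ i, ∑ j, edgeTerms β₁ β₂ M v φ i j := by
    simp only [edgeTerms_add_smul_left, Finset.sum_add_distrib, Finset.mul_sum]
  rw [H2D, H2D, H2D, hreg, ← M.integral_add_mul a ?_ ?_, ← M.integral_add_mul a ?_ ?_]
  · refine congrArg₂ (· - ·) (congrArg₂ (· + ·) (congrArg₂ (· * ·) rfl ?_) ?_) hedge <;>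
    · congr 1; ext _ _ _ _ _ _; simp only [fst_add_smul, snd_add_smul]; ring
  all_goals intro _ _; fun_prop

lemma H2D_add_smul_right (β₁ β₂ CCFL : ℝ) (M : Mesh2D Nx Ny) (u v φ : Space2D k Nx Ny) (a : ℝ) :
    H2D β₁ β₂ CCFL M φ (u + a • v) = H2D β₁ β₂ CCFL M φ u + a * H2D β₁ β₂ CCFL M φ v := by
  have hreg : ∀ t p q s p' q' s' : ℝ, t * p + q - s + a * (t * p' + q' - s') =
      t * (p + a * p') + (q + a * q') - (s + a * s') := by intros; ring
  have hedge : ∑ i, ∑ j, edgeTerms β₁ β₂ M φ (u + a • v) i j =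
      ∑ i, ∑ j, edgeTerms β₁ β₂ M φ u i j + a * ∑ i, ∑ j, edgeTerms β₁ β₂ M φ v i j := by
    simp only [edgeTerms_add_smul_right, Finset.sum_add_distrib, Finset.mul_sum]
  rw [H2D, H2D, H2D, hreg, ← M.integral_add_mul a ?_ ?_, ← M.integral_add_mul a ?_ ?_]
  · refine congrArg₂ (· - ·) (congrArg₂ (· + ·) (congrArg₂ (· * ·) rfl ?_) ?_) hedge <;>
    · congr 1; ext _ _ _ _ _ _
      simp only [fst_add_smul, snd_add_smul, dfst_add_smul, dsnd_add_smul]; ring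
  all_goals intro _ _; fun_prop

/-- On the diagonal the integrand of the transport terms is the derivative of a product on each
overlap, and the edge terms are its boundary values. -/
lemma integral_transport_eq_sum_edgeTerms (β₁ β₂ : ℝ) (M : Mesh2D Nx Ny) (u : Space2D k Nx Ny) :
    M.integral (fun c d ξ₁ ξ₂ η₁ η₂ =>
        u.snd d η₁ η₂ * (β₁ * u.dfst 0 c ξ₁ ξ₂ + β₂ * u.dfst 1 c ξ₁ ξ₂)
        + u.fst c ξ₁ ξ₂ * (β₁ * u.dsnd 0 d η₁ η₂ + β₂ * u.dsnd 1 d η₁ η₂)) =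
      ∑ i, ∑ j, edgeTerms β₁ β₂ M u u i j := by
  have hfst0 : ∀ c x y, HasDerivAt (fun s => u.fst c s y) (u.dfst 0 c x y) x := fun c x y =>
    MvPolynomial.hasDerivAt_eval_fst _ x y
  have hsnd0 : ∀ c x y, HasDerivAt (fun s => u.snd c s y) (u.dsnd 0 c x y) x := fun c x y =>
    MvPolynomial.hasDerivAt_eval_fst _ x y
  have hfst1 : ∀ c x y, HasDerivAt (fun t => u.fst c x t) (u.dfst 1 c x y) y := fun c x y =>
    MvPolynomial.hasDerivAt_eval_snd _ x y
  have hsnd1 : ∀ c x y, HasDerivAt (fun t => u.snd c x t) (u.dsnd 1 c x y) y := fun c x y =>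
    MvPolynomial.hasDerivAt_eval_snd _ x y
  set Fx : Fin Nx × Fin Ny → Fin Nx × Fin Ny → ℝ → ℝ → ℝ → ℝ → ℝ := fun c d ξ₁ ξ₂ η₁ η₂ =>
    β₁ * u.snd d η₁ η₂ * u.dfst 0 c ξ₁ ξ₂ + β₁ * u.fst c ξ₁ ξ₂ * u.dsnd 0 d η₁ η₂ with hFx
  set Fy : Fin Nx × Fin Ny → Fin Nx × Fin Ny → ℝ → ℝ → ℝ → ℝ → ℝ := fun c d ξ₁ ξ₂ η₁ η₂ =>
    β₂ * u.snd d η₁ η₂ * u.dfst 1 c ξ₁ ξ₂ + β₂ * u.fst c ξ₁ ξ₂ * u.dsnd 1 d η₁ η₂ with hFy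
  have hsplit : M.integral (fun c d ξ₁ ξ₂ η₁ η₂ =>
        u.snd d η₁ η₂ * (β₁ * u.dfst 0 c ξ₁ ξ₂ + β₂ * u.dfst 1 c ξ₁ ξ₂)
        + u.fst c ξ₁ ξ₂ * (β₁ * u.dsnd 0 d η₁ η₂ + β₂ * u.dsnd 1 d η₁ η₂)) =
      M.integral Fx + 1 * M.integral Fy := by
    rw [← M.integral_add_mul 1 (fun c d => by simp only [hFx]; fun_prop)
      (fun c d => by simp only [hFy]; fun_prop)]
    congr 1; ext c d ξ₁ ξ₂ η₁ η₂; simp only [hFx, hFy]; ring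
  have hy := sum_primalInt_primalInt_deriv M.hx M.hy
    (G := fun i i' ξ₁ η₁ j j' ξ₂ η₂ => β₂ * u.fst (i, j) ξ₁ ξ₂ * u.snd (i', j') η₁ η₂)
    (G' := fun i i' ξ₁ η₁ j j' ξ₂ η₂ => Fy (i, j) (i', j') ξ₁ ξ₂ η₁ η₂)
    (fun i i' x y j j' s ξ => by
      refine (((hfst1 (i, j) x ξ).const_mul β₂).mul
        ((hsnd1 (i', j') y (ξ + s)).comp_add_const ξ s)).congr_deriv ?_
      simp only [hFy]; ring)
    (fun i i' j j' => by fun_prop) (fun i i' j j' => by simp only [hFy]; fun_prop)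
  have hx := sum_primalInt_primalInt_deriv M.hy M.hx
    (G := fun j j' ξ₂ η₂ i i' ξ₁ η₁ => β₁ * u.fst (i, j) ξ₁ ξ₂ * u.snd (i', j') η₁ η₂)
    (G' := fun j j' ξ₂ η₂ i i' ξ₁ η₁ => Fx (i, j) (i', j') ξ₁ ξ₂ η₁ η₂)
    (fun j j' x y i i' s ξ => by
      refine (((hfst0 (i, j) ξ x).const_mul β₁).mul
        ((hsnd0 (i', j') (ξ + s) y).comp_add_const ξ s)).congr_deriv ?_
      simp only [hFx]; ring)
    (fun i i' j j' => by fun_prop) (fun i i' j j' => by simp only [hFx]; fun_prop)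
  have hx' : M.integral Fx = ∑ i, ∑ j, primalInt M.hy j fun j' ξ₂ η₂ =>
      primalInt M.hx i fun i' ξ₁ η₁ => Fx (i, j) (i', j') ξ₁ ξ₂ η₁ η₂ :=
    Finset.sum_congr rfl fun i _ => Finset.sum_congr rfl fun j _ =>
      primalInt_comm M.hx M.hy i j (F := fun i' j' ξ₁ η₁ ξ₂ η₂ => Fx (i, j) (i', j') ξ₁ ξ₂ η₁ η₂)
        fun i' j' => by simp only [hFx]; fun_prop
  have hy' : M.integral Fy = _ := hy
  rw [hsplit, hx', Finset.sum_comm, hx, hy', Finset.sum_comm, one_mul, ← Finset.sum_add_distrib]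
  refine Finset.sum_congr rfl fun i _ => ?_
  rw [← Finset.sum_add_distrib]
  refine Finset.sum_congr rfl fun j _ => ?_
  have hreg : ∀ {p q r s p' q' r' s' : ℝ}, q = q' → s = s' → p = p' → r = r' →
      q + s + (p + r) = p' + q' + r' + s' := by rintro _ _ _ _ _ _ _ _ rfl rfl rfl rfl; ring
  refine hreg ?_ rfl ?_ rfl <;>
  · congr 1; ext _ _ _; ring

lemma H2D_self (β₁ β₂ CCFL : ℝ) (M : Mesh2D Nx Ny) (u : Space2D k Nx Ny) :
    H2D β₁ β₂ CCFL M u u = -(1 / tauMax2D β₁ β₂ CCFL M.hx M.hy) *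
      M.integral (fun c d ξ₁ ξ₂ η₁ η₂ =>
        (u.fst c ξ₁ ξ₂ - u.snd d η₁ η₂) * (u.fst c ξ₁ ξ₂ - u.snd d η₁ η₂)) := by
  rw [H2D, integral_transport_eq_sum_edgeTerms, add_sub_assoc]
  exact add_eq_left.2 (sub_self _)

end

lemma one_div_tauMax2D (β₁ β₂ CCFL hx hy : ℝ) :
    1 / tauMax2D β₁ β₂ CCFL hx hy = (|β₁| / hx + |β₂| / hy) / CCFL := by
  rw [tauMax2D, one_div_div]

/-- The bound on `ℋ` before the shape regularity of the mesh is used. -/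
lemma exists_abs_H2D_le (k : ℕ) {CCFL : ℝ} (hCFL : 0 < CCFL) :
    ∃ C > 0, ∀ {Nx Ny : ℕ} [NeZero Nx] [NeZero Ny] (M : Mesh2D Nx Ny) (β₁ β₂ : ℝ)
      (u φ : Space2D k Nx Ny), |H2D β₁ β₂ CCFL M u φ| ≤
        (|β₁| / M.hx + |β₂| / M.hy) * C *
          (∑ i, ∑ j, localEnergy M u i j + ∑ i, ∑ j, localEnergy M φ i j) := by
  obtain ⟨C, hC, hloc⟩ := exists_local_bound_2D k
  refine ⟨(4 / CCFL + 10) * C, by positivity, fun {Nx Ny} _ _ M β₁ β₂ u φ => ?_⟩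
  have hhx := M.hx_pos
  have hhy := M.hy_pos
  set A : ℝ := C / (M.hx * M.hy) with hA
  have hA0 : 0 < A := by positivity
  set D : ℝ := |β₁| / M.hx + |β₂| / M.hy with hD
  have hD0 : 0 ≤ D := by positivity
  set s : ℝ := ∑ i, ∑ j, localEnergy M u i j + ∑ i, ∑ j, localEnergy M φ i j with hs
  set e : Fin Nx → Fin Ny → ℝ := fun i j => A * localEnergy M u i j + A * localEnergy M φ i j
    with he
  have hEu : ∀ i j, 0 ≤ A * localEnergy M u i j := fun i j =>
    mul_nonneg hA0.le (localEnergy_nonneg M u i j)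
  have hEφ : ∀ i j, 0 ≤ A * localEnergy M φ i j := fun i j =>
    mul_nonneg hA0.le (localEnergy_nonneg M φ i j)
  have hsum : ∑ i, ∑ j, e i j = A * s := by
    simp only [he, hs, Finset.sum_add_distrib, mul_add, Finset.mul_sum]
  have hlu := hloc M u
  have hlφ := hloc M φ
  have hzx : |(0 : ℝ)| ≤ M.hx / 2 := by rw [abs_zero]; linarith
  have hzy : |(0 : ℝ)| ≤ M.hy / 2 := by rw [abs_zero]; linarith
  have hex : |M.hx / 2| ≤ M.hx / 2 := by rw [abs_of_pos (by linarith)]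
  have hey : |M.hy / 2| ≤ M.hy / 2 := by rw [abs_of_pos (by linarith)]
  have hex' : |-(M.hx / 2)| ≤ M.hx / 2 := by rwa [abs_neg]
  have hey' : |-(M.hy / 2)| ≤ M.hy / 2 := by rwa [abs_neg]
  have h1 : |M.integral (fun c d ξ₁ ξ₂ η₁ η₂ =>
      (u.fst c ξ₁ ξ₂ - u.snd d η₁ η₂) * (φ.fst c ξ₁ ξ₂ - φ.snd d η₁ η₂))| ≤
      2 * (M.hx * M.hy) * ∑ i, ∑ j, 2 * e i j := by
    refine M.abs_integral_le (e := fun i j => 2 * e i j)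
      fun i j i' j' ξ₁ ξ₂ η₁ η₂ hξ₁ hξ₂ hη₁ hη₂ => ?_
    have b1 := (hlu i j ξ₁ ξ₂ hξ₁ hξ₂).1.1
    have b2 := (hlu i' j' η₁ η₂ hη₁ hη₂).2.1
    have b3 := (hlφ i j ξ₁ ξ₂ hξ₁ hξ₂).1.1
    have b4 := (hlφ i' j' η₁ η₂ hη₁ hη₂).2.1
    refine (abs_mul_le_add_of_sq_le (A := 2 * (A * localEnergy M u i j)
      + 2 * (A * localEnergy M u i' j')) (B := 2 * (A * localEnergy M φ i j)
      + 2 * (A * localEnergy M φ i' j')) ?_ ?_).trans_eq (by simp only [he]; ring)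
    · nlinarith [sq_nonneg (u.fst (i, j) ξ₁ ξ₂ + u.snd (i', j') η₁ η₂)]
    · nlinarith [sq_nonneg (φ.fst (i, j) ξ₁ ξ₂ + φ.snd (i', j') η₁ η₂)]
  have h2 : |M.integral (fun c d ξ₁ ξ₂ η₁ η₂ =>
        u.snd d η₁ η₂ * (β₁ * φ.dfst 0 c ξ₁ ξ₂ + β₂ * φ.dfst 1 c ξ₁ ξ₂)
        + u.fst c ξ₁ ξ₂ * (β₁ * φ.dsnd 0 d η₁ η₂ + β₂ * φ.dsnd 1 d η₁ η₂))| ≤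
      2 * (M.hx * M.hy) * ∑ i, ∑ j, D * e i j := by
    refine M.abs_integral_le (e := fun i j => D * e i j)
      fun i j i' j' ξ₁ ξ₂ η₁ η₂ hξ₁ hξ₂ hη₁ hη₂ => ?_
    have b1 := abs_mul_le_add_of_sq_le (hlu i' j' η₁ η₂ hη₁ hη₂).2.1
      (hlφ i j ξ₁ ξ₂ hξ₁ hξ₂).1.2.1
    have b2 := abs_mul_le_add_of_sq_le (hlu i' j' η₁ η₂ hη₁ hη₂).2.1
      (hlφ i j ξ₁ ξ₂ hξ₁ hξ₂).1.2.2
    have b3 := abs_mul_le_add_of_sq_le (hlu i j ξ₁ ξ₂ hξ₁ hξ₂).1.1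
      (hlφ i' j' η₁ η₂ hη₁ hη₂).2.2.1
    have b4 := abs_mul_le_add_of_sq_le (hlu i j ξ₁ ξ₂ hξ₁ hξ₂).1.1
      (hlφ i' j' η₁ η₂ hη₁ hη₂).2.2.2
    set U := u.snd (i', j') η₁ η₂
    set V := u.fst (i, j) ξ₁ ξ₂
    have hfac : U * (β₁ * φ.dfst 0 (i, j) ξ₁ ξ₂ + β₂ * φ.dfst 1 (i, j) ξ₁ ξ₂)
        + V * (β₁ * φ.dsnd 0 (i', j') η₁ η₂ + β₂ * φ.dsnd 1 (i', j') η₁ η₂) =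
        β₁ / M.hx * (U * (M.hx * φ.dfst 0 (i, j) ξ₁ ξ₂) + V * (M.hx * φ.dsnd 0 (i', j') η₁ η₂)) +
        β₂ / M.hy * (U * (M.hy * φ.dfst 1 (i, j) ξ₁ ξ₂) + V * (M.hy * φ.dsnd 1 (i', j') η₁ η₂)) := by
      field_simp; ring
    rw [hfac]
    refine (abs_add_le _ _).trans ?_
    rw [abs_mul, abs_mul, abs_div, abs_div, abs_of_pos hhx, abs_of_pos hhy, hD]
    have c1 : |U * (M.hx * φ.dfst 0 (i, j) ξ₁ ξ₂) + V * (M.hx * φ.dsnd 0 (i', j') η₁ η₂)| ≤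
        e i j + e i' j' := (abs_add_le _ _).trans (by simp only [he]; linarith)
    have c2 : |U * (M.hy * φ.dfst 1 (i, j) ξ₁ ξ₂) + V * (M.hy * φ.dsnd 1 (i', j') η₁ η₂)| ≤
        e i j + e i' j' := (abs_add_le _ _).trans (by simp only [he]; linarith)
    have := mul_le_mul_of_nonneg_left c1 (by positivity : 0 ≤ |β₁| / M.hx)
    have := mul_le_mul_of_nonneg_left c2 (by positivity : 0 ≤ |β₂| / M.hy)
    linarith
  -- A difference of two products with a common factor `β`, as in every edge integral.
  have hdiff : ∀ {β x y z w X Y : ℝ}, |x * y| ≤ X → |z * w| ≤ Y →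
      |β * x * y - β * z * w| ≤ |β| * (X + Y) := by
    intro β x y z w X Y hX hY
    rw [mul_assoc, mul_assoc, ← mul_sub, abs_mul]
    exact mul_le_mul_of_nonneg_left ((abs_sub _ _).trans (add_le_add hX hY)) (abs_nonneg _)
  have g1 := sum_abs_primalInt_le (B := |β₂|) (e := e) hhx.le
    (F := fun i j i' ξ η => β₂ * u.snd (i', j) η 0 * φ.fst (i, j) ξ (M.hy / 2)
      - β₂ * u.snd (i', j - 1) η 0 * φ.fst (i, j) ξ (-(M.hy / 2)))
    fun i j i' ξ η hξ hη => by
      refine (hdiff (abs_mul_le_add_of_sq_le (hlu i' j η 0 hη hzy).2.1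
        (hlφ i j ξ _ hξ hey).1.1) (abs_mul_le_add_of_sq_le (hlu i' (j - 1) η 0 hη hzy).2.1
        (hlφ i j ξ _ hξ hey').1.1)).trans ?_
      refine mul_le_mul_of_nonneg_left ?_ (abs_nonneg _)
      simp only [he]; linarith [hEu i j, hEφ i' j, hEφ i' (j - 1)]
  have g2 := sum_abs_primalInt_le (B := |β₁|) (e := fun j i => e i j) hhy.le
    (F := fun j i j' ξ η => β₁ * u.snd (i, j') 0 η * φ.fst (i, j) (M.hx / 2) ξ
      - β₁ * u.snd (i - 1, j') 0 η * φ.fst (i, j) (-(M.hx / 2)) ξ)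
    fun j i j' ξ η hξ hη => by
      refine (hdiff (abs_mul_le_add_of_sq_le (hlu i j' 0 η hzx hη).2.1
        (hlφ i j _ ξ hex hξ).1.1) (abs_mul_le_add_of_sq_le (hlu (i - 1) j' 0 η hzx hη).2.1
        (hlφ i j _ ξ hex' hξ).1.1)).trans ?_
      refine mul_le_mul_of_nonneg_left ?_ (abs_nonneg _)
      simp only [he]; linarith [hEu i j, hEφ i j', hEφ (i - 1) j']
  have g3 := sum_abs_dualInt_le (B := |β₂|) (e := e) hhx.le
    (F := fun i j i' ξ η => β₂ * u.fst (i', j + 1) ξ 0 * φ.snd (i, j) η (M.hy / 2)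
      - β₂ * u.fst (i', j) ξ 0 * φ.snd (i, j) η (-(M.hy / 2)))
    fun i j i' ξ η hξ hη => by
      refine (hdiff (abs_mul_le_add_of_sq_le (hlu i' (j + 1) ξ 0 hξ hzy).1.1
        (hlφ i j η _ hη hey).2.1) (abs_mul_le_add_of_sq_le (hlu i' j ξ 0 hξ hzy).1.1
        (hlφ i j η _ hη hey').2.1)).trans ?_
      refine mul_le_mul_of_nonneg_left ?_ (abs_nonneg _)
      simp only [he]; linarith [hEu i j, hEφ i' j, hEφ i' (j + 1)]
  have g4 := sum_abs_dualInt_le (B := |β₁|) (e := fun j i => e i j) hhy.le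
    (F := fun j i j' ξ η => β₁ * u.fst (i + 1, j') 0 ξ * φ.snd (i, j) (M.hx / 2) η
      - β₁ * u.fst (i, j') 0 ξ * φ.snd (i, j) (-(M.hx / 2)) η)
    fun j i j' ξ η hξ hη => by
      refine (hdiff (abs_mul_le_add_of_sq_le (hlu (i + 1) j' 0 ξ hzx hξ).1.1
        (hlφ i j _ η hex hη).2.1) (abs_mul_le_add_of_sq_le (hlu i j' 0 ξ hzx hξ).1.1
        (hlφ i j _ η hex' hη).2.1)).trans ?_
      refine mul_le_mul_of_nonneg_left ?_ (abs_nonneg _)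
      simp only [he]; linarith [hEu i j, hEφ i j', hEφ (i + 1) j']
  rw [Finset.sum_comm, Finset.sum_comm (f := fun j i => e i j), hsum] at g2 g4
  rw [hsum] at g1 g3
  have h3 : |∑ i, ∑ j, edgeTerms β₁ β₂ M u φ i j| ≤
      4 * M.hx * |β₂| * (A * s) + 4 * M.hy * |β₁| * (A * s) + 4 * M.hx * |β₂| * (A * s)
        + 4 * M.hy * |β₁| * (A * s) := by
    refine le_trans ?_ (add_le_add (add_le_add (add_le_add g1 g2) g3) g4)
    simp only [← Finset.sum_add_distrib]
    refine (Finset.abs_sum_le_sum_abs _ _).trans (Finset.sum_le_sum fun i _ =>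
      (Finset.abs_sum_le_sum_abs _ _).trans (Finset.sum_le_sum fun j _ => ?_))
    rw [edgeTerms]
    exact (abs_add_le _ _).trans (add_le_add ((abs_add_le _ _).trans
      (add_le_add (abs_add_le _ _) le_rfl)) le_rfl)
  have hτ : |-(1 / tauMax2D β₁ β₂ CCFL M.hx M.hy)| = D / CCFL := by
    rw [abs_neg, one_div_tauMax2D, abs_of_nonneg (by positivity)]
  have hH : |H2D β₁ β₂ CCFL M u φ| ≤ D / CCFL * (2 * (M.hx * M.hy) * ∑ i, ∑ j, 2 * e i j)
      + 2 * (M.hx * M.hy) * (∑ i, ∑ j, D * e i j)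
      + (4 * M.hx * |β₂| * (A * s) + 4 * M.hy * |β₁| * (A * s) + 4 * M.hx * |β₂| * (A * s)
        + 4 * M.hy * |β₁| * (A * s)) := by
    refine (abs_sub _ _).trans (add_le_add ((abs_add_le _ _).trans (add_le_add ?_ h2)) h3)
    rw [abs_mul, hτ]
    gcongr
  refine hH.trans_eq ?_
  simp only [← Finset.mul_sum]
  rw [hsum, hA, hD]
  field_simp
  ring

theorem exists_hasDissipativeOperator_2D (k : ℕ) (β₁ β₂ σ : ℝ) {CCFL : ℝ} (hCFL : 0 < CCFL) :
    ∃ K > 0, ∀ S ∈ cdgFamily2D k β₁ β₂ CCFL σ, HasDissipativeOperator S K := by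
  obtain ⟨_, -, hloc⟩ := exists_local_bound_2D k
  obtain ⟨C, hC, hbd⟩ := exists_abs_H2D_le k hCFL
  refine ⟨2 * (|σ| * (|β₁| + |β₂|) * C + 1), by positivity, ?_⟩
  rintro S ⟨Nx, Ny, hNx, hNy, M, hM, rfl⟩
  have hh := M.h_pos
  have hhx := M.hx_pos
  have hhy := M.hy_pos
  have hip : ∀ u : Space2D k Nx Ny, (cdg2D k β₁ β₂ CCFL M).ip u u =
      ∑ i, ∑ j, localEnergy M u i j := fun u => rfl
  have hipnn : ∀ u : Space2D k Nx Ny, 0 ≤ (cdg2D k β₁ β₂ CCFL M).ip u u := fun u => by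
    rw [hip]
    exact Finset.sum_nonneg fun i _ => Finset.sum_nonneg fun j _ => localEnergy_nonneg M u i j
  refine hasDissipativeOperator_of_bilinear (V := Space2D k Nx Ny)
    (ip := (cdg2D k β₁ β₂ CCFL M).ip) (H := H2D β₁ β₂ CCFL M) hh (by positivity) ?_ ?_ hipnn ?_
    (fun u v φ a => H2D_add_smul_left β₁ β₂ CCFL M u v φ a)
    (fun u v φ a => H2D_add_smul_right β₁ β₂ CCFL M u v φ a) ?_ ?_
  · intro u v
    simp only [cdg2D]
    congr 1; ext c d ξ₁ ξ₂ η₁ η₂; ring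
  · intro u v φ a
    simp only [cdg2D]
    rw [← M.integral_add_mul a (fun c d => by fun_prop) (fun c d => by fun_prop)]
    congr 1; ext c d ξ₁ ξ₂ η₁ η₂; rw [fst_add_smul, snd_add_smul]; ring
  · intro u hu
    have hE : ∀ i j, localEnergy M u i j = 0 := by
      rw [hip, Finset.sum_eq_zero_iff_of_nonneg fun i _ =>
        Finset.sum_nonneg fun j _ => localEnergy_nonneg M u i j] at hu
      intro i j
      exact (Finset.sum_eq_zero_iff_of_nonneg fun j _ => localEnergy_nonneg M u i j).1
        (hu i (Finset.mem_univ i)) j (Finset.mem_univ j)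
    have hpoly : ∀ p : MvPolynomial (Fin 2) ℝ, (∀ x y, |x| ≤ M.hx / 2 → |y| ≤ M.hy / 2 →
        MvPolynomial.eval ![x, y] p ^ 2 ≤ 0) → p = 0 := by
      intro p hp
      refine MvPolynomial.funext_set
        ![Set.Icc (-(M.hx / 2)) (M.hx / 2), Set.Icc (-(M.hy / 2)) (M.hy / 2)] ?_ fun v hv => ?_
      · intro i
        fin_cases i
        · exact Set.Icc_infinite (by linarith)
        · exact Set.Icc_infinite (by linarith)
      · have hv0 : |v 0| ≤ M.hx / 2 := abs_le.2 (hv 0 (Set.mem_univ _))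
        have hv1 : |v 1| ≤ M.hy / 2 := abs_le.2 (hv 1 (Set.mem_univ _))
        have h1 := hp (v 0) (v 1) hv0 hv1
        have hvv : ![v 0, v 1] = v := by ext i; fin_cases i <;> rfl
        rw [hvv] at h1
        rw [map_zero]
        exact pow_eq_zero_iff (two_ne_zero) |>.1 (le_antisymm h1 (sq_nonneg _))
    refine Prod.ext (funext fun c => Subtype.ext (hpoly _ fun x y hx hy => ?_))
      (funext fun c => Subtype.ext (hpoly _ fun x y hx hy => ?_))
    · have := (hloc M u c.1 c.2 x y hx hy).1.1
      rwa [hE, mul_zero] at this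
    · have := (hloc M u c.1 c.2 x y hx hy).2.1
      rwa [hE, mul_zero] at this
  · intro u
    rw [H2D_self, neg_mul, one_div_tauMax2D]
    refine neg_nonpos.2 (mul_nonneg (by positivity) (Finset.sum_nonneg fun i _ =>
      Finset.sum_nonneg fun j _ => primalInt_nonneg hhx.le i fun _ _ _ =>
        primalInt_nonneg hhy.le j fun _ _ _ => mul_self_nonneg _))
  · intro u φ
    refine (hbd M β₁ β₂ u φ).trans ?_
    rw [← hip, ← hip]
    refine mul_le_mul_of_nonneg_right ?_ (add_nonneg (hipnn u) (hipnn φ))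
    -- Shape regularity compares `1 / h_x` and `1 / h_y` with `1 / h`.
    have hσ : 0 < σ := by
      have h1 : 0 < σ * min M.hx M.hy := hh.trans_le hM
      exact pos_of_mul_pos_left h1 (lt_min hhx hhy).le
    have hinv : ∀ {t : ℝ}, 0 < t → min M.hx M.hy ≤ t → ∀ β : ℝ, |β| / t ≤ |σ| * |β| / M.h := by
      intro t ht hmin β
      rw [abs_of_pos hσ, div_le_div_iff₀ ht hh]
      have h1 : M.h ≤ σ * t := le_trans hM (by gcongr)
      calc |β| * M.h ≤ |β| * (σ * t) := by gcongr
        _ = _ := by ring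
    calc (|β₁| / M.hx + |β₂| / M.hy) * C
        ≤ (|σ| * |β₁| / M.h + |σ| * |β₂| / M.h) * C := by
          exact mul_le_mul_of_nonneg_right (add_le_add (hinv hhx (min_le_left _ _) β₁)
            (hinv hhy (min_le_right _ _) β₂)) hC.le
      _ = (|σ| * (|β₁| + |β₂|) * C) / M.h := by ring
      _ ≤ _ := by gcongr; linarith

end

end

theorem mainTheorem2
    (R : RKMethod) (r : ℕ) (hr : 1 ≤ r) (hR : R.HasOrder r)
    (m : ℕ) (α : ℕ → ℝ) (hα : IsEvolutionCoeff R m α)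
    (ζ ρ : ℕ) (hζ : IsTerminationIndex α ζ) (hρ : IsContributionIndex α ζ ρ)
    (k : ℕ) (β₁ β₂ CCFL σ : ℝ) (hCFL : 0 < CCFL)
    (𝓕 : Set SemiDiscretization)
    (h𝓕 : 𝓕 = cdgFamily1D k β₁ CCFL σ ∨ 𝓕 = cdgFamily2D k β₁ β₂ CCFL σ) :
    (ρ = ζ → aLow α ζ ζ ζ < 0 → MonotonicallyStable R m 𝓕) ∧
    (ρ = ζ → 0 < aLow α ζ ζ ζ → WeaklyStable (2 * ζ) R m 𝓕) ∧
    (ρ < ζ → WeaklyStable (2 * ρ + 1) R m 𝓕) := by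
  obtain ⟨K, hK, h⟩ : ∃ K > 0, ∀ S ∈ 𝓕, HasDissipativeOperator S K := by
    rcases h𝓕 with rfl | rfl
    · exact exists_hasDissipativeOperator_1D k β₁ σ hCFL
    · exact exists_hasDissipativeOperator_2D k β₁ β₂ σ hCFL
  exact stability_of_dissipative hr hR hα hζ hρ hK h
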